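/- Let $\Gamma$ be a finite group and $p$ a prime with $p\nmid|\Gamma|$. Let $V_1,\dots,V_c$ be the non-trivial irreducible representations of $\Gamma$ over $\mathbb{F}_p$ (one from each isomorphism class). Let $\kappa_i=\mathrm{End}_\Gamma(V_i)$ (a finite field), $q_i=|\kappa_i|$ and $n_i=\dim_{\kappa_i}V_i$. Let $\epsilon_i=-1$ if $(\wedge^2_{\kappa_i}V_i)^\Gamma\neq 0$, let $\epsilon_i=1$ if $(\wedge^2_{\kappa_i}V_i)^\Gamma=0$ but $(V_i\otimes_{\kappa_i}V_i)^\Gamma\neq 0$, and let $\epsilon_i=0$ if $(V_i\otimes_{\kappa_i}V_i)^\Gamma=0$. Let $u$ be a positive integer. Let $R_\Gamma$ be the set of isomorphism classes of finite dimensional representations $V$ of $\Gamma$ over $\mathbb{F}_p$ with $V^\Gamma=0$, with the $\sigma$-algebra of all subsets. Write $\mathrm{Sur}(X,V)$ for the set of surjective homomorphisms of $\Gamma$-representations $X\to V$, $\mathrm{Aut}(V)$ for the group of automorphisms of the representation $V$, and $\eta_q(m)=\prod_{\ell=1}^{m}(1-q^{-\ell})$ for $m\in\{0,1,2,\dots\}\cup\{\infty\}$.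 Call $V_i,V_j$ dual if $V_j\cong V_i^\vee$, and $V_i$ self-dual if $V_i\cong V_i^\vee$, as representations over $\mathbb{F}_p$. Then there is a unique measure $\nu$ on $R_\Gamma$ such that $$\int_{X\in R_\Gamma}|\mathrm{Sur}(X,V)|\,d\nu=\frac{|(\wedge^2_{\mathbb{F}_p}V)^\Gamma|}{|V|^u}\qquad\text{for every }V\in R_\Gamma .$$ For all non-negative integers $f_1,\dots,f_c$ and $V=\prod_i V_i^{f_i}$, we have $$\nu(\{V\})=\frac{|(\wedge^2_{\mathbb{F}_p}V)^\Gamma|}{|V|^u\,|\mathrm{Aut}(V)|}\prod_{\substack{i\\ V_i\text{ self-dual}}}\ \prod_{\ell\ge 0}\bigl(1+q_i^{-un_i-\frac{\epsilon_i+1}{2}-\ell}\bigr)^{-1}\prod_{\substack{i<j\\ V_i,V_j\text{ dual}}}\frac{\eta_{q_i}(\infty)\,\eta_{q_i}(2un_i)}{\eta_{q_i}(un_i-f_i+f_j)\,\eta_{q_i}(un_i+f_i-f_j)}$$ if $|f_i-f_j|\le un_i$ for all pairs of dual representations $V_i,V_j$, and $\nu(\{V\})=0$ otherwise. -/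

import Mathlib

open scoped TensorProduct MonoidAlgebra ENNReal

noncomputable section

namespace PTorsion

section General

variable {k G V : Type*} [CommRing k] [Group G] [AddCommGroup V] [Module k V]

/-- The action of `G` on the exterior square `⋀²_k V` of a representation `V` over `k`,
`g (v ∧ w) = g v ∧ g w`. -/
def exteriorSquare (ρ : Representation k G V) : Representation k G (⋀[k]^2 V) where
  toFun g := exteriorPower.map 2 (ρ g)
  map_one' := by
    rw [map_one]
    exact exteriorPower.map_id
  map_mul' g h := by
    rw [map_mul]
    exact exteriorPower.map_comp (ρ h) (ρ g)

end General

section EndRing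

variable {k G V : Type*} [Field k] [Group G] [AddCommGroup V] [Module k V]

/-- `End_G(V)`: the ring of `G`-equivariant `k`-linear endomorphisms of `V`. -/
def EndRing (ρ : Representation k G V) : Type _ := ρ.IntertwiningMap ρ

instance instRingEndRing (ρ : Representation k G V) : Ring (EndRing ρ) :=
  { (inferInstance : Semiring (ρ.IntertwiningMap ρ)),
    (inferInstance : AddCommGroup (ρ.IntertwiningMap ρ)) with }

/-- `V` is a module over `End_G(V)` by evaluation. -/
instance (ρ : Representation k G V) : Module (EndRing ρ) V where
  smul f v := f.toLinearMap v
  one_smul _ := rfl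
  mul_smul _ _ _ := rfl
  smul_zero f := f.toLinearMap.map_zero
  smul_add f := f.toLinearMap.map_add
  add_smul _ _ _ := rfl
  zero_smul _ := rfl

theorem EndRing.smul_def (ρ : Representation k G V) (f : EndRing ρ) (v : V) :
    f • v = f.toLinearMap v := rfl

/-- The endomorphism ring of a finite irreducible representation is commutative
(Schur's lemma and Wedderburn's little theorem). -/
theorem EndRing.mul_comm' (ρ : Representation k G V) [ρ.IsIrreducible] [Finite V]
    (a b : EndRing ρ) : a * b = b * a := by
  classical
  have : Finite ρ.asModule := inferInstanceAs (Finite V)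
  have : Finite (Module.End k[G] ρ.asModule) :=
    Finite.of_injective (fun f => (f : ρ.asModule → ρ.asModule)) DFunLike.coe_injective
  let e := Representation.IntertwiningMap.equivAlgEnd ρ
  apply e.injective
  have h : ∀ x y : Module.End k[G] ρ.asModule, x * y = y * x := fun x y =>
    (littleWedderburn (Module.End k[G] ρ.asModule)).mul_comm x y
  exact (map_mul e a b).trans ((h _ _).trans (map_mul e b a).symm)

instance instCommRingEndRing (ρ : Representation k G V) [ρ.IsIrreducible] [Finite V] :
    CommRing (EndRing ρ) :=
  { instRingEndRing ρ with mul_comm := EndRing.mul_comm' ρ }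

/-- An irreducible representation `V`, regarded as a representation over `κ = End_G(V)`. -/
def overEnd (ρ : Representation k G V) [ρ.IsIrreducible] [Finite V] :
    Representation (EndRing ρ) G V where
  toFun g :=
    { toFun := ρ g
      map_add' := (ρ g).map_add
      map_smul' := fun f v =>
        (Representation.IntertwiningMap.isIntertwining ρ ρ f g v).symm }
  map_one' := by
    ext v
    exact congrArg (fun φ : V →ₗ[k] V => φ v) ρ.map_one
  map_mul' g h := by
    ext v
    exact congrArg (fun φ : V →ₗ[k] V => φ v) (ρ.map_mul g h)

open Classical in
/-- The sign `ε` of an irreducible representation `V`, with `κ = End_G(V)`: it is `-1` if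
`(⋀²_κ V)^G ≠ 0`; it is `1` if `(⋀²_κ V)^G = 0` but `(V ⊗_κ V)^G ≠ 0`; and it is `0` if
`(V ⊗_κ V)^G = 0`. -/
def eps (ρ : Representation k G V) [ρ.IsIrreducible] [Finite V] : ℤ :=
  if (exteriorSquare (overEnd ρ)).invariants ≠ ⊥ then -1
  else if ((overEnd ρ).tprod (overEnd ρ)).invariants ≠ ⊥ then 1
  else 0

end EndRing

/-- A finite dimensional representation of `Γ` over `F_p`. -/
structure FinRep (p : ℕ) [Fact p.Prime] (Γ : Type*) [Group Γ] where
  carrier : Type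
  [addCommGroup : AddCommGroup carrier]
  [module : Module (ZMod p) carrier]
  [finite : Finite carrier]
  ρ : Representation (ZMod p) Γ carrier

attribute [instance] FinRep.addCommGroup FinRep.module FinRep.finite

section Reps

variable {p : ℕ} [Fact p.Prime] {Γ : Type*} [Group Γ]

namespace FinRep

/-- Isomorphism of representations. -/
def Iso (V W : FinRep p Γ) : Prop := Nonempty (V.ρ.Equiv W.ρ)

/-- `W` is isomorphic to the dual representation of `V`. -/
def IsDual (V W : FinRep p Γ) : Prop := Nonempty (V.ρ.dual.Equiv W.ρ)

/-- `q = |End_Γ(V)|`. -/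
def q (V : FinRep p Γ) : ℕ := Nat.card (EndRing V.ρ)

/-- `n = dim_κ V` with `κ = End_Γ(V)`. -/
def n (V : FinRep p Γ) : ℕ := Module.finrank (EndRing V.ρ) V.carrier

/-- `|Aut(V)|`. -/
def cardAut (V : FinRep p Γ) : ℕ := Nat.card (V.ρ.Equiv V.ρ)

/-- `|(⋀²_{F_p} V)^Γ|`. -/
def cardWedgeInv (V : FinRep p Γ) : ℕ := Nat.card (exteriorSquare V.ρ).invariants

/-- `|Sur(X, V)|`, the number of surjective `Γ`-equivariant linear maps `X → V`. -/
def cardSur (X V : FinRep p Γ) : ℕ :=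
  Nat.card {φ : X.ρ.IntertwiningMap V.ρ // Function.Surjective φ}

/-- The product `∏_i V_i^{f_i}` with the componentwise action. -/
def prodPow {c : ℕ} (W : Fin c → FinRep p Γ) (f : Fin c → ℕ) : FinRep p Γ where
  carrier := ∀ i : Fin c, Fin (f i) → (W i).carrier
  ρ :=
    { toFun := fun g =>
        { toFun := fun x i a => (W i).ρ g (x i a)
          map_add' := fun x y => by ext i a; simp
          map_smul' := fun r x => by ext i a; simp }
      map_one' := by ext x i a; simp
      map_mul' := fun g h => by
        apply LinearMap.ext
        intro x
        funext i a
        simp }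

theorem invariants_eq_bot (V : FinRep p Γ) [V.ρ.IsIrreducible] (h : ¬ V.ρ.IsTrivial) :
    V.ρ.invariants = ⊥ := by
  let S : Subrepresentation V.ρ :=
    ⟨V.ρ.invariants, fun g v hv => by
      have h1 : V.ρ g v = v := hv g
      rw [h1]
      exact hv⟩
  rcases IsSimpleOrder.eq_bot_or_eq_top S with hS | hS
  · exact congrArg Subrepresentation.toSubmodule hS
  · exact absurd ⟨fun g => by
      ext v
      have hv : v ∈ S := by rw [hS]; trivial
      exact hv g⟩ h

theorem prodPow_invariants {c : ℕ} (W : Fin c → FinRep p Γ) (f : Fin c → ℕ)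
    (h : ∀ i, (W i).ρ.invariants = ⊥) : (prodPow W f).ρ.invariants = ⊥ := by
  rw [eq_bot_iff]
  intro x hx
  have hx0 : x = 0 := by
    funext i a
    have : x i a ∈ (W i).ρ.invariants := fun g => congrFun (congrFun (hx g) i) a
    rw [h i] at this
    exact this
  exact hx0

theorem Iso.cardSur_eq {X Y : FinRep p Γ} (h : Iso X Y) (V : FinRep p Γ) :
    cardSur X V = cardSur Y V := by
  obtain ⟨e⟩ := h
  refine Nat.card_congr
    { toFun := fun φ => ⟨φ.1.comp e.symm.toIntertwiningMap, ?_⟩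
      invFun := fun φ => ⟨φ.1.comp e.toIntertwiningMap, ?_⟩
      left_inv := ?_
      right_inv := ?_ }
  · exact φ.2.comp e.symm.toLinearEquiv.surjective
  · exact φ.2.comp e.toLinearEquiv.surjective
  · intro φ
    apply Subtype.ext
    apply DFunLike.ext
    intro x
    exact congrArg φ.1 (e.toLinearEquiv.symm_apply_apply x)
  · intro φ
    apply Subtype.ext
    apply DFunLike.ext
    intro x
    exact congrArg φ.1 (e.toLinearEquiv.apply_symm_apply x)

end FinRep

/-- Isomorphism as an equivalence relation on the representations `V` with `V^Γ = 0`. -/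
def isoSetoid (p : ℕ) [Fact p.Prime] (Γ : Type*) [Group Γ] :
    Setoid {V : FinRep p Γ // V.ρ.invariants = ⊥} where
  r V W := FinRep.Iso V.1 W.1
  iseqv :=
    { refl := fun V => ⟨Representation.Equiv.refl V.1.ρ⟩
      symm := fun ⟨e⟩ => ⟨e.symm⟩
      trans := fun ⟨e⟩ ⟨e'⟩ => ⟨e.trans e'⟩ }

/-- `R_Γ`: the set of isomorphism classes of finite dimensional representations `V` of `Γ` over
`F_p` with `V^Γ = 0`. -/
def RGamma (p : ℕ) [Fact p.Prime] (Γ : Type*) [Group Γ] := Quotient (isoSetoid p Γ)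

/-- Every subset of `R_Γ` is measurable. -/
instance : MeasurableSpace (RGamma p Γ) := ⊤

/-- The isomorphism class of `V` in `R_Γ`. -/
def isoClass (V : FinRep p Γ) (hV : V.ρ.invariants = ⊥) : RGamma p Γ :=
  Quotient.mk (isoSetoid p Γ) ⟨V, hV⟩

/-- `|Sur(X, V)|` as a function of the isomorphism class `X ∈ R_Γ`. -/
def RGamma.cardSur (X : RGamma p Γ) (V : FinRep p Γ) : ℕ :=
  Quotient.lift (s := isoSetoid p Γ) (fun Y => FinRep.cardSur Y.1 V)
    (fun _ _ h => FinRep.Iso.cardSur_eq h V) X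

/-- The measure `ν` on `R_Γ` satisfies `∫ |Sur(X, V)| dν = |(⋀²_{F_p} V)^Γ| / |V|^u` for every
`V ∈ R_Γ`. -/
def HasMoments (u : ℕ) (ν : MeasureTheory.Measure (RGamma p Γ)) : Prop :=
  ∀ V : FinRep p Γ, V.ρ.invariants = ⊥ →
    ∫⁻ X, (X.cardSur V : ℝ≥0∞) ∂ν =
      (V.cardWedgeInv : ℝ≥0∞) / (Nat.card V.carrier : ℝ≥0∞) ^ u

/-- `W_1, …, W_c` is a complete list, without repetition up to isomorphism, of the non-trivial
irreducible representations of `Γ` over `F_p`. -/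
structure IsListOfNontrivialIrreps {c : ℕ} (W : Fin c → FinRep p Γ) : Prop where
  irreducible : ∀ i, (W i).ρ.IsIrreducible
  nontrivial : ∀ i, ¬ (W i).ρ.IsTrivial
  distinct : ∀ i j, FinRep.Iso (W i) (W j) → i = j
  exhaustive : ∀ V : FinRep p Γ, V.ρ.IsIrreducible → ¬ V.ρ.IsTrivial →
    ∃ i, FinRep.Iso V (W i)

theorem IsListOfNontrivialIrreps.prodPow_invariants {c : ℕ} {W : Fin c → FinRep p Γ}
    (hW : IsListOfNontrivialIrreps W) (f : Fin c → ℕ) :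
    (FinRep.prodPow W f).ρ.invariants = ⊥ :=
  FinRep.prodPow_invariants W f fun i =>
    have := hW.irreducible i
    FinRep.invariants_eq_bot (W i) (hW.nontrivial i)

/-- `η_q(m) = ∏_{ℓ=1}^m (1 - q^{-ℓ})`. -/
def eta (q m : ℕ) : ℝ := ∏ ℓ ∈ Finset.Icc 1 m, (1 - ((q : ℝ) ^ ℓ)⁻¹)

/-- `η_q(∞) = ∏_{ℓ=1}^∞ (1 - q^{-ℓ})`. -/
def etaInf (q : ℕ) : ℝ := ∏' ℓ : ℕ, (1 - ((q : ℝ) ^ (ℓ + 1))⁻¹)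

/-- The factor `∏_{ℓ≥0} (1 + q^{-un-(ε+1)/2-ℓ})⁻¹` attached to a self-dual irreducible `V`. -/
def selfDualFactor (u : ℕ) (V : FinRep p Γ) [V.ρ.IsIrreducible] : ℝ :=
  ∏' ℓ : ℕ,
    (1 + (V.q : ℝ) ^ (-((u * V.n : ℕ) : ℝ) - ((eps V.ρ : ℝ) + 1) / 2 - (ℓ : ℝ)))⁻¹

/-- The factor `η_q(∞) η_q(2un) / (η_q(un - a + b) η_q(un + a - b))`, with `q = q_V` and `n = n_V`,
attached to a pair of non-isomorphic dual irreducibles `V, V'` occurring with multiplicities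
`a, b`. It is used only when `|a - b| ≤ un`, so the subtractions do not truncate. -/
def dualPairFactor (u : ℕ) (V : FinRep p Γ) (a b : ℕ) : ℝ :=
  etaInf V.q * eta V.q (2 * (u * V.n)) /
    (eta V.q (u * V.n + b - a) * eta V.q (u * V.n + a - b))

open Classical in
/-- The value of the measure at `V = ∏_i W_i^{f_i}` when `|f_i - f_j| ≤ u n_i` for all dual pairs.
-/
def massFormula (u : ℕ) {c : ℕ} (W : Fin c → FinRep p Γ)
    (hW : ∀ i, (W i).ρ.IsIrreducible) (f : Fin c → ℕ) : ℝ :=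
  ((FinRep.prodPow W f).cardWedgeInv : ℝ) /
      ((Nat.card (FinRep.prodPow W f).carrier : ℝ) ^ u * ((FinRep.prodPow W f).cardAut : ℝ)) *
    (∏ i : Fin c with FinRep.IsDual (W i) (W i), selfDualFactor u (W i)) *
    ∏ ij : Fin c × Fin c with ij.1 < ij.2 ∧ FinRep.IsDual (W ij.1) (W ij.2),
      dualPairFactor u (W ij.1) (f ij.1) (f ij.2)

end Reps

end PTorsion

end

/-! Since `p ∤ |Γ|`, representations are semisimple, so the points of `R_Γ` are the multiplicity
vectors `f`, and the theorem becomes a countable linear system. By Schur's lemma the number of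
surjections from `∏ V_i^{e_i}` onto `∏ V_i^{f_i}` is `∏ surjCount q_i e_i f_i`. Averaging over `Γ`
identifies `|(⋀² V)^Γ|` with the number of invariant alternating forms, whose logarithm is quadratic
in `f`. Hence moments and proposed masses split as products over self-dual irreducibles and over
dual pairs.

Two computations show that the proposed masses have the right moments. Both substitute `e = f + g`,
and `surjCount_add` separates the variables. For a self-dual irreducible the remaining sum is
Euler's series for `∏ (1 + z Q^l)` with `Q = 1/q` and `z = s/q^{un+1}`, where `s` is the number of
invariant alternating forms on it. For a dual pair the double sum is done by the `q`-Vandermonde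
identity and then its Cauchy limit (`tsum_pairExp`).

Uniqueness is a triangular inversion. The alternating coefficients `invCoeff` satisfy `∑_g coeff g *
surj x g = δ_{x,0}`, so applying them to the moments at `f + g`, rescaled by `q^{fg}`, isolates the
mass at `f` (`mass_eq_of_moments`). The interchange of sums is legitimate because the moments grow
slowly enough (`summable_shiftMoment`).

The sign `ε` enters only through `s = q^{(1-ε)/2}` (`cardAlt_of_eps`). A non-zero invariant form `B`
on a self-dual `V` identifies all invariant forms with `κ = End_Γ(V)` and gives an adjoint
involution `σ` of `κ`. If `σ = 1` then `B` comes from a `κ`-bilinear form and `s` is `q` or `1`; if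
`σ ≠ 1` the form is of hermitian type, `ε = 0` and `s² = q`. The vanishing outside `|f_i - f_j| ≤
un_i` comes from the convention that `1/(Q;Q)_m` is zero for `m < 0`. -/

section

open Finset Filter Topology

/-! ### Identities for `q`-series -/

/-- The finite `q`-Pochhammer symbol `(Q; Q)_n`. -/
noncomputable def qPoch (Q : ℝ) (n : ℕ) : ℝ := ∏ l ∈ range n, (1 - Q ^ (l + 1))

/-- `1 / (Q; Q)_n`, extended by zero to negative `n`. -/
noncomputable def qPochInv (Q : ℝ) (n : ℤ) : ℝ := if 0 ≤ n then (qPoch Q n.toNat)⁻¹ else 0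

/-- The infinite product `(Q; Q)_∞`. -/
noncomputable def qPochInf (Q : ℝ) : ℝ := ∏' l : ℕ, (1 - Q ^ (l + 1))

section QSeries

variable {Q : ℝ}

lemma qPoch_succ (n : ℕ) : qPoch Q (n + 1) = qPoch Q n * (1 - Q ^ (n + 1)) := by
  simp [qPoch, prod_range_succ]

lemma one_sub_pow_pos (h0 : 0 < Q) (h1 : Q < 1) (n : ℕ) : 0 < 1 - Q ^ (n + 1) := by
  have : Q ^ (n + 1) < 1 := pow_lt_one₀ h0.le h1 (by simp)
  linarith

lemma qPoch_pos (h0 : 0 < Q) (h1 : Q < 1) (n : ℕ) : 0 < qPoch Q n :=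
  prod_pos fun l _ => one_sub_pow_pos h0 h1 l

lemma qPoch_antitone (h0 : 0 < Q) (h1 : Q < 1) : Antitone (qPoch Q) := by
  refine antitone_nat_of_succ_le fun n => ?_
  rw [qPoch_succ]
  have := qPoch_pos h0 h1 n
  have := pow_pos h0 (n + 1)
  nlinarith

lemma multipliable_qPoch (h0 : 0 < Q) (h1 : Q < 1) :
    Multipliable fun l : ℕ => (1 - Q ^ (l + 1)) := by
  have hs : Summable fun l : ℕ => ‖-Q ^ (l + 1)‖ := by
    simp only [norm_neg, norm_pow, Real.norm_of_nonneg h0.le]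
    exact (summable_nat_add_iff 1).2 (summable_geometric_of_lt_one h0.le h1)
  simpa [sub_eq_add_neg] using multipliable_one_add_of_summable hs

lemma tendsto_qPoch (h0 : 0 < Q) (h1 : Q < 1) :
    Tendsto (qPoch Q) atTop (𝓝 (qPochInf Q)) :=
  (multipliable_qPoch h0 h1).hasProd.tendsto_prod_nat

lemma qPochInf_le (h0 : 0 < Q) (h1 : Q < 1) (n : ℕ) : qPochInf Q ≤ qPoch Q n :=
  (qPoch_antitone h0 h1).le_of_tendsto (tendsto_qPoch h0 h1) n

lemma qPochInf_pos (h0 : 0 < Q) (h1 : Q < 1) : 0 < qPochInf Q := by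
  have hne : qPochInf Q ≠ 0 := by
    have hs : Summable fun l : ℕ => ‖-Q ^ (l + 1)‖ := by
      simp only [norm_neg, norm_pow, Real.norm_of_nonneg h0.le]
      exact (summable_nat_add_iff 1).2 (summable_geometric_of_lt_one h0.le h1)
    have := tprod_one_add_ne_zero_of_summable (f := fun l : ℕ => -Q ^ (l + 1))
      (fun i => by
        have := one_sub_pow_pos h0 h1 i
        rw [← sub_eq_add_neg]; exact this.ne') hs
    simpa [sub_eq_add_neg, qPochInf] using this
  have hge : 0 ≤ qPochInf Q :=
    ge_of_tendsto' (tendsto_qPoch h0 h1) fun n => (qPoch_pos h0 h1 n).le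
  exact lt_of_le_of_ne hge hne.symm

lemma qPochInv_natCast (n : ℕ) : qPochInv Q n = (qPoch Q n)⁻¹ := by simp [qPochInv]

lemma qPochInv_of_neg {n : ℤ} (h : n < 0) : qPochInv Q n = 0 := by simp [qPochInv, h]

lemma qPochInv_nonneg (h0 : 0 < Q) (h1 : Q < 1) (n : ℤ) : 0 ≤ qPochInv Q n := by
  unfold qPochInv
  split_ifs
  · exact (inv_pos.2 (qPoch_pos h0 h1 _)).le
  · exact le_rfl

lemma qPochInv_le (h0 : 0 < Q) (h1 : Q < 1) (n : ℤ) : qPochInv Q n ≤ (qPochInf Q)⁻¹ := by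
  unfold qPochInv
  split_ifs
  · exact inv_anti₀ (qPochInf_pos h0 h1) (qPochInf_le h0 h1 _)
  · exact (inv_pos.2 (qPochInf_pos h0 h1)).le

/-- The recursion persists for `n ≤ 0` because `1 - Q^0 = 0`. So the extension by zero lets
summation identities be proved without boundary terms. -/
lemma qPochInv_pred (h0 : 0 < Q) (h1 : Q < 1) (n : ℤ) :
    (1 - Q ^ n) * qPochInv Q n = qPochInv Q (n - 1) := by
  rcases lt_trichotomy n 0 with h | rfl | h
  · rw [qPochInv_of_neg h, qPochInv_of_neg (by omega), mul_zero]
  · rw [qPochInv_of_neg (show (0 : ℤ) - 1 < 0 by norm_num)]; simp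
  · obtain ⟨m, rfl⟩ : ∃ m : ℕ, n = (m + 1 : ℕ) := ⟨(n - 1).toNat, by omega⟩
    have : ((m + 1 : ℕ) : ℤ) - 1 = (m : ℕ) := by push_cast; ring
    rw [this, qPochInv_natCast, qPochInv_natCast, qPoch_succ, zpow_natCast]
    have h2 := (one_sub_pow_pos h0 h1 m).ne'
    have h3 := (qPoch_pos h0 h1 m).ne'
    field_simp

lemma tendsto_qPochInv_sub (h0 : 0 < Q) (h1 : Q < 1) (j : ℤ) :
    Tendsto (fun n : ℕ => qPochInv Q (n + j)) atTop (𝓝 (qPochInf Q)⁻¹) := by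
  have ht := (tendsto_qPoch h0 h1).inv₀ (qPochInf_pos h0 h1).ne'
  have hm : Tendsto (fun n : ℕ => ((n : ℤ) + j).toNat) atTop atTop := by
    refine tendsto_atTop.2 fun b => ?_
    filter_upwards [eventually_ge_atTop (b + j.natAbs)] with n hn
    omega
  refine (ht.comp hm).congr' ?_
  filter_upwards [eventually_ge_atTop j.natAbs] with n hn
  have : 0 ≤ (n : ℤ) + j := by omega
  simp [qPochInv, this]

/-- A form of the `q`-Vandermonde identity. -/
lemma sum_qPochInv (h0 : 0 < Q) (h1 : Q < 1) (n : ℕ) (s : ℤ) :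
    ∑ j ∈ range (n + 1), Q ^ ((j : ℤ) * (j + s)) * qPochInv Q j * qPochInv Q (n - j) *
      qPochInv Q (s + j) = qPochInv Q n * qPochInv Q (n + s) := by
  have hQ := h0.ne'
  induction n generalizing s with
  | zero => simp [qPochInv, qPoch]
  | succ n ih =>
    have hpos := one_sub_pow_pos h0 h1 n
    refine mul_left_cancel₀ hpos.ne' ?_
    -- Split `1 - Q^(n+1) = (1 - Q^(n+1-j)) + Q^(n+1-j) (1 - Q^j)`; each bracket lowers one index by
    -- `qPochInv_pred`.
    have key : ∀ j : ℕ, (1 - Q ^ (n + 1)) * (Q ^ ((j : ℤ) * (j + s)) * qPochInv Q j *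
        qPochInv Q ((n + 1 : ℕ) - j) * qPochInv Q (s + j)) =
        Q ^ ((j : ℤ) * (j + s)) * qPochInv Q j * qPochInv Q (n - j) * qPochInv Q (s + j) +
        Q ^ ((j : ℤ) * (j + s) + n + 1 - j) * qPochInv Q (j - 1) * qPochInv Q ((n + 1 : ℕ) - j) *
          qPochInv Q (s + j) := by
      intro j
      have e1 := qPochInv_pred h0 h1 (((n + 1 : ℕ) : ℤ) - j)
      have e2 := qPochInv_pred h0 h1 (j : ℤ)
      have e3 : (((n + 1 : ℕ) : ℤ) - j) - 1 = n - j := by push_cast; ring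
      rw [e3] at e1
      rw [← e1, ← e2]
      have e4 : Q ^ ((j : ℤ) * (j + s) + n + 1 - j) =
          Q ^ ((j : ℤ) * (j + s)) * Q ^ (((n + 1 : ℕ) : ℤ) - j) := by
        rw [← zpow_add₀ hQ]; congr 1; push_cast; ring
      have e5 : Q ^ (n + 1) = Q ^ (((n + 1 : ℕ) : ℤ) - j) * Q ^ (j : ℤ) := by
        rw [← zpow_add₀ hQ, ← zpow_natCast]; congr 1; ring
      rw [e4, e5]
      ring
    rw [mul_sum, sum_congr rfl fun j _ => key j, sum_add_distrib, sum_range_succ, ih s,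
      qPochInv_of_neg (show (n : ℤ) - (n + 1 : ℕ) < 0 by push_cast; omega), sum_range_succ',
      qPochInv_of_neg (show ((0 : ℕ) : ℤ) - 1 < 0 by norm_num)]
    -- The end terms at `j = n + 1` and `j = 0` have dropped out. After the shift `j ↦ j + 1` the
    -- second sum is the case `n` with `s + 1`.
    have key2 : ∀ j : ℕ, Q ^ (((j + 1 : ℕ) : ℤ) * ((j + 1 : ℕ) + s) + n + 1 - (j + 1 : ℕ)) *
        qPochInv Q ((j + 1 : ℕ) - 1) * qPochInv Q ((n + 1 : ℕ) - (j + 1 : ℕ)) *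
          qPochInv Q (s + (j + 1 : ℕ)) =
        Q ^ ((n : ℤ) + 1 + s) * (Q ^ ((j : ℤ) * (j + (s + 1))) * qPochInv Q j *
          qPochInv Q (n - j) * qPochInv Q ((s + 1) + j)) := by
      intro j
      have e1 : ((j + 1 : ℕ) : ℤ) - 1 = j := by push_cast; ring
      have e2 : ((n + 1 : ℕ) : ℤ) - (j + 1 : ℕ) = n - j := by push_cast; ring
      have e3 : s + (j + 1 : ℕ) = (s + 1) + j := by push_cast; ring
      have e4 : ((j + 1 : ℕ) : ℤ) * ((j + 1 : ℕ) + s) + n + 1 - (j + 1 : ℕ) =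
          ((n : ℤ) + 1 + s) + (j : ℤ) * (j + (s + 1)) := by push_cast; ring
      rw [e1, e2, e3, e4, zpow_add₀ hQ]
      ring
    rw [sum_congr rfl fun j _ => key2 j, ← mul_sum, ih (s + 1)]
    have f1 := qPochInv_pred h0 h1 ((n + 1 : ℕ) : ℤ)
    have f2 := qPochInv_pred h0 h1 ((n : ℤ) + 1 + s)
    have e1 : ((n + 1 : ℕ) : ℤ) - 1 = n := by push_cast; ring
    have e2 : (n : ℤ) + 1 + s - 1 = n + s := by ring
    have e3 : (n : ℤ) + (s + 1) = n + 1 + s := by ring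
    rw [e1, zpow_natCast] at f1
    rw [e2] at f2
    have e4 : ((n + 1 : ℕ) : ℤ) + s = n + 1 + s := by push_cast; ring
    rw [e3, e4]
    linear_combination (-qPochInv Q n) * f2 - qPochInv Q (n + 1 + s) * f1

lemma summable_zpow_quadratic (h0 : 0 < Q) (h1 : Q < 1) (s : ℤ) :
    Summable fun j : ℕ => Q ^ ((j : ℤ) * (j + s)) := by
  refine Summable.of_norm_bounded_eventually_nat (g := fun j : ℕ => Q ^ j)
    (summable_geometric_of_lt_one h0.le h1) ?_
  filter_upwards [eventually_ge_atTop (s.natAbs + 1)] with j hj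
  rw [Real.norm_of_nonneg (zpow_nonneg h0.le _), ← zpow_natCast]
  refine zpow_le_zpow_right_of_le_one₀ h0 h1.le ?_
  have : (1 : ℤ) ≤ j + s := by omega
  nlinarith

/-- A two-sided form of Cauchy's identity. -/
lemma hasSum_qPochInv (h0 : 0 < Q) (h1 : Q < 1) (s : ℤ) :
    HasSum (fun j : ℕ => Q ^ ((j : ℤ) * (j + s)) * qPochInv Q j * qPochInv Q (s + j))
      (qPochInf Q)⁻¹ := by
  set C := (qPochInf Q)⁻¹ with hC
  have hCpos : 0 < C := inv_pos.2 (qPochInf_pos h0 h1)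
  have hn := qPochInv_nonneg h0 h1
  have hl := qPochInv_le h0 h1
  have hz : ∀ j : ℕ, 0 ≤ Q ^ ((j : ℤ) * (j + s)) := fun j => zpow_nonneg h0.le _
  have hsum : Summable fun j : ℕ => Q ^ ((j : ℤ) * (j + s)) * qPochInv Q j * qPochInv Q (s + j) := by
    refine Summable.of_nonneg_of_le (fun j => ?_) (fun j => ?_)
      (((summable_zpow_quadratic h0 h1 s).mul_right C).mul_right C)
    · exact mul_nonneg (mul_nonneg (hz j) (hn _)) (hn _)
    · have := hz j
      have := hn j
      gcongr
      · exact hn _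
      · exact hl _
      · exact hl _
  have hbound : Summable fun j : ℕ => Q ^ ((j : ℤ) * (j + s)) * C * C * C :=
    (((summable_zpow_quadratic h0 h1 s).mul_right C).mul_right C).mul_right C
  -- Let `n → ∞` in the `q`-Vandermonde identity. Both sides acquire a spare factor `C`, which is
  -- cancelled at the end.
  have hlim := tendsto_tsum_of_dominated_convergence (𝓕 := atTop)
    (f := fun (n : ℕ) (j : ℕ) => Q ^ ((j : ℤ) * (j + s)) * qPochInv Q j * qPochInv Q (n + -j) *
      qPochInv Q (s + j))
    (g := fun j : ℕ => Q ^ ((j : ℤ) * (j + s)) * qPochInv Q j * C * qPochInv Q (s + j)) hbound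
    (fun j => ((tendsto_qPochInv_sub h0 h1 (-j)).const_mul _).mul_const _)
    (Eventually.of_forall fun n j => by
      have := hz j
      have := hn j
      have := hn (n + -j)
      have := hn (s + j)
      rw [Real.norm_of_nonneg (by positivity)]
      gcongr <;> exact hl _)
  have hfin : ∀ n : ℕ, ∑' j : ℕ, Q ^ ((j : ℤ) * (j + s)) * qPochInv Q j * qPochInv Q (n + -j) *
      qPochInv Q (s + j) = qPochInv Q n * qPochInv Q (n + s) := by
    intro n
    rw [← sum_qPochInv h0 h1 n s, tsum_eq_sum (s := range (n + 1))]
    · simp [sub_eq_add_neg]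
    · intro j hj
      rw [qPochInv_of_neg (show (n : ℤ) + -j < 0 by simp at hj; omega)]
      simp
  simp only [hfin] at hlim
  have hlim2 : Tendsto (fun n : ℕ => qPochInv Q n * qPochInv Q (n + s)) atTop (𝓝 (C * C)) := by
    have := tendsto_qPochInv_sub h0 h1 0
    simp only [add_zero] at this
    exact this.mul (tendsto_qPochInv_sub h0 h1 s)
  have heq := tendsto_nhds_unique hlim hlim2
  have : C * ∑' j : ℕ, (Q ^ ((j : ℤ) * (j + s)) * qPochInv Q j * qPochInv Q (s + j)) = C * C := by
    rw [← heq, ← tsum_mul_left]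
    congr 1; ext j; ring
  rw [← mul_left_cancel₀ hCpos.ne' this]
  exact hsum.hasSum

lemma summable_euler (h0 : 0 < Q) (h1 : Q < 1) (z : ℝ) :
    Summable fun g : ℕ => Q ^ g.choose 2 * z ^ g / qPoch Q g := by
  have hne : ∀ g, qPoch Q g ≠ 0 := fun g => (qPoch_pos h0 h1 g).ne'
  rcases eq_or_ne z 0 with rfl | hz
  · refine summable_of_ne_finset_zero (s := {0}) fun g hg => ?_
    simp [zero_pow (show g ≠ 0 by simpa using hg)]
  refine summable_of_ratio_test_tendsto_lt_one (l := 0) one_pos ?_ ?_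
  · exact Eventually.of_forall fun g => by
      have := hne g
      positivity
  · have key : ∀ g : ℕ, ‖Q ^ (g + 1).choose 2 * z ^ (g + 1) / qPoch Q (g + 1)‖ /
        ‖Q ^ g.choose 2 * z ^ g / qPoch Q g‖ = Q ^ g * |z| / (1 - Q ^ (g + 1)) := by
      intro g
      have h2 : (g + 1).choose 2 = g + g.choose 2 := by
        rw [Nat.choose_succ_succ' g 1]; simp
      have h3 := one_sub_pow_pos h0 h1 g
      have h4 := qPoch_pos h0 h1 g
      rw [qPoch_succ, h2]
      simp only [norm_div, norm_mul, norm_pow, Real.norm_of_nonneg h0.le, Real.norm_of_nonneg h3.le,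
        Real.norm_of_nonneg h4.le, Real.norm_eq_abs]
      have : |z| ≠ 0 := abs_ne_zero.2 hz
      field_simp
      ring
    simp only [key]
    have t1 := tendsto_pow_atTop_nhds_zero_of_lt_one h0.le h1
    have t2 := (tendsto_add_atTop_iff_nat 1).2 t1
    have := (t1.mul_const |z|).div ((tendsto_const_nhds (x := (1 : ℝ))).sub t2) (by simp)
    simpa only [zero_mul, sub_zero, zero_div, Pi.div_def] using this

/-- Euler's identity for `∏ (1 + z Q^l)`. -/
lemma hasProd_euler (h0 : 0 < Q) (h1 : Q < 1) {z : ℝ} (hz : 0 ≤ z) :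
    HasProd (fun l : ℕ => 1 + z * Q ^ l) (∑' g : ℕ, Q ^ g.choose 2 * z ^ g / qPoch Q g) := by
  set G : ℝ → ℝ := fun z => ∑' g : ℕ, Q ^ g.choose 2 * z ^ g / qPoch Q g with hG
  -- The functional equation of the product, checked on coefficients. Iterating it and using `G (z
  -- Q^N) → 1` identifies `G` with the product.
  have hfe : ∀ z, G z = (1 + z) * G (z * Q) := by
    intro z
    have s1 := summable_euler h0 h1 z
    have s2 := summable_euler h0 h1 (z * Q)
    have e : G z - G (z * Q) = z * G (z * Q) := by
      simp only [hG]
      rw [← s1.tsum_sub s2, ← tsum_mul_left, (s1.sub s2).tsum_eq_zero_add]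
      simp only [pow_zero, sub_self, zero_add]
      congr 1
      ext g
      have h2 : (g + 1).choose 2 = g + g.choose 2 := by
        rw [Nat.choose_succ_succ' g 1]; simp
      have h3 := one_sub_pow_pos h0 h1 g
      have h4 := qPoch_pos h0 h1 g
      rw [h2, qPoch_succ]
      field_simp
      ring
    linarith
  have hit : ∀ N : ℕ, G z = (∏ l ∈ range N, (1 + z * Q ^ l)) * G (z * Q ^ N) := by
    intro N
    induction N with
    | zero => simp
    | succ N ih => rw [ih, prod_range_succ, hfe (z * Q ^ N), pow_succ]; ring_nf
  have hcont : Tendsto (fun N : ℕ => G (z * Q ^ N)) atTop (𝓝 1) := by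
    have hb : ∀ w, 0 ≤ w → w ≤ z → |G w - 1| ≤ w * ∑' g : ℕ,
        Q ^ (g + 1).choose 2 * z ^ g / qPoch Q (g + 1) := by
      intro w hw hwz
      have s1 := summable_euler h0 h1 w
      have hsz : Summable fun g : ℕ => Q ^ (g + 1).choose 2 * z ^ g / qPoch Q (g + 1) := by
        rcases eq_or_lt_of_le hz with rfl | hz'
        · refine summable_of_ne_finset_zero (s := {0}) fun g hg => ?_
          simp [zero_pow (show g ≠ 0 by simpa using hg)]
        · have := ((summable_nat_add_iff 1).2 (summable_euler h0 h1 z)).mul_left z⁻¹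
          refine this.congr fun g => ?_
          rw [pow_succ]; field_simp
      have e : G w - 1 = ∑' g : ℕ, Q ^ (g + 1).choose 2 * w ^ (g + 1) / qPoch Q (g + 1) := by
        simp only [hG]
        rw [s1.tsum_eq_zero_add]
        simp [qPoch]
      have hpos := fun g => qPoch_pos h0 h1 g
      rw [e, abs_of_nonneg (tsum_nonneg fun g => by have := hpos (g + 1); positivity),
        ← tsum_mul_left]
      refine ((summable_nat_add_iff 1).2 s1).tsum_le_tsum (fun g => ?_) (hsz.mul_left w)
      have := hpos (g + 1)
      rw [mul_div_assoc', pow_succ']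
      rw [show Q ^ (g + 1).choose 2 * (w * w ^ g) = w * (Q ^ (g + 1).choose 2 * w ^ g) by ring]
      gcongr
    have t1 : Tendsto (fun N : ℕ => z * Q ^ N * ∑' g : ℕ,
        Q ^ (g + 1).choose 2 * z ^ g / qPoch Q (g + 1)) atTop (𝓝 0) := by
      have := ((tendsto_pow_atTop_nhds_zero_of_lt_one h0.le h1).const_mul z).mul_const
        (∑' g : ℕ, Q ^ (g + 1).choose 2 * z ^ g / qPoch Q (g + 1))
      simpa using this
    have t2 : Tendsto (fun N : ℕ => G (z * Q ^ N) - 1) atTop (𝓝 0) :=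
      squeeze_zero_norm (fun N => hb _ (by positivity)
        (mul_le_of_le_one_right hz (pow_le_one₀ h0.le h1.le))) t1
    simpa using t2.add_const 1
  have hmul : Multipliable fun l : ℕ => 1 + z * Q ^ l := by
    refine multipliable_one_add_of_summable ?_
    simp only [norm_mul, norm_pow, Real.norm_of_nonneg h0.le]
    exact (summable_geometric_of_lt_one h0.le h1).mul_left _
  have t := hmul.hasProd.tendsto_prod_nat.mul hcont
  have : G z = ∏' l : ℕ, (1 + z * Q ^ l) := by
    rw [mul_one] at t
    exact tendsto_nhds_unique (tendsto_const_nhds.congr fun N => hit N) t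
  change HasProd _ (G z)
  rw [this]
  exact hmul.hasProd

end QSeries

/-- Newton-type telescoping: the alternating sum of the `q`-binomial coefficients. -/
lemma sum_alternating_prod_sub (q X : ℝ) (hq : 1 < q) (N : ℕ) :
    ∑ g ∈ range (N + 1), (-1) ^ g * (∏ k ∈ range g, (X - q ^ k)) /
      ∏ j ∈ range g, (q ^ (j + 1) - 1) =
    (-1) ^ N * (∏ k ∈ range N, (X - q ^ (k + 1))) / ∏ j ∈ range N, (q ^ (j + 1) - 1) := by
  have hpos : ∀ j : ℕ, q ^ (j + 1) - 1 ≠ 0 := fun j => by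
    have := one_lt_pow₀ hq (n := j + 1) (by simp)
    linarith
  induction N with
  | zero => simp
  | succ N ih =>
    rw [sum_range_succ, ih, prod_range_succ' (fun k => X - q ^ k) N,
      prod_range_succ (fun j => q ^ (j + 1) - 1), prod_range_succ (fun k => X - q ^ (k + 1))]
    have h1 : ∏ j ∈ range N, (q ^ (j + 1) - 1) ≠ 0 := prod_ne_zero_iff.2 fun j _ => hpos j
    have h2 := hpos N
    field_simp
    ring

/-! ### Counting surjections over a finite field, and inverting the counts -/

/-- The number of surjections `κ^e → κ^f` of vector spaces over a field with `q` elements. -/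
def surjCount (q e f : ℕ) : ℕ := ∏ k ∈ range f, (q ^ e - q ^ k)

section SurjCount

variable {q : ℕ}

/-- The factor `k = e` vanishes, so truncated subtraction in the later factors does no harm. -/
lemma surjCount_eq_zero {e f : ℕ} (h : e < f) : surjCount q e f = 0 :=
  prod_eq_zero (mem_range.2 h) (Nat.sub_self _)

lemma surjCount_pos (hq : 2 ≤ q) {e f : ℕ} (h : f ≤ e) : 0 < surjCount q e f :=
  prod_pos fun _ hk => Nat.sub_pos_of_lt
    (Nat.pow_lt_pow_right hq ((mem_range.1 hk).trans_le h))

/-- The last `g` factors are `q^(f+x) - q^(f+k) = q^f (q^x - q^k)`. This separation of variables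
drives both the evaluation of the moments and their inversion. -/
lemma surjCount_add (f x g : ℕ) :
    surjCount q (f + x) (f + g) = surjCount q (f + x) f * (q ^ (f * g) * surjCount q x g) := by
  unfold surjCount
  rw [prod_range_add]
  congr 1
  have h : q ^ (f * g) = ∏ _k ∈ range g, q ^ f := by simp [pow_mul]
  rw [h, ← prod_mul_distrib]
  exact prod_congr rfl fun k _ => by rw [pow_add, pow_add, Nat.mul_sub]

lemma surjCount_cast (hq : 2 ≤ q) (e f : ℕ) :
    (surjCount q e f : ℝ) = ∏ k ∈ range f, ((q : ℝ) ^ e - (q : ℝ) ^ k) := by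
  rcases lt_or_ge e f with h | h
  · rw [surjCount_eq_zero h, Nat.cast_zero, prod_eq_zero (mem_range.2 h) (sub_self _)]
  · unfold surjCount
    rw [Nat.cast_prod]
    refine prod_congr rfl fun k hk => ?_
    rw [Nat.cast_sub (Nat.pow_le_pow_right (by omega) ((mem_range.1 hk).le.trans h))]
    push_cast
    rfl

/-- Here `q^k` is pulled out of `q^g - q^k`, which suits `invCoeff`; `surjCount_self` pulls out
`q^g` instead, which suits the `q`-series in `1/q`. -/
lemma surjCount_self_eq (hq : 2 ≤ q) (g : ℕ) :
    (surjCount q g g : ℝ) = (q : ℝ) ^ g.choose 2 * ∏ j ∈ range g, ((q : ℝ) ^ (j + 1) - 1) := by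
  rw [surjCount_cast hq]
  have h1 : (q : ℝ) ^ g.choose 2 = ∏ k ∈ range g, (q : ℝ) ^ k := by
    rw [prod_pow_eq_pow_sum, sum_range_id, Nat.choose_two_right]
  rw [h1, ← prod_range_reflect (fun j => (q : ℝ) ^ (j + 1) - 1), ← prod_mul_distrib]
  refine prod_congr rfl fun k hk => ?_
  have : k < g := mem_range.1 hk
  rw [mul_sub, mul_one, ← pow_add]
  congr 2
  omega

lemma surjCount_self (hq : 2 ≤ q) (g : ℕ) :
    (surjCount q g g : ℝ) = (q : ℝ) ^ (g * g) * qPoch (q : ℝ)⁻¹ g := by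
  have hq0 : (q : ℝ) ≠ 0 := by positivity
  have h : (q : ℝ) ^ (g * g) = ∏ _k ∈ range g, (q : ℝ) ^ g := by simp [pow_mul]
  rw [surjCount_cast hq, h, qPoch, ← prod_range_reflect (fun l => 1 - (q : ℝ)⁻¹ ^ (l + 1)), ← prod_mul_distrib]
  refine prod_congr rfl fun k hk => ?_
  have : k < g := mem_range.1 hk
  have e : (q : ℝ) ^ g = (q : ℝ) ^ (g - 1 - k + 1) * (q : ℝ) ^ k := by
    rw [← pow_add]; congr 1; omega
  rw [mul_sub, mul_one, e, inv_pow]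
  field_simp

/-- The coefficients which invert the triangular array `surjCount`. -/
noncomputable def invCoeff (q g : ℕ) : ℝ := (-1) ^ g / ∏ j ∈ range g, ((q : ℝ) ^ (j + 1) - 1)

lemma abs_invCoeff (hq : 2 ≤ q) (g : ℕ) :
    |invCoeff q g| = (q : ℝ) ^ g.choose 2 / surjCount q g g := by
  have h : ∀ j : ℕ, 0 < (q : ℝ) ^ (j + 1) - 1 := fun j => by
    have := one_lt_pow₀ (show (1 : ℝ) < q by exact_mod_cast hq) (n := j + 1) (by simp)
    linarith
  have h2 : 0 < ∏ j ∈ range g, ((q : ℝ) ^ (j + 1) - 1) := prod_pos fun j _ => h j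
  rw [invCoeff, abs_div, abs_pow, abs_neg, abs_one, one_pow, abs_of_pos h2, surjCount_self_eq hq]
  have : (q : ℝ) ^ g.choose 2 ≠ 0 := by positivity
  field_simp

/-- Take `X = q^x` and `N = x` in `sum_alternating_prod_sub`: for `x > 0` the factor `X - q^(k+1)`
with `k = x - 1` kills the right-hand side. -/
lemma sum_invCoeff (hq : 2 ≤ q) (x : ℕ) :
    ∑ g ∈ range (x + 1), invCoeff q g * surjCount q x g = if x = 0 then 1 else 0 := by
  have hq1 : (1 : ℝ) < q := by exact_mod_cast hq
  have h := sum_alternating_prod_sub (q : ℝ) ((q : ℝ) ^ x) hq1 x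
  have e : ∀ g, invCoeff q g * surjCount q x g = (-1) ^ g * (∏ k ∈ range g,
      ((q : ℝ) ^ x - (q : ℝ) ^ k)) / ∏ j ∈ range g, ((q : ℝ) ^ (j + 1) - 1) := fun g => by
    rw [surjCount_cast hq, invCoeff]; ring
  rw [sum_congr rfl fun g _ => e g, h]
  rcases x with _ | x
  · simp
  · rw [prod_eq_zero (mem_range.2 (Nat.lt_succ_self x)) (by simp)]
    simp

end SurjCount

lemma inv_cast_pos {q : ℕ} (hq : 2 ≤ q) : (0 : ℝ) < (q : ℝ)⁻¹ := by positivity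

lemma inv_cast_lt_one {q : ℕ} (hq : 2 ≤ q) : (q : ℝ)⁻¹ < 1 :=
  inv_lt_one_of_one_lt₀ (by exact_mod_cast hq)

lemma tsum_ofReal_eq {α : Type*} {F : α → ℝ} {A : ℝ} (h0 : ∀ x, 0 ≤ F x) (h : HasSum F A) :
    ∑' x, ENNReal.ofReal (F x) = ENNReal.ofReal A := by
  rw [← ENNReal.ofReal_tsum_of_nonneg h0 h.summable, h.tsum_eq]

/-! ### The block of one self-dual irreducible -/

section SingleBlock

/-- The moment attached to a self-dual irreducible representation occurring `f` times. -/
noncomputable def moment₁ (q a s f : ℕ) : ℝ := (q : ℝ) ^ f.choose 2 * (s : ℝ) ^ f / (q : ℝ) ^ (a * f)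

/-- The mass attached to a self-dual irreducible representation occurring `f` times. -/
noncomputable def mass₁ (q a s f : ℕ) : ℝ :=
  moment₁ q a s f / surjCount q f f *
    ∏' l : ℕ, (1 + (s : ℝ) / (q : ℝ) ^ (a + 1) * (q : ℝ)⁻¹ ^ l)⁻¹

variable {q a s : ℕ}

lemma moment₁_nonneg (f : ℕ) : 0 ≤ moment₁ q a s f := by unfold moment₁; positivity

/-- The cross term `q^(fg)` comes from `(f+g choose 2)`, and cancels the same power in
`surjCount_add`. -/
lemma moment₁_add (hq : 2 ≤ q) (f g : ℕ) :
    moment₁ q a s (f + g) = moment₁ q a s f * moment₁ q a s g * (q : ℝ) ^ (f * g) := by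
  have hq0 : (q : ℝ) ≠ 0 := by positivity
  have h : (f + g).choose 2 = f.choose 2 + g.choose 2 + f * g := by
    have := Nat.add_choose_eq f g 2
    rw [this]
    simp [Finset.Nat.antidiagonal_succ]
    ring
  unfold moment₁
  rw [h]
  field_simp
  ring

/-- The exponent `(g choose 2) - g²` equals `-(g choose 2) - g`, which turns the quotient into the
Euler term with `z = s/q^(a+1)`. -/
lemma moment₁_div (hq : 2 ≤ q) (g : ℕ) :
    moment₁ q a s g / surjCount q g g = (q : ℝ)⁻¹ ^ g.choose 2 *
      ((s : ℝ) / (q : ℝ) ^ (a + 1)) ^ g / qPoch (q : ℝ)⁻¹ g := by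
  have hq0 : (q : ℝ) ≠ 0 := by positivity
  have h1 : g * g = g.choose 2 + g.choose 2 + g := by
    rw [Nat.choose_two_right]
    have h2 := Nat.even_mul_pred_self g
    have h3 := Nat.div_two_mul_two_of_even h2
    rcases g with _ | g
    · simp
    · simp at h3 ⊢; nlinarith
  rw [surjCount_self hq, moment₁, h1]
  have := (qPoch_pos (inv_cast_pos hq) (inv_cast_lt_one hq) g).ne'
  generalize qPoch (q : ℝ)⁻¹ g = P at *
  rw [inv_pow, div_pow, ← pow_mul, show (a + 1) * g = a * g + g by ring]
  simp only [pow_add]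
  field_simp

lemma mass₁_nonneg (f : ℕ) : 0 ≤ mass₁ q a s f := by
  unfold mass₁
  have := moment₁_nonneg (q := q) (a := a) (s := s) f
  have : 0 ≤ ∏' l : ℕ, (1 + (s : ℝ) / (q : ℝ) ^ (a + 1) * (q : ℝ)⁻¹ ^ l)⁻¹ := by
    -- Convergence need not be settled here, since a divergent product has the default value `1`.
    by_cases h : Multipliable fun l : ℕ => (1 + (s : ℝ) / (q : ℝ) ^ (a + 1) * (q : ℝ)⁻¹ ^ l)⁻¹
    · exact ge_of_tendsto' h.hasProd.tendsto_prod_nat fun n =>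
        prod_nonneg fun i _ => by positivity
    · rw [tprod_eq_one_of_not_multipliable h]; exact zero_le_one
  positivity

/-- Terms with `e < f` vanish. For `e = f + g` the summand is the moment at `f` times the Euler term
at `g`, and the normalizing product of the mass is the inverse of Euler's sum. -/
lemma tsum_mass₁ (hq : 2 ≤ q) (f : ℕ) :
    ∑' e, ENNReal.ofReal (mass₁ q a s e) * (surjCount q e f : ℝ≥0∞) =
      ENNReal.ofReal (moment₁ q a s f) := by
  have h0 := inv_cast_pos hq
  have h1 := inv_cast_lt_one hq
  set z : ℝ := (s : ℝ) / (q : ℝ) ^ (a + 1) with hz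
  have hz0 : 0 ≤ z := by positivity
  have hE := hasProd_euler h0 h1 hz0
  set G : ℝ := ∑' g : ℕ, (q : ℝ)⁻¹ ^ g.choose 2 * z ^ g / qPoch (q : ℝ)⁻¹ g with hG
  have hG1 : 1 ≤ G := by
    have hs := summable_euler h0 h1 z
    have := hs.le_tsum 0 (fun g _ => by have := qPoch_pos h0 h1 g; positivity)
    rw [← hG] at this
    simpa [qPoch] using this
  have hGinv : ∏' l : ℕ, (1 + z * (q : ℝ)⁻¹ ^ l)⁻¹ = G⁻¹ := by
    have : HasProd (fun l : ℕ => (1 + z * (q : ℝ)⁻¹ ^ l)⁻¹) G⁻¹ := by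
      have := (Tendsto.inv₀ hE (by positivity : G ≠ 0))
      refine this.congr fun t => ?_
      simp
    exact this.tprod_eq
  have key : ∀ g, mass₁ q a s (f + g) * surjCount q (f + g) f =
      moment₁ q a s f * G⁻¹ * ((q : ℝ)⁻¹ ^ g.choose 2 * z ^ g / qPoch (q : ℝ)⁻¹ g) := by
    intro g
    rw [← moment₁_div hq, mass₁, hGinv, moment₁_add hq, surjCount_add]
    have e1 : (surjCount q (f + g) f : ℝ) ≠ 0 := by
      exact_mod_cast (surjCount_pos hq (by omega)).ne'
    have e2 : (surjCount q g g : ℝ) ≠ 0 := by exact_mod_cast (surjCount_pos hq le_rfl).ne'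
    have hq0 : (q : ℝ) ≠ 0 := by positivity
    push_cast
    field_simp
  have hs : HasSum (fun e => mass₁ q a s e * surjCount q e f) (moment₁ q a s f) := by
    rw [← (add_right_injective f).hasSum_iff]
    · have := (summable_euler h0 h1 z).hasSum.mul_left (moment₁ q a s f * G⁻¹)
      rw [← hG, mul_assoc, inv_mul_cancel₀ (by positivity), mul_one] at this
      exact this.congr_fun key
    · intro e he
      have : e < f := by
        by_contra h
        exact he ⟨e - f, by simp; omega⟩
      rw [surjCount_eq_zero this]; simp
  rw [← tsum_ofReal_eq (fun e => mul_nonneg (mass₁_nonneg e) (Nat.cast_nonneg _)) hs]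
  congr 1
  ext e
  rw [ENNReal.ofReal_mul (mass₁_nonneg e), ENNReal.ofReal_natCast]

/-- The coefficient `|invCoeff|` brings a factor `q^(g choose 2)` that cancels the Gaussian decay of
the Euler terms. What remains is bounded by a geometric series in `z = s/q^(a+1) ≤ q^(-a) < 1`. -/
lemma summable_moment₁ (hq : 2 ≤ q) (ha : 0 < a) (hs : s ≤ q) (f : ℕ) :
    Summable fun g => |invCoeff q g| * (moment₁ q a s (f + g) / (q : ℝ) ^ (f * g)) := by
  have h0 := inv_cast_pos hq
  have h1 := inv_cast_lt_one hq
  have hq0 : (0 : ℝ) < q := by positivity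
  set z : ℝ := (s : ℝ) / (q : ℝ) ^ (a + 1) with hz
  have hz0 : 0 ≤ z := by positivity
  have hz1 : z < 1 := by
    rw [hz, div_lt_one (by positivity)]
    have : (s : ℝ) ≤ q := by exact_mod_cast hs
    refine this.trans_lt ?_
    rw [pow_succ]
    have : (1 : ℝ) < (q : ℝ) ^ a := one_lt_pow₀ (by exact_mod_cast hq) ha.ne'
    nlinarith
  refine Summable.of_nonneg_of_le (fun g => ?_) (fun g => ?_)
    ((summable_geometric_of_lt_one hz0 hz1).mul_left (moment₁ q a s f * (qPochInf (q : ℝ)⁻¹)⁻¹))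
  · have := moment₁_nonneg (q := q) (a := a) (s := s) (f + g); positivity
  · have e : |invCoeff q g| * (moment₁ q a s (f + g) / (q : ℝ) ^ (f * g)) =
        moment₁ q a s f * (qPoch (q : ℝ)⁻¹ g)⁻¹ * z ^ g := by
      have := moment₁_div (a := a) (s := s) hq g
      rw [abs_invCoeff hq, moment₁_add hq]
      calc _ = moment₁ q a s f * (q : ℝ) ^ g.choose 2 * (moment₁ q a s g / surjCount q g g) := by
            field_simp
        _ = _ := by rw [this, inv_pow, ← hz]; field_simp
    rw [e]
    have := moment₁_nonneg (q := q) (a := a) (s := s) f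
    have := inv_anti₀ (qPochInf_pos h0 h1) (qPochInf_le h0 h1 g)
    gcongr

end SingleBlock

/-! ### The block of a pair of dual irreducibles -/

section PairBlock

/-- The moment attached to a dual pair of irreducible representations. -/
noncomputable def moment₂ (q a f₁ f₂ : ℕ) : ℝ := (q : ℝ) ^ (f₁ * f₂) / (q : ℝ) ^ (a * (f₁ + f₂))

/-- The mass attached to a dual pair of irreducible representations. -/
noncomputable def mass₂ (q a f₁ f₂ : ℕ) : ℝ :=
  moment₂ q a f₁ f₂ / (surjCount q f₁ f₁ * surjCount q f₂ f₂) *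
    (qPochInf (q : ℝ)⁻¹ * qPoch (q : ℝ)⁻¹ (2 * a) *
      (qPochInv (q : ℝ)⁻¹ (a + f₂ - f₁) * qPochInv (q : ℝ)⁻¹ (a + f₁ - f₂)))

variable {q a : ℕ}

lemma moment₂_nonneg (f₁ f₂ : ℕ) : 0 ≤ moment₂ q a f₁ f₂ := by unfold moment₂; positivity

lemma mass₂_nonneg (hq : 2 ≤ q) (f₁ f₂ : ℕ) : 0 ≤ mass₂ q a f₁ f₂ := by
  have h0 := inv_cast_pos hq
  have h1 := inv_cast_lt_one hq
  unfold mass₂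
  have := qPochInf_pos h0 h1
  have := qPoch_pos h0 h1 (2 * a)
  have := qPochInv_nonneg h0 h1 (a + f₂ - f₁)
  have := qPochInv_nonneg h0 h1 (a + f₁ - f₂)
  have := moment₂_nonneg (q := q) (a := a) f₁ f₂
  positivity

/-- The exponent which governs the pair block after translation by `d = f₁ - f₂`. -/
def pairExp (a : ℕ) (d : ℤ) (g₁ g₂ : ℕ) : ℤ :=
  (g₁ : ℤ) ^ 2 + (g₂ : ℤ) ^ 2 - g₁ * g₂ + a * (g₁ + g₂) + d * (g₁ - g₂)

/-- The cross terms `f₁g₂ + g₁f₂ - f₁g₁ - f₂g₂` equal `-(f₁-f₂)(g₁-g₂)`, so apart from the moment at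
`(f₁, f₂)` the translation enters only through `f₁ - f₂`. -/
lemma moment₂_add_div (hq : 2 ≤ q) (f₁ f₂ g₁ g₂ : ℕ) :
    moment₂ q a (f₁ + g₁) (f₂ + g₂) / ((q : ℝ) ^ (f₁ * g₁) * (q : ℝ) ^ (f₂ * g₂)) /
      (surjCount q g₁ g₁ * surjCount q g₂ g₂) =
    moment₂ q a f₁ f₂ * ((q : ℝ)⁻¹ ^ pairExp a (f₁ - f₂) g₁ g₂ *
      qPochInv (q : ℝ)⁻¹ g₁ * qPochInv (q : ℝ)⁻¹ g₂) := by
  have hq0 : (q : ℝ) ≠ 0 := by positivity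
  have e1 := (qPoch_pos (inv_cast_pos hq) (inv_cast_lt_one hq) g₁).ne'
  have e2 := (qPoch_pos (inv_cast_pos hq) (inv_cast_lt_one hq) g₂).ne'
  rw [surjCount_self hq, surjCount_self hq, qPochInv_natCast, qPochInv_natCast, moment₂, moment₂]
  have key : (q : ℝ) ^ ((f₁ + g₁) * (f₂ + g₂)) / (q : ℝ) ^ (a * (f₁ + g₁ + (f₂ + g₂))) /
      ((q : ℝ) ^ (f₁ * g₁) * (q : ℝ) ^ (f₂ * g₂)) / ((q : ℝ) ^ (g₁ * g₁) * (q : ℝ) ^ (g₂ * g₂)) =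
      (q : ℝ) ^ (f₁ * f₂) / (q : ℝ) ^ (a * (f₁ + f₂)) *
        (q : ℝ)⁻¹ ^ pairExp a (f₁ - f₂) g₁ g₂ := by
    simp only [← zpow_natCast, inv_zpow', ← zpow_add₀ hq0, ← zpow_sub₀ hq0]
    congr 1
    unfold pairExp
    push_cast
    ring
  calc _ = (q : ℝ) ^ ((f₁ + g₁) * (f₂ + g₂)) / (q : ℝ) ^ (a * (f₁ + g₁ + (f₂ + g₂))) /
      ((q : ℝ) ^ (f₁ * g₁) * (q : ℝ) ^ (f₂ * g₂)) / ((q : ℝ) ^ (g₁ * g₁) * (q : ℝ) ^ (g₂ * g₂)) *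
      ((qPoch (q : ℝ)⁻¹ g₁)⁻¹ * (qPoch (q : ℝ)⁻¹ g₂)⁻¹) := by field_simp
    _ = _ := by rw [key]; ring

/-- For `n < 0` both sides vanish. This case is needed because the lemma is applied with `n = a - d
+ g₂`, which may be negative. -/
lemma hasSum_qPochInv_int {Q : ℝ} (h0 : 0 < Q) (h1 : Q < 1) (n s : ℤ) :
    HasSum (fun j : ℕ => Q ^ ((j : ℤ) * (j + s)) * qPochInv Q j * qPochInv Q (n - j) *
      qPochInv Q (s + j)) (qPochInv Q n * qPochInv Q (n + s)) := by
  rcases lt_or_ge n 0 with h | h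
  · rw [qPochInv_of_neg h, zero_mul]
    convert hasSum_zero with j
    rw [qPochInv_of_neg (show n - (j : ℤ) < 0 by omega)]
    simp
  · lift n to ℕ using h
    rw [← sum_qPochInv h0 h1 n s]
    refine hasSum_sum_of_ne_finset_zero fun j hj => ?_
    rw [qPochInv_of_neg (show (n : ℤ) - (j : ℤ) < 0 by simp at hj; omega)]
    simp

/-- The total mass identity for a dual pair. -/
lemma tsum_pairExp {Q : ℝ} (h0 : 0 < Q) (h1 : Q < 1) (a : ℕ) (d : ℤ) :
    ∑' g : ℕ × ℕ, ENNReal.ofReal (Q ^ pairExp a d g.1 g.2 * qPochInv Q g.1 * qPochInv Q g.2 *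
      (qPochInv Q (a - d - (g.1 - g.2)) * qPochInv Q (a + d + (g.1 - g.2)))) =
    ENNReal.ofReal ((qPoch Q (2 * a))⁻¹ * (qPochInf Q)⁻¹) := by
  have hn := qPochInv_nonneg h0 h1
  rw [ENNReal.tsum_prod', ENNReal.tsum_comm]
  have hin : ∀ g₂ : ℕ, ∑' g₁ : ℕ, ENNReal.ofReal (Q ^ pairExp a d g₁ g₂ * qPochInv Q g₁ *
      qPochInv Q g₂ * (qPochInv Q (a - d - (g₁ - g₂)) * qPochInv Q (a + d + (g₁ - g₂)))) =
      ENNReal.ofReal ((qPoch Q (2 * a))⁻¹ * (Q ^ ((g₂ : ℤ) * (g₂ + (a - d))) * qPochInv Q g₂ *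
        qPochInv Q ((a - d) + g₂))) := by
    intro g₂
    refine tsum_ofReal_eq (fun g₁ => ?_) ?_
    · have := hn g₁
      have := hn g₂
      have := hn (a - d - (g₁ - g₂))
      have := hn (a + d + (g₁ - g₂))
      have : 0 ≤ Q ^ pairExp a d g₁ g₂ := zpow_nonneg h0.le _
      positivity
    -- For fixed `g₂` the exponent splits as `g₂(g₂+a-d) + g₁(g₁+a+d-g₂)`, so the sum over `g₁` is a
    -- `q`-Vandermonde sum. Its parameters add up to `2a`, independently of `g₂`, which leaves
    -- Cauchy's sum over `g₂`.
    · have h := (hasSum_qPochInv_int h0 h1 (a - d + g₂) (a + d - g₂)).mul_left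
        (Q ^ ((g₂ : ℤ) * (g₂ + (a - d))) * qPochInv Q g₂)
      have e : (a - d + g₂ + (a + d - g₂) : ℤ) = (2 * a : ℕ) := by push_cast; ring
      rw [e, qPochInv_natCast (2 * a)] at h
      rw [show (qPoch Q (2 * a))⁻¹ * (Q ^ ((g₂ : ℤ) * (g₂ + (a - d))) * qPochInv Q g₂ *
        qPochInv Q ((a - d) + g₂)) = Q ^ ((g₂ : ℤ) * (g₂ + (a - d))) * qPochInv Q g₂ *
          (qPochInv Q ((a - d) + g₂) * (qPoch Q (2 * a))⁻¹) by ring]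
      refine h.congr_fun fun g₁ => ?_
      have e1 : pairExp a d g₁ g₂ = (g₂ : ℤ) * (g₂ + (a - d)) + (g₁ : ℤ) * (g₁ + (a + d - g₂)) := by
        unfold pairExp; ring
      have e2 : (a - d - (g₁ - g₂) : ℤ) = a - d + g₂ - g₁ := by ring
      have e3 : (a + d + (g₁ - g₂) : ℤ) = a + d - g₂ + g₁ := by ring
      rw [e1, zpow_add₀ h0.ne', e2, e3]
      ring
  simp only [hin]
  refine tsum_ofReal_eq (fun g₂ => ?_) ((hasSum_qPochInv h0 h1 (a - d)).mul_left _)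
  have := hn g₂
  have := hn (a - d + g₂)
  have := qPoch_pos h0 h1 (2 * a)
  have : 0 ≤ Q ^ ((g₂ : ℤ) * (g₂ + (a - d))) := zpow_nonneg h0.le _
  positivity

/-- As for one block, put `e = f + g` and separate the moment at `f`. The remaining double sum is
`tsum_pairExp` with `d = f₁ - f₂`, and the constants in `mass₂` are exactly the inverse of its
value. -/
lemma tsum_mass₂ (hq : 2 ≤ q) (f₁ f₂ : ℕ) :
    ∑' e : ℕ × ℕ, ENNReal.ofReal (mass₂ q a e.1 e.2) *
        ((surjCount q e.1 f₁ : ℝ≥0∞) * (surjCount q e.2 f₂ : ℝ≥0∞)) =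
      ENNReal.ofReal (moment₂ q a f₁ f₂) := by
  have h0 := inv_cast_pos hq
  have h1 := inv_cast_lt_one hq
  have hn := qPochInv_nonneg h0 h1
  have hp1 := qPochInf_pos h0 h1
  have hp2 := qPoch_pos h0 h1 (2 * a)
  have hinj : Function.Injective fun g : ℕ × ℕ => (f₁ + g.1, f₂ + g.2) := by
    rintro ⟨x, y⟩ ⟨z, w⟩ h
    simp at h
    simp [h]
  rw [← hinj.tsum_eq]
  · have key : ∀ g : ℕ × ℕ, ENNReal.ofReal (mass₂ q a (f₁ + g.1) (f₂ + g.2)) *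
        ((surjCount q (f₁ + g.1) f₁ : ℝ≥0∞) * (surjCount q (f₂ + g.2) f₂ : ℝ≥0∞)) =
        ENNReal.ofReal (moment₂ q a f₁ f₂ *
          (qPochInf (q : ℝ)⁻¹ * qPoch (q : ℝ)⁻¹ (2 * a))) *
        ENNReal.ofReal ((q : ℝ)⁻¹ ^ pairExp a (f₁ - f₂) g.1 g.2 * qPochInv (q : ℝ)⁻¹ g.1 *
          qPochInv (q : ℝ)⁻¹ g.2 * (qPochInv (q : ℝ)⁻¹ (a - (f₁ - f₂) - (g.1 - g.2)) *
            qPochInv (q : ℝ)⁻¹ (a + (f₁ - f₂) + (g.1 - g.2)))) := by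
      intro g
      rw [← ENNReal.ofReal_natCast, ← ENNReal.ofReal_natCast,
        ← ENNReal.ofReal_mul (by positivity), ← ENNReal.ofReal_mul (mass₂_nonneg hq _ _),
        ← ENNReal.ofReal_mul (by have := moment₂_nonneg (q := q) (a := a) f₁ f₂; positivity)]
      congr 1
      have h := moment₂_add_div (a := a) hq f₁ f₂ g.1 g.2
      have e1 : ((a : ℤ) + (f₂ + g.2 : ℕ) - (f₁ + g.1 : ℕ)) = a - (f₁ - f₂) - (g.1 - g.2) := by
        push_cast; ring
      have e2 : ((a : ℤ) + (f₁ + g.1 : ℕ) - (f₂ + g.2 : ℕ)) = a + (f₁ - f₂) + (g.1 - g.2) := by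
        push_cast; ring
      have n1 : (surjCount q (f₁ + g.1) f₁ : ℝ) ≠ 0 := by
        exact_mod_cast (surjCount_pos hq (by omega)).ne'
      have n2 : (surjCount q (f₂ + g.2) f₂ : ℝ) ≠ 0 := by
        exact_mod_cast (surjCount_pos hq (by omega)).ne'
      have n3 : (surjCount q g.1 g.1 : ℝ) ≠ 0 := by exact_mod_cast (surjCount_pos hq le_rfl).ne'
      have n4 : (surjCount q g.2 g.2 : ℝ) ≠ 0 := by exact_mod_cast (surjCount_pos hq le_rfl).ne'
      have hq0 : (q : ℝ) ≠ 0 := by positivity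
      rw [mass₂, e1, e2, surjCount_add f₁ g.1 g.1, surjCount_add f₂ g.2 g.2]
      push_cast
      set A := qPochInv (q : ℝ)⁻¹ (a - (f₁ - f₂) - (g.1 - g.2))
      set B := qPochInv (q : ℝ)⁻¹ (a + (f₁ - f₂) + (g.1 - g.2))
      set D := qPochInf (q : ℝ)⁻¹
      set E := qPoch (q : ℝ)⁻¹ (2 * a)
      calc _ = moment₂ q a (f₁ + g.1) (f₂ + g.2) /
            ((q : ℝ) ^ (f₁ * g.1) * (q : ℝ) ^ (f₂ * g.2)) /
            (surjCount q g.1 g.1 * surjCount q g.2 g.2) * (D * E * (A * B)) := by field_simp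
        _ = _ := by rw [h]; ring
    simp only [key]
    rw [ENNReal.tsum_mul_left, tsum_pairExp h0 h1,
      ← ENNReal.ofReal_mul (by have := moment₂_nonneg (q := q) (a := a) f₁ f₂; positivity)]
    congr 1
    set D := qPochInf (q : ℝ)⁻¹
    set E := qPoch (q : ℝ)⁻¹ (2 * a)
    calc _ = moment₂ q a f₁ f₂ * (D * D⁻¹) * (E * E⁻¹) := by ring
      _ = _ := by rw [mul_inv_cancel₀ hp1.ne', mul_inv_cancel₀ hp2.ne', mul_one, mul_one]
  · intro e he
    have h1' : f₁ ≤ e.1 := by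
      by_contra hlt
      exact he (by simp [surjCount_eq_zero (not_le.1 hlt)])
    have h2' : f₂ ≤ e.2 := by
      by_contra hlt
      exact he (by simp [surjCount_eq_zero (not_le.1 hlt)])
    exact ⟨(e.1 - f₁, e.2 - f₂), by ext <;> simp <;> omega⟩

lemma summable_moment₂ (hq : 2 ≤ q) (ha : 0 < a) (f₁ f₂ : ℕ) :
    Summable fun g : ℕ × ℕ => |invCoeff q g.1| * |invCoeff q g.2| *
      (moment₂ q a (f₁ + g.1) (f₂ + g.2) / ((q : ℝ) ^ (f₁ * g.1) * (q : ℝ) ^ (f₂ * g.2))) := by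
  have h0 := inv_cast_pos hq
  have h1 := inv_cast_lt_one hq
  have hq0 : (q : ℝ) ≠ 0 := by positivity
  set Q := (q : ℝ)⁻¹ with hQ
  set d : ℤ := (f₁ : ℤ) - f₂ with hd
  set C := (qPochInf Q)⁻¹
  have hC : 0 < C := inv_pos.2 (qPochInf_pos h0 h1)
  have hgeo := summable_geometric_of_lt_one h0.le h1
  have hb := (hgeo.mul_of_nonneg hgeo (fun n => pow_nonneg h0.le n)
    (fun n => pow_nonneg h0.le n)).mul_left (moment₂ q a f₁ f₂ * Q ^ (-d ^ 2) * (C * C))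
  have hm := moment₂_nonneg (q := q) (a := a)
  refine Summable.of_nonneg_of_le (fun g => ?_) (fun g => ?_) hb
  · have := hm (f₁ + g.1) (f₂ + g.2)
    positivity
  · have h := moment₂_add_div (a := a) hq f₁ f₂ g.1 g.2
    rw [abs_invCoeff hq, abs_invCoeff hq]
    have e : (q : ℝ) ^ g.1.choose 2 / surjCount q g.1 g.1 * ((q : ℝ) ^ g.2.choose 2 /
        surjCount q g.2 g.2) * (moment₂ q a (f₁ + g.1) (f₂ + g.2) /
          ((q : ℝ) ^ (f₁ * g.1) * (q : ℝ) ^ (f₂ * g.2))) =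
        moment₂ q a f₁ f₂ * (((q : ℝ) ^ g.1.choose 2 * (q : ℝ) ^ g.2.choose 2 *
          Q ^ pairExp a d g.1 g.2) * (qPochInv Q g.1 * qPochInv Q g.2)) := by
      calc _ = (q : ℝ) ^ g.1.choose 2 * (q : ℝ) ^ g.2.choose 2 *
            (moment₂ q a (f₁ + g.1) (f₂ + g.2) / ((q : ℝ) ^ (f₁ * g.1) * (q : ℝ) ^ (f₂ * g.2)) /
            (surjCount q g.1 g.1 * surjCount q g.2 g.2)) := by ring
        _ = _ := by rw [h]; ring
    have hch : ∀ n : ℕ, ((n.choose 2 : ℕ) : ℤ) * 2 = n * n - n := by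
      intro n
      rw [Nat.choose_two_right]
      have h3 := Nat.div_two_mul_two_of_even (Nat.even_mul_pred_self n)
      rcases n with _ | n
      · simp
      · simp only [Nat.add_sub_cancel] at h3 ⊢
        have : (((n + 1) * n / 2 : ℕ) : ℤ) * 2 = (((n + 1) * n : ℕ) : ℤ) := by exact_mod_cast h3
        rw [this]; push_cast; ring
    have hpow : (q : ℝ) ^ g.1.choose 2 * (q : ℝ) ^ g.2.choose 2 * Q ^ pairExp a d g.1 g.2 ≤
        Q ^ (-d ^ 2) * (Q ^ g.1 * Q ^ g.2) := by
      have l1 : (q : ℝ) ^ g.1.choose 2 * (q : ℝ) ^ g.2.choose 2 * Q ^ pairExp a d g.1 g.2 =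
          Q ^ (pairExp a d g.1 g.2 - g.1.choose 2 - g.2.choose 2) := by
        simp only [hQ, ← zpow_natCast, inv_zpow', ← zpow_add₀ hq0]
        congr 1; ring
      have l2 : Q ^ (-d ^ 2) * (Q ^ g.1 * Q ^ g.2) = Q ^ (-d ^ 2 + g.1 + g.2 : ℤ) := by
        rw [zpow_add₀ h0.ne', zpow_add₀ h0.ne', zpow_natCast, zpow_natCast]; ring
      rw [l1, l2]
      refine zpow_le_zpow_right_of_le_one₀ h0 h1.le ?_
      have c1 := hch g.1
      have c2 := hch g.2
      have ha' : (1 : ℤ) ≤ a := by exact_mod_cast ha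
      unfold pairExp
      have p1 : (0 : ℤ) ≤ g.1 := by positivity
      have p2 : (0 : ℤ) ≤ g.2 := by positivity
      -- After subtracting the binomials the exponent is `((g₁-g₂+d)² - d²)/2 + (a + 1/2)(g₁+g₂)`.
      -- The quadratic part is degenerate, so decay along the diagonal comes from the linear part
      -- alone.
      nlinarith [sq_nonneg ((g.1 : ℤ) - g.2 + d), sq_nonneg d, mul_nonneg (sub_nonneg.2 ha') p1,
        mul_nonneg (sub_nonneg.2 ha') p2]
    rw [e]
    have t1 := qPochInv_le h0 h1 g.1
    have t2 := qPochInv_le h0 h1 g.2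
    have t3 := qPochInv_nonneg h0 h1 g.1
    have t4 := qPochInv_nonneg h0 h1 g.2
    have t5 := hm f₁ f₂
    calc _ ≤ moment₂ q a f₁ f₂ * ((Q ^ (-d ^ 2) * (Q ^ g.1 * Q ^ g.2)) * (C * C)) := by
          have : 0 ≤ Q ^ (-d ^ 2) := zpow_nonneg h0.le _
          gcongr
      _ = _ := by ring

end PairBlock

lemma ENNReal.tsum_fin_pi_prod {T : Type*} (n : ℕ) (F : Fin n → T → ℝ≥0∞) :
    ∑' x : Fin n → T, ∏ k, F k (x k) = ∏ k, ∑' t, F k t := by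
  induction n with
  | zero => simp
  | succ n ih =>
    rw [← (Fin.consEquiv fun _ : Fin (n + 1) => T).tsum_eq, ENNReal.tsum_prod', Fin.prod_univ_succ,
      ← ih, ← ENNReal.tsum_mul_right]
    refine tsum_congr fun t => ?_
    rw [← ENNReal.tsum_mul_left]
    refine tsum_congr fun y => ?_
    simp [Fin.prod_univ_succ, Fin.consEquiv]

lemma ENNReal.tsum_pi_prod {κ T : Type*} [Fintype κ] (F : κ → T → ℝ≥0∞) :
    ∑' x : κ → T, ∏ k, F k (x k) = ∏ k, ∑' t, F k t := by
  let e := Fintype.equivFin κ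
  rw [← e.symm.prod_comp, ← ENNReal.tsum_fin_pi_prod, ← (e.arrowCongr (Equiv.refl T)).tsum_eq]
  refine tsum_congr fun x => ?_
  rw [← e.symm.prod_comp]
  simp [Equiv.arrowCongr]

/-! ### Splitting products and sums along the duality involution -/

section Involution

variable {ι : Type*} [LinearOrder ι] {σ : ι → ι}

/-- A tuple is the same as its values at the fixed points and at the pairs of an involution. -/
noncomputable def involutionEquiv (hσ : Function.Involutive σ) (T : Type*) :
    (ι → T) ≃ ({i // σ i = i} → T) × ({i // i < σ i} → T × T) :=
  Equiv.ofBijective (fun e => (fun i => e i, fun i => (e i, e (σ i)))) <| by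
    constructor
    · intro e e' h
      simp only [Prod.mk.injEq] at h
      funext i
      rcases lt_trichotomy (σ i) i with hi | hi | hi
      · have := congrFun h.2 ⟨σ i, by rwa [hσ i]⟩
        simp only [Prod.mk.injEq, hσ i] at this
        exact this.2
      · exact congrFun h.1 ⟨i, hi⟩
      · exact (Prod.mk.inj (congrFun h.2 ⟨i, hi⟩)).1
    · rintro ⟨x, y⟩
      -- Each two-element orbit is indexed by its smaller element, so the value at the larger one is
      -- read off as a second component.
      refine ⟨fun i => if h : σ i = i then x ⟨i, h⟩ else if h' : i < σ i then (y ⟨i, h'⟩).1 else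
        (y ⟨σ i, by rw [hσ i]; exact lt_of_le_of_ne (not_lt.1 h') h⟩).2, ?_⟩
      ext i
      · simp [i.2]
      · simp [i.2, i.2.ne']
      · have h1 : ¬ i.1 = σ i.1 := i.2.ne
        have h2 : ¬ σ i.1 < i.1 := i.2.not_gt
        simp [hσ i.1, h1, h2]

lemma prod_eq_prod_involution [Fintype ι] {M : Type*} [CommMonoid M] (hσ : Function.Involutive σ)
    (g : ι → M) :
    ∏ i, g i = (∏ i with σ i = i, g i) * ∏ i with i < σ i, g i * g (σ i) := by
  rw [← prod_filter_mul_prod_filter_not univ (fun i => σ i = i)]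
  congr 1
  rw [← prod_filter_mul_prod_filter_not _ (fun i => i < σ i), prod_mul_distrib, filter_filter,
    filter_filter]
  congr 1
  · exact prod_congr (by ext i; simp; exact fun h => h.ne') fun _ _ => rfl
  · refine prod_bij' (fun i _ => σ i) (fun i _ => σ i) ?_ ?_ ?_ ?_ ?_
    · intro i hi
      simp only [mem_filter, mem_univ, true_and, not_lt] at hi ⊢
      rw [hσ i]
      exact lt_of_le_of_ne hi.2 hi.1
    · intro i hi
      simp only [mem_filter, mem_univ, true_and, not_lt] at hi ⊢
      rw [hσ i]
      exact ⟨hi.ne, hi.le⟩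
    · exact fun i _ => hσ i
    · exact fun i _ => hσ i
    · intro i _
      rw [hσ i]

/-- Different blocks involve disjoint coordinates, and in `ℝ≥0∞` the sum distributes with no
summability condition. This reduces everything to one orbit at a time. -/
lemma tsum_involution [Fintype ι] (hσ : Function.Involutive σ) {T : Type*} (A : ι → T → ℝ≥0∞)
    (B : ι → T → T → ℝ≥0∞) :
    ∑' e : ι → T, (∏ i with σ i = i, A i (e i)) * ∏ i with i < σ i, B i (e i) (e (σ i)) =
      (∏ i with σ i = i, ∑' t, A i t) * ∏ i with i < σ i, ∑' t : T × T, B i t.1 t.2 := by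
  have h1 : ∀ F : ι → ℝ≥0∞, ∏ i with σ i = i, F i = ∏ i : {i // σ i = i}, F i := fun F =>
    prod_subtype _ (by simp) _
  have h2 : ∀ F : ι → ℝ≥0∞, ∏ i with i < σ i, F i = ∏ i : {i // i < σ i}, F i := fun F =>
    prod_subtype _ (by simp) _
  simp only [h1, h2]
  rw [← ENNReal.tsum_pi_prod (fun i : {i // σ i = i} => A i),
    ← ENNReal.tsum_pi_prod (fun (i : {i // i < σ i}) (t : T × T) => B i t.1 t.2),
    ← ENNReal.tsum_mul_right]
  simp only [← ENNReal.tsum_mul_left]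
  rw [← ENNReal.tsum_prod (f := fun (x : {i // σ i = i} → T) (y : {i // i < σ i} → T × T) =>
    (∏ k : {i // σ i = i}, A k (x k)) * ∏ k : {i // i < σ i}, B k (y k).1 (y k).2), ← (involutionEquiv hσ T).tsum_eq]
  rfl

end Involution

/-! ### The moment problem for multiplicity vectors -/

/-- The numerical data attached to a list of irreducible representations, closed under duality. -/
structure MomentData (ι : Type*) where
  /-- the order of the endomorphism field -/
  q : ι → ℕ
  /-- the exponent `u n` -/
  a : ι → ℕ
  /-- the number of invariant alternating forms -/
  s : ι → ℕ
  /-- duality -/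
  σ : ι → ι
  involutive : Function.Involutive σ
  two_le_q : ∀ i, 2 ≤ q i
  a_pos : ∀ i, 0 < a i
  s_le : ∀ i, s i ≤ q i
  q_σ : ∀ i, q (σ i) = q i

namespace MomentData

variable {ι : Type*} [Fintype ι] (D : MomentData ι)

/-- The number of surjections, as a function of the multiplicities. -/
def surj (e f : ι → ℕ) : ℕ := ∏ i, surjCount (D.q i) (e i) (f i)

lemma surj_eq_zero {e f : ι → ℕ} (h : ¬ f ≤ e) : D.surj e f = 0 := by
  obtain ⟨i, hi⟩ := not_forall.1 h
  exact prod_eq_zero (mem_univ i) (surjCount_eq_zero (not_le.1 hi))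

lemma surj_self_pos (f : ι → ℕ) : 0 < D.surj f f :=
  prod_pos fun i _ => surjCount_pos (D.two_le_q i) le_rfl

lemma surj_add (f x g : ι → ℕ) :
    D.surj (f + x) (f + g) = D.surj (f + x) f * ((∏ i, D.q i ^ (f i * g i)) * D.surj x g) := by
  simp only [surj, Pi.add_apply, surjCount_add, prod_mul_distrib]

/-- The coefficients which invert `surj`. -/
noncomputable def coeff (g : ι → ℕ) : ℝ := ∏ i, invCoeff (D.q i) (g i)

/-- The sum is finite, supported on the box `g ≤ x`, and there it is the product over `i` of the
one-variable relations `sum_invCoeff`. -/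
lemma hasSum_coeff (x : ι → ℕ) :
    HasSum (fun g => D.coeff g * D.surj x g) (if x = 0 then 1 else 0) := by
  classical
  have h : ∑ g ∈ Fintype.piFinset fun i => range (x i + 1), D.coeff g * D.surj x g =
      if x = 0 then 1 else 0 := by
    have h1 : ∀ g, D.coeff g * D.surj x g =
        ∏ i, invCoeff (D.q i) (g i) * surjCount (D.q i) (x i) (g i) := fun g => by
      rw [coeff, surj, prod_mul_distrib]; push_cast; rfl
    simp only [h1]
    rw [← prod_univ_sum (fun i => range (x i + 1))
      (fun i n => invCoeff (D.q i) n * (surjCount (D.q i) (x i) n : ℝ))]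
    simp only [sum_invCoeff (D.two_le_q _)]
    split_ifs with hx
    · simp [hx]
    · obtain ⟨i, hi⟩ := Function.ne_iff.1 hx
      exact prod_eq_zero (mem_univ i) (if_neg hi)
  rw [← h]
  refine hasSum_sum_of_ne_finset_zero fun g hg => ?_
  rw [D.surj_eq_zero, Nat.cast_zero, mul_zero]
  intro hle
  exact hg (Fintype.mem_piFinset.2 fun i => mem_range.2 (Nat.lt_succ_of_le (hle i)))

variable [LinearOrder ι]

/-- The moments, as a function of the multiplicities. -/
noncomputable def moment (f : ι → ℕ) : ℝ :=
  (∏ i with D.σ i = i, moment₁ (D.q i) (D.a i) (D.s i) (f i)) *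
    ∏ i with i < D.σ i, moment₂ (D.q i) (D.a i) (f i) (f (D.σ i))

/-- The masses, as a function of the multiplicities. -/
noncomputable def mass (f : ι → ℕ) : ℝ :=
  (∏ i with D.σ i = i, mass₁ (D.q i) (D.a i) (D.s i) (f i)) *
    ∏ i with i < D.σ i, mass₂ (D.q i) (D.a i) (f i) (f (D.σ i))

lemma moment_nonneg (f : ι → ℕ) : 0 ≤ D.moment f :=
  mul_nonneg (prod_nonneg fun _ _ => moment₁_nonneg _) (prod_nonneg fun _ _ => moment₂_nonneg _ _)

/-- The masses have the prescribed moments. -/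
theorem tsum_mass (f : ι → ℕ) :
    ∑' e, ENNReal.ofReal (D.mass e) * (D.surj e f : ℝ≥0∞) = ENNReal.ofReal (D.moment f) := by
  have h1 : ∀ e, ENNReal.ofReal (D.mass e) * (D.surj e f : ℝ≥0∞) =
      (∏ i with D.σ i = i, ENNReal.ofReal (mass₁ (D.q i) (D.a i) (D.s i) (e i)) *
        (surjCount (D.q i) (e i) (f i) : ℝ≥0∞)) *
      ∏ i with i < D.σ i, ENNReal.ofReal (mass₂ (D.q i) (D.a i) (e i) (e (D.σ i))) *
        ((surjCount (D.q i) (e i) (f i) : ℝ≥0∞) *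
          (surjCount (D.q i) (e (D.σ i)) (f (D.σ i)) : ℝ≥0∞)) := by
    intro e
    rw [mass, surj, ENNReal.ofReal_mul (prod_nonneg fun _ _ => mass₁_nonneg _),
      ENNReal.ofReal_prod_of_nonneg (fun _ _ => mass₁_nonneg _),
      ENNReal.ofReal_prod_of_nonneg (fun _ _ => mass₂_nonneg (D.two_le_q _) _ _),
      prod_eq_prod_involution D.involutive, prod_mul_distrib, prod_mul_distrib]
    push_cast
    simp only [D.q_σ, prod_mul_distrib]
    ring
  simp only [h1]
  rw [tsum_involution D.involutive (fun i n => ENNReal.ofReal (mass₁ (D.q i) (D.a i) (D.s i) n) *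
        (surjCount (D.q i) n (f i) : ℝ≥0∞)) (fun i n n' =>
        ENNReal.ofReal (mass₂ (D.q i) (D.a i) n n') * ((surjCount (D.q i) n (f i) : ℝ≥0∞) *
          (surjCount (D.q i) n' (f (D.σ i)) : ℝ≥0∞)))]
  rw [moment, ENNReal.ofReal_mul (prod_nonneg fun _ _ => moment₁_nonneg _),
      ENNReal.ofReal_prod_of_nonneg (fun _ _ => moment₁_nonneg _),
      ENNReal.ofReal_prod_of_nonneg (fun _ _ => moment₂_nonneg _ _)]
  simp only [tsum_mass₁ (D.two_le_q _), tsum_mass₂ (D.two_le_q _)]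

/-- The moments of the measure translated by `f` and biased by the number of surjections. -/
noncomputable def shiftMoment (f g : ι → ℕ) : ℝ :=
  D.moment (f + g) / ∏ i, (D.q i : ℝ) ^ (f i * g i)

lemma shiftMoment_nonneg (f g : ι → ℕ) : 0 ≤ D.shiftMoment f g :=
  div_nonneg (D.moment_nonneg _) (by positivity)

/-- The terms are non-negative and factor over the orbits of `σ`, so the sum in `ℝ≥0∞` is a finite
product of block sums, each already known to be finite. This is the bound behind Fubini in the
inversion. -/
lemma summable_shiftMoment (f : ι → ℕ) :
    Summable fun g => |D.coeff g| * D.shiftMoment f g := by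
  have key : ∀ g, |D.coeff g| * D.shiftMoment f g =
      (∏ i with D.σ i = i, |invCoeff (D.q i) (g i)| *
        (moment₁ (D.q i) (D.a i) (D.s i) (f i + g i) / (D.q i : ℝ) ^ (f i * g i))) *
      ∏ i with i < D.σ i, |invCoeff (D.q i) (g i)| * |invCoeff (D.q i) (g (D.σ i))| *
        (moment₂ (D.q i) (D.a i) (f i + g i) (f (D.σ i) + g (D.σ i)) /
          ((D.q i : ℝ) ^ (f i * g i) * (D.q i : ℝ) ^ (f (D.σ i) * g (D.σ i)))) := by
    intro g
    rw [coeff, shiftMoment, moment, abs_prod, prod_eq_prod_involution D.involutive,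
      prod_eq_prod_involution D.involutive (fun i => (D.q i : ℝ) ^ (f i * g i))]
    simp only [D.q_σ, prod_mul_distrib, prod_div_distrib, Pi.add_apply]
    rw [mul_div_mul_comm]
    ring
  have n1 : ∀ i n, 0 ≤ |invCoeff (D.q i) n| *
        (moment₁ (D.q i) (D.a i) (D.s i) (f i + n) / (D.q i : ℝ) ^ (f i * n)) := fun i n =>
    mul_nonneg (abs_nonneg _) (div_nonneg (moment₁_nonneg _) (by positivity))
  have n2 : ∀ i n n', 0 ≤ |invCoeff (D.q i) n| * |invCoeff (D.q i) n'| *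
        (moment₂ (D.q i) (D.a i) (f i + n) (f (D.σ i) + n') /
          ((D.q i : ℝ) ^ (f i * n) * (D.q i : ℝ) ^ (f (D.σ i) * n'))) := fun i n n' =>
    mul_nonneg (by positivity) (div_nonneg (moment₂_nonneg _ _) (by positivity))
  have htop : ∑' g, ENNReal.ofReal (|D.coeff g| * D.shiftMoment f g) ≠ ⊤ := by
    have h2 : ∀ g, ENNReal.ofReal (|D.coeff g| * D.shiftMoment f g) =
      (∏ i with D.σ i = i, ENNReal.ofReal (|invCoeff (D.q i) (g i)| *
        (moment₁ (D.q i) (D.a i) (D.s i) (f i + g i) / (D.q i : ℝ) ^ (f i * g i)))) *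
      ∏ i with i < D.σ i, ENNReal.ofReal (|invCoeff (D.q i) (g i)| *
        |invCoeff (D.q i) (g (D.σ i))| *
        (moment₂ (D.q i) (D.a i) (f i + g i) (f (D.σ i) + g (D.σ i)) /
          ((D.q i : ℝ) ^ (f i * g i) * (D.q i : ℝ) ^ (f (D.σ i) * g (D.σ i))))) := by
      intro g
      rw [key, ENNReal.ofReal_mul (prod_nonneg fun i _ => n1 i _),
        ENNReal.ofReal_prod_of_nonneg (fun i _ => n1 i _),
        ENNReal.ofReal_prod_of_nonneg (fun i _ => n2 i _ _)]
    simp only [h2]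
    rw [tsum_involution D.involutive (fun i n => ENNReal.ofReal (|invCoeff (D.q i) n| *
        (moment₁ (D.q i) (D.a i) (D.s i) (f i + n) / (D.q i : ℝ) ^ (f i * n))))
      (fun i n n' => ENNReal.ofReal (|invCoeff (D.q i) n| * |invCoeff (D.q i) n'| *
        (moment₂ (D.q i) (D.a i) (f i + n) (f (D.σ i) + n') /
          ((D.q i : ℝ) ^ (f i * n) * (D.q i : ℝ) ^ (f (D.σ i) * n')))))]
    refine ENNReal.mul_ne_top (ENNReal.prod_ne_top fun i _ => ?_)
      (ENNReal.prod_ne_top fun i _ => ?_)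
    · exact (summable_moment₁ (D.two_le_q i) (D.a_pos i) (D.s_le i) (f i)).tsum_ofReal_ne_top
    · exact (summable_moment₂ (D.two_le_q i) (D.a_pos i) (f i) (f (D.σ i))).tsum_ofReal_ne_top
  have := ENNReal.summable_toReal htop
  refine this.congr fun g => ?_
  rw [ENNReal.toReal_ofReal (mul_nonneg (abs_nonneg _) (D.shiftMoment_nonneg f g))]

/-- The masses can be recovered from the moments. -/
theorem mass_eq_of_moments {m : (ι → ℕ) → ℝ≥0∞}
    (hm : ∀ f, ∑' e, m e * (D.surj e f : ℝ≥0∞) = ENNReal.ofReal (D.moment f)) (f : ι → ℕ) :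
    m f = ENNReal.ofReal (∑' g, D.coeff g * D.shiftMoment f g) / (D.surj f f : ℝ≥0∞) := by
  -- Each term is bounded by a finite moment, so the argument can move to real numbers, where the
  -- signed coefficients live.
  have hfin : ∀ e g, m e * (D.surj e g : ℝ≥0∞) ≠ ⊤ := fun e g =>
    ne_top_of_le_ne_top ENNReal.ofReal_ne_top ((ENNReal.le_tsum e).trans (hm g).le)
  set r : (ι → ℕ) → ℝ := fun x => (m (f + x) * (D.surj (f + x) f : ℝ≥0∞)).toReal with hr
  have hr0 : ∀ x, 0 ≤ r x := fun x => ENNReal.toReal_nonneg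
  have hinj : Function.Injective fun x : ι → ℕ => f + x := add_right_injective f
  -- Only `e ≥ f` contribute to the moment at `f + g`. By `surj_add`, dividing it by `∏ q^(f g)`
  -- gives the moment at `g` of the biased, translated masses `r`.
  have hsum : ∀ g, HasSum (fun x => r x * D.surj x g) (D.shiftMoment f g) := by
    intro g
    have h1 : ∑' x, m (f + x) * (D.surj (f + x) (f + g) : ℝ≥0∞) =
        ENNReal.ofReal (D.moment (f + g)) := by
      rw [← hm]
      refine hinj.tsum_eq (f := fun e => m e * (D.surj e (f + g) : ℝ≥0∞)) fun e he => ?_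
      have : f ≤ e := by
        by_contra h
        refine he ?_
        have : D.surj e (f + g) = 0 := D.surj_eq_zero fun h' => h (le_self_add.trans h')
        simp [this]
      exact ⟨e - f, by funext i; simp [this i]⟩
    have h2 := ENNReal.hasSum_toReal (f := fun x => m (f + x) * (D.surj (f + x) (f + g) : ℝ≥0∞))
      (by rw [h1]; exact ENNReal.ofReal_ne_top)
    rw [← ENNReal.tsum_toReal_eq (fun x => hfin _ _), h1,
      ENNReal.toReal_ofReal (D.moment_nonneg _)] at h2
    have h3 := h2.div_const (∏ i, (D.q i : ℝ) ^ (f i * g i))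
    refine h3.congr_fun fun x => ?_
    have hne : ∏ i, (D.q i : ℝ) ^ (f i * g i) ≠ 0 := prod_ne_zero_iff.2 fun i _ => by
      have := D.two_le_q i
      positivity
    rw [hr, surj_add]
    simp only [ENNReal.toReal_mul, ENNReal.toReal_natCast]
    push_cast
    field_simp
  -- Absolute convergence: as `r ≥ 0`, the inner sum of absolute values is exactly `|coeff g| *
  -- shiftMoment f g`.
  have hF : Summable fun z : (ι → ℕ) × (ι → ℕ) => D.coeff z.1 * (r z.2 * D.surj z.2 z.1) := by
    refine Summable.of_norm ?_
    rw [summable_prod_of_nonneg fun _ => norm_nonneg _]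
    have e : ∀ g x, ‖D.coeff g * (r x * D.surj x g)‖ = |D.coeff g| * (r x * D.surj x g) := by
      intro g x
      rw [norm_mul, Real.norm_eq_abs,
        Real.norm_of_nonneg (mul_nonneg (hr0 x) (Nat.cast_nonneg _))]
    simp only [e]
    refine ⟨fun g => (hsum g).summable.mul_left _, ?_⟩
    simp only [tsum_mul_left, (hsum _).tsum_eq]
    exact D.summable_shiftMoment f
  have hcomm := hF.tsum_comm (f := fun g x => D.coeff g * (r x * D.surj x g))
  -- Summing over `g` first leaves only `x = 0`, where `r 0 = m f * surj f f`.
  have e1 : ∀ x, ∑' g, D.coeff g * (r x * D.surj x g) = if x = 0 then r 0 else 0 := by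
    intro x
    have := ((D.hasSum_coeff x).mul_left (r x)).tsum_eq
    rw [show (fun g => D.coeff g * (r x * D.surj x g)) =
      fun g => r x * (D.coeff g * D.surj x g) by ext g; ring, this]
    split_ifs with h <;> simp [h]
  simp only [e1, tsum_mul_left, (hsum _).tsum_eq, tsum_ite_eq] at hcomm
  rw [← hcomm, hr]
  simp only [add_zero]
  rw [ENNReal.ofReal_toReal (hfin _ _), ENNReal.mul_div_cancel_right]
  · exact_mod_cast (D.surj_self_pos f).ne'
  · exact ENNReal.natCast_ne_top _

theorem eq_of_moments {m m' : (ι → ℕ) → ℝ≥0∞}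
    (hm : ∀ f, ∑' e, m e * (D.surj e f : ℝ≥0∞) = ENNReal.ofReal (D.moment f))
    (hm' : ∀ f, ∑' e, m' e * (D.surj e f : ℝ≥0∞) = ENNReal.ofReal (D.moment f)) : m = m' := by
  funext f
  rw [D.mass_eq_of_moments hm, D.mass_eq_of_moments hm']

end MomentData

end

/-! ### Semisimplicity and the list of irreducible representations -/

noncomputable section

namespace PTorsion

open Function

variable {p : ℕ} [Fact p.Prime] {Γ : Type*} [Group Γ]

/-- Build an intertwining map from an equivariant linear map. -/
def mkHom {V U : FinRep p Γ} (φ : V.carrier →ₗ[ZMod p] U.carrier)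
    (h : ∀ g v, φ (V.ρ g v) = U.ρ g (φ v)) : V.ρ.IntertwiningMap U.ρ :=
  ⟨φ, fun g => by ext v; exact h g v⟩

namespace FinRep

lemma Iso.refl (V : FinRep p Γ) : Iso V V := ⟨Representation.Equiv.refl V.ρ⟩

lemma Iso.symm {V U : FinRep p Γ} (h : Iso V U) : Iso U V := h.elim fun e => ⟨e.symm⟩

lemma Iso.trans {V U X : FinRep p Γ} (h : Iso V U) (h' : Iso U X) : Iso V X :=
  h.elim fun e => h'.elim fun e' => ⟨e.trans e'⟩

lemma Iso.of_bijective {V U : FinRep p Γ} (φ : V.ρ.IntertwiningMap U.ρ) (h : Bijective φ) :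
    Iso V U := ⟨φ.ofBijective h⟩

/-- The direct sum of two representations. -/
protected def prod (V U : FinRep p Γ) : FinRep p Γ where
  carrier := V.carrier × U.carrier
  ρ := V.ρ.prod U.ρ

/-- A subrepresentation as a representation. -/
def sub (V : FinRep p Γ) (S : Subrepresentation V.ρ) : FinRep p Γ where
  carrier := S.toSubmodule
  ρ := S.toRepresentation

/-- The dual representation. -/
def dual (V : FinRep p Γ) : FinRep p Γ where
  carrier := Module.Dual (ZMod p) V.carrier
  finite := Finite.of_injective _ DFunLike.coe_injective
  ρ := V.ρ.dual

lemma sub_invariants (V : FinRep p Γ) (S : Subrepresentation V.ρ) (h : V.ρ.invariants = ⊥) :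
    (V.sub S).ρ.invariants = ⊥ := by
  rw [eq_bot_iff]
  intro x hx
  have : Subtype.val (p := (· ∈ S.toSubmodule)) x ∈ V.ρ.invariants :=
    fun g => congrArg Subtype.val (hx g)
  rw [h] at this
  exact Subtype.ext this

/-- A subrepresentation of `S` pushes forward along the inclusion to one of `V` below `S`, to which
minimality of `S` applies. -/
lemma sub_irreducible (V : FinRep p Γ) (S : Subrepresentation V.ρ) (h : IsAtom S) :
    (V.sub S).ρ.IsIrreducible := by
  have hmap : ∀ R : Subrepresentation (V.sub S).ρ, ∃ R' : Subrepresentation V.ρ,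
      R' ≤ S ∧ ∀ x : S.toSubmodule, (x : V.carrier) ∈ R' ↔ x ∈ R := by
    intro R
    refine ⟨⟨R.toSubmodule.map S.toSubmodule.subtype, ?_⟩, ?_, ?_⟩
    · rintro g v ⟨x, hx, rfl⟩
      exact ⟨(V.sub S).ρ g x, R.apply_mem_toSubmodule g hx, rfl⟩
    · rintro v ⟨x, hx, rfl⟩
      exact x.2
    · intro x
      constructor
      · rintro ⟨y, hy, hyx⟩
        have : y = x := Subtype.ext hyx
        exact this ▸ hy
      · intro hx
        exact ⟨x, hx, rfl⟩
  refine { exists_pair_ne := ⟨⊥, ⊤, ?_⟩, eq_bot_or_eq_top := fun R => ?_ }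
  · intro hbt
    refine h.1 (le_bot_iff.1 fun x hx => ?_)
    have : (⟨x, hx⟩ : S.toSubmodule) ∈ (⊥ : Subrepresentation (V.sub S).ρ) := by
      rw [hbt]; trivial
    exact congrArg Subtype.val (show (⟨x, hx⟩ : S.toSubmodule) = 0 from this)
  · obtain ⟨R', hR', hmem⟩ := hmap R
    rcases h.le_iff.1 hR' with h0 | h1
    · left
      refine le_bot_iff.1 fun x hx => ?_
      have := (hmem x).2 hx
      rw [h0] at this
      exact Subtype.ext this
    · right
      refine top_le_iff.1 fun x _ => ?_
      refine (hmem x).1 ?_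
      rw [h1]
      exact Subtype.property (p := (· ∈ S.toSubmodule)) x

/-- A non-zero representation without invariants splits off an irreducible one. -/
lemma exists_iso_prod [Finite Γ] (hp : ¬ p ∣ Nat.card Γ) (V : FinRep p Γ)
    (hV : V.ρ.invariants = ⊥) [Nontrivial V.carrier] :
    ∃ S U : FinRep p Γ, S.ρ.IsIrreducible ∧ ¬ S.ρ.IsTrivial ∧ U.ρ.invariants = ⊥ ∧
      Nat.card U.carrier < Nat.card V.carrier ∧ Iso V (S.prod U) := by
  -- The hypothesis of Maschke's theorem, which provides the complement `T` below.
  have : NeZero (Nat.card Γ : ZMod p) :=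
    ⟨fun h => hp ((ZMod.natCast_eq_zero_iff _ _).1 h)⟩
  have hfin : Finite (Subrepresentation V.ρ) :=
    Finite.of_injective _ (SetLike.coe_injective (A := Subrepresentation V.ρ))
  have hne : (⊤ : Subrepresentation V.ρ) ≠ ⊥ := by
    obtain ⟨x, hx⟩ := exists_ne (0 : V.carrier)
    intro h
    have : x ∈ (⊥ : Subrepresentation V.ρ) := by rw [← h]; trivial
    exact hx this
  obtain ⟨S, hS, -⟩ := (eq_bot_or_exists_atom_le (⊤ : Subrepresentation V.ρ)).resolve_left hne
  obtain ⟨T, hT⟩ := exists_isCompl S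
  have hirr := V.sub_irreducible S hS
  have hinvS := V.sub_invariants S hV
  have hc : IsCompl S.toSubmodule T.toSubmodule := by
    refine ⟨disjoint_iff.2 ?_, codisjoint_iff.2 ?_⟩
    · exact congrArg Subrepresentation.toSubmodule hT.inf_eq_bot
    · exact congrArg Subrepresentation.toSubmodule hT.sup_eq_top
  have hbij : Iso ((V.sub S).prod (V.sub T)) V := by
    let e := Submodule.prodEquivOfIsCompl _ _ hc
    refine Iso.of_bijective (mkHom (V := (V.sub S).prod (V.sub T)) (U := V) e.toLinearMap ?_)
      e.bijective
    rintro g ⟨x, y⟩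
    change ((V.sub S).ρ g x : S.toSubmodule).1 + ((V.sub T).ρ g y : T.toSubmodule).1 =
      V.ρ g (x.1 + y.1)
    rw [map_add]
    rfl
  have hSne : ∃ x : V.carrier, x ∈ S ∧ x ≠ 0 := by
    by_contra h
    push Not at h
    exact hS.1 (le_bot_iff.1 fun x hx => h x hx)
  refine ⟨V.sub S, V.sub T, hirr, ?_, V.sub_invariants T hV, ?_, hbij.symm⟩
  · intro htriv
    have := Representation.invariants_eq_top (ρ := (V.sub S).ρ)
    rw [hinvS] at this
    obtain ⟨x, hx, hx0⟩ := hSne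
    have h1 : (⟨x, hx⟩ : S.toSubmodule) ∈ (⊥ : Submodule (ZMod p) S.toSubmodule) := by
      change _ ∈ (⊥ : Submodule (ZMod p) (V.sub S).carrier)
      rw [this]; trivial
    exact hx0 (congrArg Subtype.val (show (⟨x, hx⟩ : S.toSubmodule) = 0 from h1))
  · obtain ⟨x, hx, hx0⟩ := hSne
    refine Set.ncard_lt_ncard (s := (T.toSubmodule : Set V.carrier)) (t := Set.univ) ?_ |>.trans_eq
      (Set.ncard_univ _)
    rw [Set.ssubset_univ_iff]
    intro h
    have hxT : x ∈ T.toSubmodule := by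
      change x ∈ (T.toSubmodule : Set V.carrier)
      rw [h]; trivial
    exact hx0 ((Submodule.disjoint_def.1 hc.disjoint) x hx hxT)

variable {c : ℕ}

/-- Raise one multiplicity by one. -/
def succAt (f : Fin c → ℕ) (i : Fin c) : Fin c → ℕ := update f i (f i + 1)

lemma succAt_induction {P : (Fin c → ℕ) → Prop} (h0 : P 0)
    (hs : ∀ f i, P f → P (succAt f i)) (f : Fin c → ℕ) : P f := by
  induction hn : ∑ i, f i generalizing f with
  | zero =>
    have : f = 0 := by
      funext i
      exact (Finset.sum_eq_zero_iff.1 hn) i (Finset.mem_univ i)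
    exact this ▸ h0
  | succ n ih =>
    obtain ⟨i, -, hi⟩ : ∃ i ∈ Finset.univ, f i ≠ 0 := by
      by_contra h
      push Not at h
      rw [Finset.sum_eq_zero h] at hn
      omega
    have e : f = succAt (update f i (f i - 1)) i := by
      funext j
      by_cases hj : j = i
      · subst hj; simp [succAt]; omega
      · simp [succAt, hj]
    rw [e]
    refine hs _ _ (ih _ ?_)
    rw [Finset.sum_update_of_mem (Finset.mem_univ i)]
    rw [← Finset.add_sum_erase _ _ (Finset.mem_univ i), ← Finset.sdiff_singleton_eq_erase] at hn
    omega

lemma prod_iso_prodPow (W : Fin c → FinRep p Γ) (f : Fin c → ℕ) (i : Fin c) :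
    Iso ((W i).prod (prodPow W f)) (prodPow W (succAt f i)) := by
  classical
  -- The identity for `j = i` and zero otherwise, packaged so that no cast along `j = i` is needed.
  -- The new copy of `W i` goes in the last slot `a = f i`.
  let Θ : ∀ j, (W i).carrier →ₗ[ZMod p] (W j).carrier := update 0 i LinearMap.id
  have hΘ : ∀ j g x, Θ j ((W i).ρ g x) = (W j).ρ g (Θ j x) := by
    intro j g x
    by_cases h : j = i
    · subst h; simp [Θ]
    · simp [Θ, h]
  have hΘi : ∀ x, Θ i x = x := fun x => by simp [Θ]
  let φ : (W i).carrier × (∀ j : Fin c, Fin (f j) → (W j).carrier) →ₗ[ZMod p]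
      (∀ j : Fin c, Fin (succAt f i j) → (W j).carrier) :=
    { toFun := fun x j a => if h : a.1 < f j then x.2 j ⟨a.1, h⟩ else Θ j x.1
      map_add' := fun x y => by
        funext j a
        by_cases h : a.1 < f j <;> simp [h]
      map_smul' := fun r x => by
        funext j a
        by_cases h : a.1 < f j <;> simp [h] }
  have hlast : f i < succAt f i i := by simp [succAt]
  have hlt : ∀ (j) (a : Fin (f j)), a.1 < succAt f i j := by
    intro j a
    by_cases h : j = i
    · subst h; exact a.2.trans hlast
    · simp [succAt, h]
  refine Iso.of_bijective (mkHom (V := (W i).prod (prodPow W f))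
    (U := prodPow W (succAt f i)) φ ?_) ⟨?_, ?_⟩
  · intro g x
    funext j a
    change (if h : a.1 < f j then (W j).ρ g (x.2 j ⟨a.1, h⟩) else Θ j ((W i).ρ g x.1)) =
      (W j).ρ g (if h : a.1 < f j then x.2 j ⟨a.1, h⟩ else Θ j x.1)
    split_ifs with h
    · rfl
    · rw [hΘ]
  · rintro ⟨x, y⟩ ⟨x', y'⟩ h
    have h' : ∀ j a, φ (x, y) j a = φ (x', y') j a := fun j a => congrFun (congrFun h j) a
    refine Prod.ext ?_ ?_
    · have := h' i ⟨f i, hlast⟩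
      simpa [φ, hΘi] using this
    · funext j a
      have := h' j ⟨a.1, hlt j a⟩
      simpa [φ] using this
  · intro y
    refine ⟨(y i ⟨f i, hlast⟩, fun j a => y j ⟨a.1, hlt j a⟩), ?_⟩
    funext j a
    change (if h : a.1 < f j then y j ⟨a.1, _⟩ else Θ j (y i ⟨f i, hlast⟩)) = y j a
    split_ifs with h
    · rfl
    · by_cases hj : j = i
      · subst hj
        rw [hΘi]
        congr
        have := a.2
        simp [succAt] at this
        omega
      · have := a.2
        simp [succAt, hj] at this
        exact absurd this h

lemma prod_iso_prod {V V' U U' : FinRep p Γ} (h : Iso V V') (h' : Iso U U') :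
    Iso (V.prod U) (V'.prod U') := by
  obtain ⟨e⟩ := h
  obtain ⟨e'⟩ := h'
  let φ := LinearEquiv.prodCongr e.toLinearEquiv e'.toLinearEquiv
  refine Iso.of_bijective (mkHom (V := V.prod U) (U := V'.prod U') φ.toLinearMap ?_) φ.bijective
  rintro g ⟨x, y⟩
  exact Prod.ext (e.toIntertwiningMap.isIntertwining _ _ g x)
    (e'.toIntertwiningMap.isIntertwining _ _ g y)

/-- Every representation without invariants is a product of irreducible ones. -/
theorem exists_iso_prodPow [Finite Γ] (hp : ¬ p ∣ Nat.card Γ) {W : Fin c → FinRep p Γ}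
    (hW : IsListOfNontrivialIrreps W) (V : FinRep p Γ) (hV : V.ρ.invariants = ⊥) :
    ∃ f, Iso V (prodPow W f) := by
  induction hn : Nat.card V.carrier using Nat.strong_induction_on generalizing V with
  | _ n ih =>
    rcases subsingleton_or_nontrivial V.carrier with hs | hs
    · refine ⟨0, ?_⟩
      have : Subsingleton (prodPow W 0).carrier :=
        inferInstanceAs (Subsingleton (∀ i : Fin c, Fin 0 → (W i).carrier))
      refine Iso.of_bijective (mkHom 0 fun g v => by simp) ⟨?_, ?_⟩
      · exact fun _ _ _ => Subsingleton.elim _ _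
      · exact fun y => ⟨0, Subsingleton.elim _ _⟩
    · obtain ⟨S, U, hirr, hnt, hU, hlt, hiso⟩ := V.exists_iso_prod hp hV
      obtain ⟨f, hf⟩ := ih _ (hn ▸ hlt) U hU rfl
      obtain ⟨i, hi⟩ := hW.exhaustive S hirr hnt
      exact ⟨succAt f i, hiso.trans ((prod_iso_prod hi hf).trans (prod_iso_prodPow W f i))⟩

end FinRep

/-- A list of the non-trivial irreducible representations exists. -/
theorem exists_isListOfNontrivialIrreps [Finite Γ] :
    ∃ (c : ℕ) (W : Fin c → FinRep p Γ), IsListOfNontrivialIrreps W := by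
  classical
  have := Fintype.ofFinite Γ
  let T := {V : FinRep p Γ // V.ρ.IsIrreducible ∧ ¬ V.ρ.IsTrivial}
  let s : Setoid T :=
    { r := fun V U => FinRep.Iso V.1 U.1
      iseqv := ⟨fun V => .refl V.1, fun h => h.symm, fun h h' => h.trans h'⟩ }
  have hv : ∀ V : T, ∃ v : V.1.carrier, v ≠ 0 := by
    intro V
    by_contra h
    push Not at h
    have := V.2.1
    obtain ⟨A, B, hAB⟩ := exists_pair_ne (Subrepresentation V.1.ρ)
    refine hAB (SetLike.ext fun x => ?_)
    rw [h x]
    exact ⟨fun _ => B.toSubmodule.zero_mem, fun _ => A.toSubmodule.zero_mem⟩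
  choose v hv using hv
  -- Every irreducible is a quotient of the regular representation through `a ↦ ∑ a_g g v`. Its
  -- kernel determines it up to isomorphism, and the finite space `Γ → ZMod p` has finitely many
  -- subspaces.
  let Φ : ∀ V : T, (Γ → ZMod p) →ₗ[ZMod p] V.1.carrier := fun V =>
    ∑ g : Γ, (LinearMap.proj g).smulRight (V.1.ρ g (v V))
  have hΦ : ∀ V a, Φ V a = ∑ g : Γ, a g • V.1.ρ g (v V) := by
    intro V a
    simp [Φ]
  have hequiv : ∀ V h a, V.1.ρ h (Φ V a) = Φ V (fun g => a (h⁻¹ * g)) := by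
    intro V h a
    rw [hΦ, hΦ, map_sum, ← Equiv.sum_comp (Equiv.mulLeft h) (fun g => a (h⁻¹ * g) • V.1.ρ g (v V))]
    simp
  have hsurj : ∀ V, Surjective (Φ V) := by
    intro V
    have := V.2.1
    let S : Subrepresentation V.1.ρ := ⟨LinearMap.range (Φ V), by
      rintro h _ ⟨a, rfl⟩
      exact ⟨_, (hequiv V h a).symm⟩⟩
    have hS : v V ∈ S := ⟨Pi.single 1 1, by rw [hΦ]; simp [Pi.single_apply]⟩
    rcases eq_bot_or_eq_top S with h | h
    · rw [h] at hS
      exact absurd hS (hv V)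
    · intro x
      have : x ∈ S := by rw [h]; trivial
      exact this
  have hker : ∀ V U : T, LinearMap.ker (Φ V) = LinearMap.ker (Φ U) → s V U := by
    intro V U h
    let e := ((Φ V).quotKerEquivOfSurjective (hsurj V)).symm.trans
      ((Submodule.quotEquivOfEq _ _ h).trans ((Φ U).quotKerEquivOfSurjective (hsurj U)))
    have he : ∀ a, e (Φ V a) = Φ U a := by
      intro a
      have : ((Φ V).quotKerEquivOfSurjective (hsurj V)).symm (Φ V a) = Submodule.Quotient.mk a := by
        rw [LinearEquiv.symm_apply_eq]
        rfl
      simp only [e, LinearEquiv.trans_apply, this]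
      rfl
    refine FinRep.Iso.of_bijective (mkHom e.toLinearMap ?_) e.bijective
    intro g x
    obtain ⟨a, rfl⟩ := hsurj V x
    change e _ = U.1.ρ g (e _)
    rw [hequiv, he, he, hequiv]
  have hfin : Finite (Quotient s) :=
    Finite.of_injective (fun V : Quotient s => LinearMap.ker (Φ V.out)) fun V U h => by
      rw [← V.out_eq, ← U.out_eq]
      exact Quotient.sound (hker _ _ h)
  let e := Finite.equivFin (Quotient s)
  refine ⟨Nat.card (Quotient s), fun i => (e.symm i).out.1, fun i => (e.symm i).out.2.1,
    fun i => (e.symm i).out.2.2, fun i j h => ?_, fun V h1 h2 => ?_⟩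
  · apply e.symm.injective
    rw [← (e.symm i).out_eq, ← (e.symm j).out_eq]
    exact Quotient.sound h
  · refine ⟨e (Quotient.mk s ⟨V, h1, h2⟩), ?_⟩
    have : s (e.symm (e (Quotient.mk s ⟨V, h1, h2⟩))).out ⟨V, h1, h2⟩ := by
      apply Quotient.exact
      rw [Quotient.out_eq, Equiv.symm_apply_apply]
    exact FinRep.Iso.symm this

end PTorsion

end

/-! ### Schur's lemma and the number of surjections -/

noncomputable section

/-- A relation between the rows restricts the image when `M ≠ 0`. Conversely, independent rows give
a right inverse matrix, which acts on powers of `M` just as on powers of `K`. -/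
lemma Matrix.surjective_smul_iff {K M : Type*} [Field K] [AddCommGroup M] [Module K M]
    [Nontrivial M] {e f : ℕ} (A : Fin f → Fin e → K) :
    Function.Surjective (fun (x : Fin e → M) (a : Fin f) => ∑ b, A a b • x b) ↔
      LinearIndependent K A := by
  constructor
  · intro h
    rw [Fintype.linearIndependent_iff]
    intro g hg a
    obtain ⟨w, hw⟩ := exists_ne (0 : M)
    obtain ⟨x, hx⟩ := h (Pi.single a w)
    have h1 : ∑ a', g a' • (Pi.single a w : Fin f → M) a' = 0 := by
      rw [← hx]
      simp only [Finset.smul_sum, smul_smul]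
      rw [Finset.sum_comm]
      refine Finset.sum_eq_zero fun b _ => ?_
      rw [← Finset.sum_smul]
      have := congrFun hg b
      simp only [Finset.sum_apply, Pi.smul_apply, smul_eq_mul, Pi.zero_apply] at this
      rw [this, zero_smul]
    rw [Finset.sum_eq_single a (fun b _ hb => by simp [hb]) (by simp), Pi.single_eq_same] at h1
    exact (smul_eq_zero.1 h1).resolve_right hw
  · intro h
    have hs : Function.Surjective (Matrix.of A).mulVec := by
      have hr : (Matrix.of A).rank = f := by
        have := LinearIndependent.rank_matrix (M := Matrix.of A) h
        simpa using this
      have : LinearMap.range (Matrix.of A).mulVecLin = ⊤ :=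
        Submodule.eq_top_of_finrank_eq (by
          change (Matrix.of A).rank = _
          rw [hr]; simp)
      exact LinearMap.range_eq_top.1 this
    obtain ⟨B, hB⟩ := Matrix.mulVec_surjective_iff_exists_right_inverse.1 hs
    intro y
    refine ⟨fun b => ∑ a, B b a • y a, ?_⟩
    funext a
    simp only [Finset.smul_sum, smul_smul]
    rw [Finset.sum_comm]
    simp only [← Finset.sum_smul]
    have : ∀ a', ∑ b, A a b * B b a' = (1 : Matrix (Fin f) (Fin f) K) a a' := fun a' => by
      rw [← hB, Matrix.mul_apply]; rfl
    simp [this, Matrix.one_apply]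

lemma card_linearIndependent_eq_surjCount {K : Type*} [Field K] [Finite K] (e f : ℕ) :
    Nat.card {s : Fin f → Fin e → K // LinearIndependent K s} = surjCount (Nat.card K) e f := by
  have := Fintype.ofFinite K
  rcases le_or_gt f e with h | h
  · rw [card_linearIndependent (by simpa using h), surjCount, Finset.prod_range]
    simp
  · rw [surjCount_eq_zero h]
    have : IsEmpty {s : Fin f → Fin e → K // LinearIndependent K s} := ⟨fun s => by
      have := s.2.fintype_card_le_finrank
      simp at this
      omega⟩
    exact Nat.card_of_isEmpty

namespace PTorsion

open Function

section Field

variable {k G V : Type*} [Field k] [Group G] [AddCommGroup V] [Module k V]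

lemma EndRing.isField (ρ : Representation k G V) [ρ.IsIrreducible] [Finite V] :
    IsField (EndRing ρ) where
  exists_pair_ne := by
    refine ⟨0, 1, fun h => ?_⟩
    obtain ⟨A, B, hAB⟩ := exists_pair_ne (Subrepresentation ρ)
    have hv : ∀ v : V, v = 0 := fun v => by
      have := congrArg (fun f : EndRing ρ => f • v) h
      simpa using this.symm
    refine hAB (SetLike.ext fun x => ?_)
    rw [hv x]
    exact ⟨fun _ => B.toSubmodule.zero_mem, fun _ => A.toSubmodule.zero_mem⟩
  mul_comm := EndRing.mul_comm' ρ
  mul_inv_cancel := by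
    intro a ha
    have hb := (Representation.IsIrreducible.bijective_or_eq_zero (ρ := ρ) (σ := ρ) a).resolve_right
      ha
    refine ⟨((Representation.IntertwiningMap.ofBijective (ρ := ρ) (σ := ρ) a hb).symm.toIntertwiningMap :
      ρ.IntertwiningMap ρ), ?_⟩
    refine Representation.IntertwiningMap.ext (LinearMap.ext fun v => ?_)
    exact (Representation.IntertwiningMap.ofBijective (ρ := ρ) (σ := ρ) a hb).apply_symm_apply v

open Classical in
-- Built on `instCommRingEndRing`, so that linear algebra over `κ` uses the same ring structure as
-- `overEnd` and `eps`.
instance instFieldEndRing (ρ : Representation k G V) [ρ.IsIrreducible] [Finite V] :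
    Field (EndRing ρ) :=
  { instCommRingEndRing ρ with
    inv := fun a => if h : a = 0 then 0 else ((EndRing.isField ρ).mul_inv_cancel h).choose
    exists_pair_ne := (EndRing.isField ρ).exists_pair_ne
    mul_inv_cancel := fun a ha => by
      change a * (if h : a = 0 then 0 else ((EndRing.isField ρ).mul_inv_cancel h).choose) = 1
      rw [dif_neg ha]
      exact ((EndRing.isField ρ).mul_inv_cancel ha).choose_spec
    inv_zero := dif_pos rfl
    nnqsmul := _
    nnqsmul_def := fun _ _ => rfl
    qsmul := _
    qsmul_def := fun _ _ => rfl }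

instance (ρ : Representation k G V) [Finite V] : Finite (EndRing ρ) :=
  Finite.of_injective (fun f : ρ.IntertwiningMap ρ => (f : V → V))
    (DFunLike.coe_injective (F := ρ.IntertwiningMap ρ))

lemma nontrivial_of_isIrreducible (ρ : Representation k G V) [ρ.IsIrreducible] : Nontrivial V := by
  by_contra h
  rw [not_nontrivial_iff_subsingleton] at h
  obtain ⟨A, B, hAB⟩ := exists_pair_ne (Subrepresentation ρ)
  refine hAB (SetLike.ext fun x => ?_)
  rw [Subsingleton.elim x 0]
  exact ⟨fun _ => B.toSubmodule.zero_mem, fun _ => A.toSubmodule.zero_mem⟩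

end Field

variable {p : ℕ} [Fact p.Prime] {Γ : Type*} [Group Γ]

namespace FinRep

lemma two_le_q (V : FinRep p Γ) [V.ρ.IsIrreducible] : 2 ≤ V.q :=
  Finite.one_lt_card (α := EndRing V.ρ)

lemma card_carrier (V : FinRep p Γ) [V.ρ.IsIrreducible] : Nat.card V.carrier = V.q ^ V.n :=
  Module.natCard_eq_pow_finrank (K := EndRing V.ρ)

lemma n_pos (V : FinRep p Γ) [V.ρ.IsIrreducible] : 0 < V.n := by
  have := nontrivial_of_isIrreducible V.ρ
  have : Module.Finite (EndRing V.ρ) V.carrier := Module.Finite.of_finite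
  exact Module.finrank_pos (R := EndRing V.ρ)

variable {c : ℕ}

lemma card_prodPow (W : Fin c → FinRep p Γ) (f : Fin c → ℕ) :
    Nat.card (prodPow W f).carrier = ∏ i, Nat.card (W i).carrier ^ f i := by
  change Nat.card (∀ i : Fin c, Fin (f i) → (W i).carrier) = _
  rw [Nat.card_pi]
  refine Finset.prod_congr rfl fun i _ => ?_
  rw [Nat.card_pi]
  simp

/-- A surjective endomorphism of a finite representation is bijective; hence `|Aut V|` is the
diagonal entry of the surjection array. -/
lemma cardAut_eq_cardSur (V : FinRep p Γ) : V.cardAut = cardSur V V := by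
  refine Nat.card_congr
    { toFun := fun e => ⟨e.toIntertwiningMap, e.toLinearEquiv.surjective⟩
      invFun := fun φ => Representation.IntertwiningMap.ofBijective φ.1
        ⟨Finite.injective_iff_surjective.2 φ.2, φ.2⟩
      left_inv := fun e => Representation.Equiv.ext rfl
      right_inv := fun φ => rfl }

lemma cardSur_congr_right (X : FinRep p Γ) {V U : FinRep p Γ} (h : Iso V U) :
    cardSur X V = cardSur X U := by
  obtain ⟨e⟩ := h
  refine Nat.card_congr
    { toFun := fun φ => ⟨e.toIntertwiningMap.comp φ.1, e.toLinearEquiv.surjective.comp φ.2⟩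
      invFun := fun φ => ⟨e.symm.toIntertwiningMap.comp φ.1,
        e.symm.toLinearEquiv.surjective.comp φ.2⟩
      left_inv := fun φ => ?_
      right_inv := fun φ => ?_ }
  · exact Subtype.ext (DFunLike.ext _ _ fun x => e.symm_apply_apply _)
  · exact Subtype.ext (DFunLike.ext _ _ fun x => e.apply_symm_apply _)

/-- The inclusion of a factor. -/
def incl (W : Fin c → FinRep p Γ) (e : Fin c → ℕ) (i : Fin c) (b : Fin (e i)) :
    (W i).ρ.IntertwiningMap (prodPow W e).ρ :=
  mkHom (V := W i) (U := prodPow W e)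
    ((LinearMap.single (ZMod p) (fun i : Fin c => Fin (e i) → (W i).carrier) i).comp
      (LinearMap.single (ZMod p) (fun _ : Fin (e i) => (W i).carrier) b)) fun g v => by
    change Pi.single i (Pi.single b ((W i).ρ g v)) = fun j a => (W j).ρ g
      (Pi.single (M := fun i : Fin c => Fin (e i) → (W i).carrier) i (Pi.single b v) j a)
    funext j a
    by_cases hj : j = i
    · subst hj
      by_cases ha : a = b
      · subst ha; simp
      · simp [ha]
    · simp [hj]

/-- The projection to a factor. -/
def projTo (W : Fin c → FinRep p Γ) (e : Fin c → ℕ) (i : Fin c) (b : Fin (e i)) :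
    (prodPow W e).ρ.IntertwiningMap (W i).ρ :=
  mkHom (V := prodPow W e) (U := W i)
    ((LinearMap.proj b).comp (LinearMap.proj (R := ZMod p)
      (φ := fun i : Fin c => Fin (e i) → (W i).carrier) i)) fun _ _ => rfl

lemma incl_apply (W : Fin c → FinRep p Γ) (e : Fin c → ℕ) (i : Fin c) (b : Fin (e i))
    (w : (W i).carrier) : incl W e i b w =
      Pi.single (M := fun i : Fin c => Fin (e i) → (W i).carrier) i (Pi.single b w) := rfl

lemma sum_incl (W : Fin c → FinRep p Γ) (e : Fin c → ℕ) (x : (prodPow W e).carrier) :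
    ∑ i, ∑ b, incl W e i b (x i b) = x := by
  change (∑ i, ∑ b, incl W e i b (x i b) : ∀ i : Fin c, Fin (e i) → (W i).carrier) = x
  simp only [incl_apply]
  funext j a
  simp only [Finset.sum_apply]
  rw [Finset.sum_eq_single j (fun i _ hi => Finset.sum_eq_zero fun b _ => by
    rw [Pi.single_eq_of_ne hi.symm]; rfl) (by simp), Finset.sum_eq_single a]
  · simp
  · intro b _ hb
    simp [hb.symm]
  · simp

/-- The homomorphism given by matrices over the endomorphism fields. -/
def matrixHom (W : Fin c → FinRep p Γ) (e f : Fin c → ℕ)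
    (A : ∀ i, Fin (f i) → Fin (e i) → EndRing (W i).ρ) :
    (prodPow W e).ρ.IntertwiningMap (prodPow W f).ρ :=
  mkHom (V := prodPow W e) (U := prodPow W f)
    { toFun := fun x i a => ∑ b, A i a b • x i b
      map_add' := fun x y => by
        funext i a
        change ∑ b, A i a b • (x i b + y i b) = ∑ b, A i a b • x i b + ∑ b, A i a b • y i b
        simp only [smul_add, Finset.sum_add_distrib]
      map_smul' := fun r x => by
        funext i a
        change ∑ b, A i a b • (r • x i b) = r • ∑ b, A i a b • x i b
        simp only [Finset.smul_sum, EndRing.smul_def, map_smul] } fun g x => by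
    funext i a
    change ∑ b, A i a b • ((W i).ρ g (x i b)) = (W i).ρ g (∑ b, A i a b • x i b)
    rw [map_sum]
    exact Finset.sum_congr rfl fun b _ => (A i a b).isIntertwining _ _ g _

lemma matrixHom_apply (W : Fin c → FinRep p Γ) (e f : Fin c → ℕ)
    (A : ∀ i, Fin (f i) → Fin (e i) → EndRing (W i).ρ) (x : (prodPow W e).carrier) (i : Fin c)
    (a : Fin (f i)) : matrixHom W e f A x i a = ∑ b, A i a b • x i b := rfl

end FinRep

open FinRep

variable {c : ℕ} {W : Fin c → FinRep p Γ}

lemma IsListOfNontrivialIrreps.hom_eq_zero (hW : IsListOfNontrivialIrreps W) {i j : Fin c}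
    (h : i ≠ j) (φ : (W i).ρ.IntertwiningMap (W j).ρ) : φ = 0 := by
  have := hW.irreducible i
  have := hW.irreducible j
  refine (Representation.IsIrreducible.bijective_or_eq_zero φ).resolve_left fun hb => ?_
  exact h (hW.distinct i j (Iso.of_bijective φ hb))

/-- Matrix entries are recovered through the inclusions and projections, and Schur's lemma kills the
components between different irreducibles. -/
lemma IsListOfNontrivialIrreps.matrixHom_bijective (hW : IsListOfNontrivialIrreps W)
    (e f : Fin c → ℕ) : Bijective (matrixHom W e f) := by
  constructor
  · intro A B h
    funext i a b
    refine Representation.IntertwiningMap.ext (LinearMap.ext fun w => ?_)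
    have key : ∀ A : ∀ i, Fin (f i) → Fin (e i) → EndRing (W i).ρ,
        matrixHom W e f A (incl W e i b w) i a = A i a b • w := by
      intro A
      rw [matrixHom_apply, incl_apply, Finset.sum_eq_single b]
      · simp
      · intro b' _ hb'
        simp [hb']
      · simp
    have h1 := key A
    rw [h, key B] at h1
    exact h1.symm
  · intro φ
    refine ⟨fun i a b => (projTo W f i a).comp (φ.comp (incl W e i b)), ?_⟩
    refine Representation.IntertwiningMap.ext (LinearMap.ext fun x => ?_)
    funext i a
    change ∑ b, φ (incl W e i b (x i b)) i a = φ x i a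
    have h1 : φ x i a = ∑ j, ∑ b, φ (incl W e j b (x j b)) i a := by
      conv_lhs => rw [← sum_incl W e x]
      change projTo W f i a (φ _) = ∑ j, ∑ b, projTo W f i a (φ _)
      simp only [map_sum]
    rw [h1, Finset.sum_eq_single i]
    · intro j _ hj
      refine Finset.sum_eq_zero fun b _ => ?_
      have := hW.hom_eq_zero hj ((projTo W f i a).comp (φ.comp (incl W e j b)))
      exact congrArg (fun ψ : (W j).ρ.IntertwiningMap (W i).ρ => ψ (x j b)) this
    · simp

lemma IsListOfNontrivialIrreps.matrixHom_surjective_iff (hW : IsListOfNontrivialIrreps W)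
    (e f : Fin c → ℕ) (A : ∀ i, Fin (f i) → Fin (e i) → EndRing (W i).ρ) :
    Surjective (matrixHom W e f A) ↔
      ∀ i, have := hW.irreducible i; LinearIndependent (EndRing (W i).ρ) (A i) := by
  have h1 : ∀ i, have := hW.irreducible i; (LinearIndependent (EndRing (W i).ρ) (A i) ↔
      Surjective (fun (x : Fin (e i) → (W i).carrier) (a : Fin (f i)) => ∑ b, A i a b • x b)) := by
    intro i
    have := hW.irreducible i
    have := nontrivial_of_isIrreducible (W i).ρ
    exact (Matrix.surjective_smul_iff (A i)).symm
  constructor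
  · intro h i
    refine (h1 i).2 fun y => ?_
    classical
    obtain ⟨x, hx⟩ := h (Pi.single (M := fun i : Fin c => Fin (f i) → (W i).carrier) i y)
    refine ⟨x i, ?_⟩
    have := congrFun hx i
    rw [Pi.single_eq_same] at this
    exact this
  · intro h y
    choose x hx using fun i => (h1 i).1 (h i) (y i)
    exact ⟨x, funext hx⟩

/-- The number of surjections between products of irreducible representations. -/
theorem IsListOfNontrivialIrreps.cardSur_prodPow (hW : IsListOfNontrivialIrreps W)
    (e f : Fin c → ℕ) :
    cardSur (prodPow W e) (prodPow W f) = ∏ i, surjCount (W i).q (e i) (f i) := by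
  let E := Equiv.ofBijective _ (hW.matrixHom_bijective e f)
  have h1 : cardSur (prodPow W e) (prodPow W f) =
      Nat.card {A : ∀ i, Fin (f i) → Fin (e i) → EndRing (W i).ρ //
        ∀ i, LinearIndependent (EndRing (W i).ρ) (A i)} := by
    refine Nat.card_congr (E.subtypeEquiv fun A => ?_).symm
    exact (hW.matrixHom_surjective_iff e f A).symm
  rw [h1, Nat.card_congr (Equiv.subtypePiEquivPi (p := fun i
    (B : Fin (f i) → Fin (e i) → EndRing (W i).ρ) => LinearIndependent (EndRing (W i).ρ) B)),
    Nat.card_pi]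
  refine Finset.prod_congr rfl fun i _ => ?_
  have := hW.irreducible i
  exact card_linearIndependent_eq_surjCount (K := EndRing (W i).ρ) (e i) (f i)

end PTorsion

end

/-! ### Invariants, duality and invariant forms -/

noncomputable section

namespace PTorsion

open Function

lemma finrank_eq_of_separating {k A B : Type*} [Field k] [AddCommGroup A] [Module k A]
    [FiniteDimensional k A] [AddCommGroup B] [Module k B] [FiniteDimensional k B]
    (P : A →ₗ[k] B →ₗ[k] k) (h1 : ∀ a, (∀ b, P a b = 0) → a = 0)
    (h2 : ∀ b, (∀ a, P a b = 0) → b = 0) : Module.finrank k B = Module.finrank k A := by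
  have i1 : Injective P := (injective_iff_map_eq_zero P).2 fun a ha => h1 a fun b => by simp [ha]
  have i2 : Injective P.flip := (injective_iff_map_eq_zero P.flip).2 fun b hb => h2 b fun a => by
    simpa using congrArg (fun F => F a) hb
  have e1 := LinearMap.finrank_le_finrank_of_injective i1
  have e2 := LinearMap.finrank_le_finrank_of_injective i2
  have d1 := Subspace.dual_finrank_eq (K := k) (V := A)
  have d2 := Subspace.dual_finrank_eq (K := k) (V := B)
  exact le_antisymm (e2.trans d1.le) (e1.trans d2.le)

section Invariants

variable {k G V : Type*} [Field k] [Group G] [Finite G] [AddCommGroup V] [Module k V]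

/-- In the non-modular case an invariant vector is detected by an invariant functional. -/
lemma exists_invariant_dual (hG : (Nat.card G : k) ≠ 0) (ρ : Representation k G V) {v : V}
    (hv : v ∈ ρ.invariants) (hv0 : v ≠ 0) : ∃ φ ∈ ρ.dual.invariants, φ v ≠ 0 := by
  have := Fintype.ofFinite G
  by_contra h
  push Not at h
  refine hv0 ((Module.forall_dual_apply_eq_zero_iff k v).1 fun φ => ?_)
  -- The sum of the translates of `φ` is invariant and takes the value `|G| φ(v)` on the invariant
  -- vector `v`.
  have h1 := h (ρ.dual.norm φ) fun g => Representation.self_norm_apply _ _ _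
  have h2 : ρ.dual.norm φ v = (Nat.card G : k) * φ v := by
    simp only [Representation.norm, LinearMap.sum_apply]
    have : ∀ g, ρ.dual g φ v = φ v := fun g => congrArg φ (hv g⁻¹)
    rw [Finset.sum_congr rfl fun g _ => this g]
    simp
  rw [h2] at h1
  exact (mul_eq_zero.1 h1).resolve_left hG

/-- In the non-modular case an invariant functional is detected by an invariant vector. -/
lemma exists_invariant (hG : (Nat.card G : k) ≠ 0) (ρ : Representation k G V)
    {φ : Module.Dual k V} (hφ : φ ∈ ρ.dual.invariants) (h0 : φ ≠ 0) :
    ∃ v ∈ ρ.invariants, φ v ≠ 0 := by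
  have := Fintype.ofFinite G
  by_contra h
  push Not at h
  refine h0 (LinearMap.ext fun v => ?_)
  have h1 := h (ρ.norm v) fun g => Representation.self_norm_apply _ _ _
  have h2 : φ (ρ.norm v) = (Nat.card G : k) * φ v := by
    simp only [Representation.norm, LinearMap.sum_apply, map_sum]
    have : ∀ g, φ (ρ g v) = φ v := fun g => by
      have := congrArg (fun ψ => ψ v) (hφ g⁻¹)
      change φ (ρ g⁻¹⁻¹ v) = φ v at this
      rwa [inv_inv] at this
    rw [Finset.sum_congr rfl fun g _ => this g]
    simp
  rw [h2] at h1
  exact (mul_eq_zero.1 h1).resolve_left hG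

lemma invariants_ne_bot_iff (hG : (Nat.card G : k) ≠ 0) (ρ : Representation k G V) :
    ρ.invariants ≠ ⊥ ↔ ρ.dual.invariants ≠ ⊥ := by
  rw [Submodule.ne_bot_iff, Submodule.ne_bot_iff]
  constructor
  · rintro ⟨v, hv, h0⟩
    obtain ⟨φ, hφ, h⟩ := exists_invariant_dual hG ρ hv h0
    exact ⟨φ, hφ, fun h' => h (by simp [h'])⟩
  · rintro ⟨φ, hφ, h0⟩
    obtain ⟨v, hv, h⟩ := exists_invariant hG ρ hφ h0
    exact ⟨v, hv, fun h' => h (by simp [h'])⟩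

/-- Evaluation pairs the two spaces of invariants, and the averaging lemmas say that it is
non-degenerate on both sides. -/
lemma finrank_dual_invariants [FiniteDimensional k V] (hG : (Nat.card G : k) ≠ 0)
    (ρ : Representation k G V) :
    Module.finrank k ρ.dual.invariants = Module.finrank k ρ.invariants := by
  refine finrank_eq_of_separating (A := ρ.invariants) (B := ρ.dual.invariants)
    (LinearMap.mk₂ k (fun v φ => φ.1 v.1) (by simp) (by simp) (by simp) (by simp)) ?_ ?_
  · intro v hv
    by_contra h
    obtain ⟨φ, hφ, hne⟩ := exists_invariant_dual hG ρ v.2 (fun h' => h (Subtype.ext h'))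
    exact hne (hv ⟨φ, hφ⟩)
  · intro φ hφ
    by_contra h
    obtain ⟨v, hv, hne⟩ := exists_invariant hG ρ φ.2 (fun h' => h (Subtype.ext h'))
    exact hne (hφ ⟨v, hv⟩)

end Invariants

section Forms

variable {k G V U : Type*} [Field k] [Group G] [AddCommGroup V] [Module k V] [AddCommGroup U]
  [Module k U]

/-- Invariant bilinear forms. -/
def BilForm (ρ : Representation k G V) (τ : Representation k G U) : Type _ :=
  {B : V →ₗ[k] U →ₗ[k] k // ∀ g v w, B (ρ g v) (τ g w) = B v w}

/-- Invariant alternating forms. -/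
def AltForm (ρ : Representation k G V) : Type _ :=
  {B : V →ₗ[k] V →ₗ[k] k // (∀ g v w, B (ρ g v) (ρ g w) = B v w) ∧ ∀ v, B v v = 0}

/-- A bilinear alternating form as an alternating map. -/
def altMapOfForm (B : V →ₗ[k] V →ₗ[k] k) (h : ∀ v, B v v = 0) : V [⋀^Fin 2]→ₗ[k] k where
  toFun v := B (v 0) (v 1)
  map_update_add' m i x y := by
    fin_cases i <;> simp
  map_update_smul' m i r x := by
    fin_cases i <;> simp
  map_eq_zero_of_eq' v i j hij hne := by
    fin_cases i <;> fin_cases j <;> simp_all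

/-- An alternating map in two variables as a bilinear form. -/
def formOfAltMap (F : V [⋀^Fin 2]→ₗ[k] k) : V →ₗ[k] V →ₗ[k] k :=
  have h0 : ∀ v w x : V, update ![v, w] 0 x = ![x, w] := fun v w x => by
    funext i; fin_cases i <;> rfl
  have h1 : ∀ v w x : V, update ![v, w] 1 x = ![v, x] := fun v w x => by
    funext i; fin_cases i <;> rfl
  LinearMap.mk₂ k (fun v w => F ![v, w])
    (fun v v' w => by simpa only [h0] using F.map_update_add ![v, w] 0 v v')
    (fun r v w => by simpa only [h0] using F.map_update_smul ![v, w] 0 r v)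
    (fun v w w' => by simpa only [h1] using F.map_update_add ![v, w] 1 w w')
    (fun r v w => by simpa only [h1] using F.map_update_smul ![v, w] 1 r w)

/-- Invariant functionals on the exterior square are invariant alternating forms. -/
def wedgeDualEquiv (ρ : Representation k G V) :
    (exteriorSquare ρ).dual.invariants ≃ AltForm ρ where
  toFun F := ⟨formOfAltMap (F.1.compAlternatingMap (exteriorPower.ιMulti k 2)), by
    constructor
    · intro g v w
      have h := congrArg (fun φ => φ (exteriorPower.ιMulti k 2 ![v, w])) (F.2 g⁻¹)
      change F.1 (exteriorPower.map 2 (ρ g⁻¹⁻¹) (exteriorPower.ιMulti k 2 ![v, w])) = _ at h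
      rw [inv_inv, exteriorPower.map_apply_ιMulti] at h
      have e : (ρ g ∘ ![v, w]) = ![ρ g v, ρ g w] := by
        funext i; fin_cases i <;> rfl
      rw [e] at h
      exact h
    · intro v
      have := (exteriorPower.ιMulti k 2 (M := V)).map_eq_zero_of_eq ![v, v] (i := 0) (j := 1)
        rfl (by simp)
      exact (congrArg F.1 this).trans (map_zero _)⟩
  invFun B := ⟨exteriorPower.alternatingMapLinearEquiv (altMapOfForm B.1 B.2.2), fun g => by
    apply exteriorPower.linearMap_ext
    ext v
    change exteriorPower.alternatingMapLinearEquiv (altMapOfForm B.1 B.2.2)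
      (exteriorPower.map 2 (ρ g⁻¹) (exteriorPower.ιMulti k 2 v)) =
      exteriorPower.alternatingMapLinearEquiv (altMapOfForm B.1 B.2.2)
      (exteriorPower.ιMulti k 2 v)
    rw [exteriorPower.map_apply_ιMulti, exteriorPower.alternatingMapLinearEquiv_apply_ιMulti,
      exteriorPower.alternatingMapLinearEquiv_apply_ιMulti]
    exact B.2.1 _ _ _⟩
  left_inv F := by
    apply Subtype.ext
    apply exteriorPower.linearMap_ext
    ext v
    simp only [LinearMap.compAlternatingMap_apply]
    rw [exteriorPower.alternatingMapLinearEquiv_apply_ιMulti]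
    change F.1 (exteriorPower.ιMulti k 2 ![v 0, v 1]) = _
    congr 2
  right_inv B := by
    apply Subtype.ext
    ext v w
    change exteriorPower.alternatingMapLinearEquiv (altMapOfForm B.1 B.2.2)
      (exteriorPower.ιMulti k 2 ![v, w]) = _
    rw [exteriorPower.alternatingMapLinearEquiv_apply_ιMulti]
    rfl

/-- Invariant functionals on the tensor product are invariant bilinear forms. -/
def tprodDualEquiv (ρ : Representation k G V) (τ : Representation k G U) :
    (ρ.tprod τ).dual.invariants ≃ BilForm ρ τ where
  toFun F := ⟨TensorProduct.curry F.1, fun g v w => by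
    have h := congrArg (fun φ => φ (v ⊗ₜ w)) (F.2 g⁻¹)
    change F.1 (ρ g⁻¹⁻¹ v ⊗ₜ τ g⁻¹⁻¹ w) = _ at h
    rw [inv_inv] at h
    exact h⟩
  invFun B := ⟨TensorProduct.lift B.1, fun g => by
    apply TensorProduct.ext'
    intro v w
    exact B.2 g⁻¹ v w⟩
  left_inv F := Subtype.ext (TensorProduct.ext' fun v w => rfl)
  right_inv B := Subtype.ext (by ext v w; rfl)

/-- Invariant forms are equivariant maps to the dual. -/
def bilFormEquiv (ρ : Representation k G V) (τ : Representation k G U) :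
    BilForm ρ τ ≃ τ.IntertwiningMap ρ.dual where
  toFun B := ⟨B.1.flip, fun g => by
    ext u v
    change B.1 v (τ g u) = B.1 (ρ g⁻¹ v) u
    rw [← B.2 g⁻¹ v (τ g u)]
    simp⟩
  invFun φ := ⟨φ.toLinearMap.flip, fun g v u => by
    change φ (τ g u) (ρ g v) = φ u v
    rw [Representation.IntertwiningMap.isIntertwining]
    change φ u (ρ g⁻¹ (ρ g v)) = φ u v
    simp⟩
  left_inv B := rfl
  right_inv φ := rfl

/-- Exchange the two variables of an invariant form. -/
def bilFormFlip (ρ : Representation k G V) (τ : Representation k G U) :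
    BilForm ρ τ ≃ BilForm τ ρ where
  toFun B := ⟨B.1.flip, fun g v w => B.2 g w v⟩
  invFun B := ⟨B.1.flip, fun g v w => B.2 g w v⟩
  left_inv _ := rfl
  right_inv _ := rfl

/-- Alternating forms on a direct sum. -/
def altFormProd (ρ : Representation k G V) (τ : Representation k G U) :
    AltForm (ρ.prod τ) ≃ AltForm ρ × AltForm τ × BilForm ρ τ where
  toFun B :=
    (⟨B.1.compl₁₂ (LinearMap.inl k V U) (LinearMap.inl k V U),
        fun g v w => by
          have := B.2.1 g (v, 0) (w, 0)
          simpa using this, fun v => B.2.2 _⟩,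
      ⟨B.1.compl₁₂ (LinearMap.inr k V U) (LinearMap.inr k V U),
        fun g v w => by
          have := B.2.1 g (0, v) (0, w)
          simpa using this, fun v => B.2.2 _⟩,
      ⟨B.1.compl₁₂ (LinearMap.inl k V U) (LinearMap.inr k V U),
        fun g v w => by
          have := B.2.1 g (v, 0) (0, w)
          simpa using this⟩)
  invFun B :=
    ⟨B.1.1.compl₁₂ (LinearMap.fst k V U) (LinearMap.fst k V U) +
      B.2.1.1.compl₁₂ (LinearMap.snd k V U) (LinearMap.snd k V U) +
      (B.2.2.1.compl₁₂ (LinearMap.fst k V U) (LinearMap.snd k V U) -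
        (B.2.2.1.compl₁₂ (LinearMap.fst k V U) (LinearMap.snd k V U)).flip),
      fun g v w => by
        simp [B.1.2.1, B.2.1.2.1, B.2.2.2],
      fun v => by
        simp [B.1.2.2, B.2.1.2.2]⟩
  left_inv B := by
    apply Subtype.ext
    -- An alternating form is skew, so one off-diagonal block determines the other.
    have hsw : ∀ x y, B.1 x y = - B.1 y x := by
      intro x y
      have := B.2.2 (x + y)
      simp only [map_add, LinearMap.add_apply, B.2.2, zero_add, add_zero] at this
      exact eq_neg_of_add_eq_zero_right this
    refine LinearMap.ext fun ⟨v, u⟩ => LinearMap.ext fun ⟨v', u'⟩ => ?_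
    change B.1 (v, 0) (v', 0) + B.1 (0, u) (0, u') + (B.1 (v, 0) (0, u') - B.1 (v', 0) (0, u)) =
      B.1 (v, u) (v', u')
    have e : ∀ (x : V) (y : U), (x, y) = (x, 0) + (0, y) := fun x y => by simp
    rw [e v u, e v' u']
    simp only [map_add, LinearMap.add_apply]
    rw [hsw (0, u) (v', 0)]
    ring
  right_inv B := by
    obtain ⟨⟨B1, h1⟩, ⟨B2, h2⟩, ⟨B3, h3⟩⟩ := B
    refine Prod.ext (Subtype.ext ?_) (Prod.ext (Subtype.ext ?_) (Subtype.ext ?_)) <;>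
    · ext v w
      simp

end Forms

end PTorsion

end

/-! ### Counting invariant forms on sums of irreducibles -/

noncomputable section

namespace PTorsion

open Function

section Forms

variable {k G V U V' U' : Type*} [Field k] [Group G] [AddCommGroup V] [Module k V] [AddCommGroup U]
  [Module k U] [AddCommGroup V'] [Module k V'] [AddCommGroup U'] [Module k U']

/-- Transport of invariant alternating forms along an isomorphism. -/
def altFormCongr {ρ : Representation k G V} {ρ' : Representation k G V'} (e : ρ.Equiv ρ') :
    AltForm ρ ≃ AltForm ρ' where
  toFun B := ⟨B.1.compl₁₂ e.symm.toLinearMap e.symm.toLinearMap, fun g v w => by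
      change B.1 (e.symm.toIntertwiningMap _) (e.symm.toIntertwiningMap _) = _
      rw [Representation.IntertwiningMap.isIntertwining,
        Representation.IntertwiningMap.isIntertwining, B.2.1]
      rfl, fun v => B.2.2 _⟩
  invFun B := ⟨B.1.compl₁₂ e.toLinearMap e.toLinearMap, fun g v w => by
      change B.1 (e.toIntertwiningMap _) (e.toIntertwiningMap _) = _
      rw [Representation.IntertwiningMap.isIntertwining,
        Representation.IntertwiningMap.isIntertwining, B.2.1]
      rfl, fun v => B.2.2 _⟩
  left_inv B := by
    apply Subtype.ext
    refine LinearMap.ext fun v => LinearMap.ext fun w => ?_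
    change B.1 (e.symm (e v)) (e.symm (e w)) = _
    simp
  right_inv B := by
    apply Subtype.ext
    refine LinearMap.ext fun v => LinearMap.ext fun w => ?_
    change B.1 (e (e.symm v)) (e (e.symm w)) = _
    simp

instance (ρ : Representation k G V) (τ : Representation k G U) [Finite V] [Finite U] [Finite k] :
    Finite (BilForm ρ τ) :=
  Finite.of_injective (fun B : BilForm ρ τ => fun v u => B.1 v u) fun _ _ h =>
    Subtype.ext (LinearMap.ext fun v => LinearMap.ext fun u => congrFun (congrFun h v) u)

/-- Forget that an invariant form is alternating. -/
def AltForm.toBilForm {ρ : Representation k G V} (B : AltForm ρ) : BilForm ρ ρ := ⟨B.1, B.2.1⟩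

lemma AltForm.toBilForm_injective {ρ : Representation k G V} :
    Injective (AltForm.toBilForm (ρ := ρ)) := fun _ _ h =>
  Subtype.ext (congrArg (fun B : BilForm ρ ρ => B.1) h)

/-- The common kernel of a subrepresentation of the dual is a subrepresentation of `V`, hence zero
or everything, and a dimension count returns to the dual. -/
lemma dual_isIrreducible [FiniteDimensional k V] (ρ : Representation k G V) [ρ.IsIrreducible] :
    ρ.dual.IsIrreducible := by
  have hnt := nontrivial_of_isIrreducible ρ
  refine { exists_pair_ne := ⟨⊥, ⊤, fun h => ?_⟩, eq_bot_or_eq_top := fun S => ?_ }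
  · obtain ⟨v, hv⟩ := exists_ne (0 : V)
    refine hv ((Module.forall_dual_apply_eq_zero_iff k v).1 fun φ => ?_)
    have : φ ∈ (⊥ : Subrepresentation ρ.dual) := by rw [h]; trivial
    rw [show φ = 0 from this]
    rfl
  · let A : Submodule k (Module.Dual k V) := S.toSubmodule
    let T : Subrepresentation ρ := ⟨A.dualCoannihilator, fun g v hv => by
      rw [Submodule.mem_dualCoannihilator] at hv ⊢
      intro φ hφ
      have := hv _ (S.apply_mem_toSubmodule g⁻¹ hφ)
      change φ (ρ g⁻¹⁻¹ v) = 0 at this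
      rwa [inv_inv] at this⟩
    have hdim := Subspace.finrank_add_finrank_dualCoannihilator_eq A
    rcases eq_bot_or_eq_top T with h | h
    · right
      have hT : A.dualCoannihilator = ⊥ := congrArg Subrepresentation.toSubmodule h
      rw [hT, finrank_bot, add_zero, ← Subspace.dual_finrank_eq] at hdim
      have hA : A = ⊤ := Submodule.eq_top_of_finrank_eq hdim
      exact Subrepresentation.toSubmodule_injective hA
    · left
      have hT : A.dualCoannihilator = ⊤ := congrArg Subrepresentation.toSubmodule h
      rw [hT, finrank_top] at hdim
      have hA : A = ⊥ := Submodule.finrank_eq_zero.1 (by omega)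
      exact Subrepresentation.toSubmodule_injective hA

end Forms

variable {p : ℕ} [Fact p.Prime] {Γ : Type*} [Group Γ]

namespace FinRep

/-- The number of invariant alternating forms. -/
def cardAlt (V : FinRep p Γ) : ℕ := Nat.card (AltForm V.ρ)

/-- The number of invariant bilinear forms. -/
def cardBil (V U : FinRep p Γ) : ℕ := Nat.card (BilForm V.ρ U.ρ)

/-- Invariant alternating forms are the invariant functionals on `⋀² V`, and invariant functionals
and invariant vectors span spaces of equal dimension. -/
lemma cardWedgeInv_eq [Finite Γ] (hp : ¬ p ∣ Nat.card Γ) (V : FinRep p Γ) :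
    V.cardWedgeInv = V.cardAlt := by
  have hfin : Finite (AltForm V.ρ) := Finite.of_injective _ AltForm.toBilForm_injective
  have e : V.cardAlt = Nat.card (exteriorSquare V.ρ).dual.invariants :=
    Nat.card_congr (wedgeDualEquiv V.ρ).symm
  rw [e, cardWedgeInv,
    Module.natCard_eq_pow_finrank (K := ZMod p) (V := (exteriorSquare V.ρ).invariants),
    Module.natCard_eq_pow_finrank (K := ZMod p) (V := (exteriorSquare V.ρ).dual.invariants)]
  congr 1
  exact (finrank_dual_invariants (fun h => hp ((ZMod.natCast_eq_zero_iff _ _).1 h)) _).symm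

lemma Iso.cardAlt_eq {V U : FinRep p Γ} (h : Iso V U) : V.cardAlt = U.cardAlt :=
  h.elim fun e => Nat.card_congr (altFormCongr e)

lemma Iso.card_eq {V U : FinRep p Γ} (h : Iso V U) : Nat.card V.carrier = Nat.card U.carrier :=
  h.elim fun e => Nat.card_congr e.toLinearEquiv.toEquiv

lemma cardAlt_prod (V U : FinRep p Γ) :
    (V.prod U).cardAlt = V.cardAlt * (U.cardAlt * cardBil V U) := by
  have := Nat.card_congr (altFormProd V.ρ U.ρ)
  rw [Nat.card_prod, Nat.card_prod] at this
  exact this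

lemma cardBil_comm (V U : FinRep p Γ) : cardBil V U = cardBil U V :=
  Nat.card_congr (bilFormFlip V.ρ U.ρ)

variable {c : ℕ}

/-- Invariant forms on a product of irreducible representations. -/
def bilFormProdPow (V : FinRep p Γ) (W : Fin c → FinRep p Γ) (f : Fin c → ℕ) :
    BilForm V.ρ (prodPow W f).ρ ≃ ∀ j, Fin (f j) → BilForm V.ρ (W j).ρ where
  toFun B j a := ⟨B.1.compl₂ (incl W f j a).toLinearMap, fun g v w => by
    change B.1 _ (incl W f j a _) = _
    rw [Representation.IntertwiningMap.isIntertwining, B.2]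
    rfl⟩
  invFun C := ⟨∑ j, ∑ a, (C j a).1.compl₂ (projTo W f j a).toLinearMap, fun g v x => by
    simp only [LinearMap.sum_apply, LinearMap.compl₂_apply]
    exact Finset.sum_congr rfl fun j _ => Finset.sum_congr rfl fun a _ => (C j a).2 g v (x j a)⟩
  left_inv B := by
    apply Subtype.ext
    refine LinearMap.ext fun v => LinearMap.ext fun x => ?_
    simp only [LinearMap.sum_apply, LinearMap.compl₂_apply]
    conv_rhs => rw [← sum_incl W f x]
    simp only [map_sum]
    rfl
  right_inv C := by
    funext j a
    apply Subtype.ext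
    refine LinearMap.ext fun v => LinearMap.ext fun w => ?_
    simp only [LinearMap.compl₂_apply, LinearMap.sum_apply]
    have key : ∀ i b, projTo W f i b (incl W f j a w) =
        Pi.single (M := fun i : Fin c => Fin (f i) → (W i).carrier) j (Pi.single a w) i b :=
      fun i b => rfl
    change ∑ i, ∑ b, (C i b).1 v (projTo W f i b (incl W f j a w)) = _
    simp only [key]
    rw [Finset.sum_eq_single j (fun i _ hi => Finset.sum_eq_zero fun b _ => by simp [hi])
      (by simp), Finset.sum_eq_single a (fun b _ hb => by simp [hb]) (by simp)]
    simp

lemma cardBil_prodPow (V : FinRep p Γ) (W : Fin c → FinRep p Γ) (f : Fin c → ℕ) :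
    cardBil V (prodPow W f) = ∏ j, cardBil V (W j) ^ f j := by
  unfold cardBil
  rw [Nat.card_congr (bilFormProdPow V W f), Nat.card_pi]
  refine Finset.prod_congr rfl fun j _ => ?_
  rw [Nat.card_pi]
  simp

/-- A non-zero invariant form is a non-zero equivariant map from `U` to the dual of `V`, hence an
isomorphism by Schur's lemma. -/
lemma isDual_iff_exists_bilForm (V U : FinRep p Γ) [V.ρ.IsIrreducible] [U.ρ.IsIrreducible] :
    IsDual V U ↔ ∃ B : BilForm V.ρ U.ρ, B.1 ≠ 0 := by
  have := dual_isIrreducible V.ρ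
  constructor
  · rintro ⟨e⟩
    refine ⟨(bilFormEquiv V.ρ U.ρ).symm e.symm.toIntertwiningMap, fun h => ?_⟩
    have := nontrivial_of_isIrreducible U.ρ
    obtain ⟨u, hu⟩ := exists_ne (0 : U.carrier)
    have h1 : e.symm u = 0 := by
      refine LinearMap.ext fun v => ?_
      exact congrArg (fun B : V.carrier →ₗ[ZMod p] U.carrier →ₗ[ZMod p] ZMod p => B v u) h
    have h2 := e.apply_symm_apply u
    rw [h1] at h2
    exact hu (h2.symm.trans e.toLinearEquiv.map_zero)
  · rintro ⟨B, hB⟩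
    rcases Representation.IsIrreducible.bijective_or_eq_zero (bilFormEquiv V.ρ U.ρ B) with h | h
    · exact ⟨((bilFormEquiv V.ρ U.ρ B).ofBijective h).symm⟩
    · refine absurd (LinearMap.ext fun v => LinearMap.ext fun u => ?_) hB
      exact congrArg (fun φ : U.ρ.IntertwiningMap V.ρ.dual => φ u v) h

lemma IsDual.symm {V U : FinRep p Γ} [V.ρ.IsIrreducible] [U.ρ.IsIrreducible] (h : IsDual V U) :
    IsDual U V := by
  rw [isDual_iff_exists_bilForm] at h ⊢
  obtain ⟨B, hB⟩ := h
  refine ⟨bilFormFlip V.ρ U.ρ B, fun h' => hB ?_⟩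
  exact LinearMap.ext fun v => LinearMap.ext fun u =>
    congrArg (fun B : U.carrier →ₗ[ZMod p] V.carrier →ₗ[ZMod p] ZMod p => B u v) h'

lemma cardBil_of_isDual {V U : FinRep p Γ} (h : IsDual V U) : cardBil V U = U.q := by
  obtain ⟨e⟩ := h
  refine (Nat.card_congr (bilFormEquiv V.ρ U.ρ)).trans (Nat.card_congr (β := EndRing U.ρ)
    { toFun := fun φ => e.toIntertwiningMap.comp φ
      invFun := fun φ => e.symm.toIntertwiningMap.comp (φ : U.ρ.IntertwiningMap U.ρ)
      left_inv := fun φ => DFunLike.ext _ _ fun x => e.symm_apply_apply _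
      right_inv := fun φ => DFunLike.ext (F := U.ρ.IntertwiningMap U.ρ) _ _ fun x =>
        e.apply_symm_apply _ })

lemma cardBil_of_not_isDual {V U : FinRep p Γ} [V.ρ.IsIrreducible] [U.ρ.IsIrreducible]
    (h : ¬ IsDual V U) : cardBil V U = 1 := by
  rw [isDual_iff_exists_bilForm] at h
  push Not at h
  have : Unique (BilForm V.ρ U.ρ) :=
    { default := ⟨0, fun g v w => rfl⟩, uniq := fun B => Subtype.ext (h B) }
  exact Nat.card_unique

lemma IsDual.q_eq {V U : FinRep p Γ} [V.ρ.IsIrreducible] [U.ρ.IsIrreducible] (h : IsDual V U) :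
    U.q = V.q := by
  rw [← cardBil_of_isDual h, cardBil_comm, cardBil_of_isDual h.symm]

lemma IsDual.n_eq {V U : FinRep p Γ} [V.ρ.IsIrreducible] [U.ρ.IsIrreducible] (h : IsDual V U) :
    U.n = V.n := by
  have h1 : Nat.card U.carrier = Nat.card V.carrier := by
    obtain ⟨e⟩ := h
    rw [← Nat.card_congr e.toLinearEquiv.toEquiv,
      Module.natCard_eq_pow_finrank (K := ZMod p) (V := Module.Dual (ZMod p) V.carrier),
      Module.natCard_eq_pow_finrank (K := ZMod p) (V := V.carrier), Subspace.dual_finrank_eq]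
  rw [card_carrier, card_carrier, h.q_eq] at h1
  exact Nat.pow_right_injective V.two_le_q h1

lemma cardAlt_le_cardBil (V : FinRep p Γ) : V.cardAlt ≤ cardBil V V :=
  Nat.card_le_card_of_injective _ AltForm.toBilForm_injective

lemma cardAlt_pos (V : FinRep p Γ) : 0 < V.cardAlt := by
  have : Finite (AltForm V.ρ) := Finite.of_injective _ AltForm.toBilForm_injective
  have : Nonempty (AltForm V.ρ) := ⟨⟨0, fun _ _ _ => rfl, fun _ => rfl⟩⟩
  exact Nat.card_pos

lemma cardAlt_of_not_isDual {V : FinRep p Γ} [V.ρ.IsIrreducible] (h : ¬ IsDual V V) :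
    V.cardAlt = 1 :=
  le_antisymm (V.cardAlt_le_cardBil.trans (cardBil_of_not_isDual h).le) V.cardAlt_pos

lemma cardAlt_le_q (V : FinRep p Γ) [V.ρ.IsIrreducible] : V.cardAlt ≤ V.q := by
  by_cases h : IsDual V V
  · exact V.cardAlt_le_cardBil.trans (cardBil_of_isDual h).le
  · rw [cardAlt_of_not_isDual h]
    exact V.two_le_q.trans' one_le_two

end FinRep

open FinRep

variable {c : ℕ} {W : Fin c → FinRep p Γ}

lemma IsListOfNontrivialIrreps.exists_isDual (hW : IsListOfNontrivialIrreps W) (i : Fin c) :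
    ∃ j, IsDual (W i) (W j) := by
  have := hW.irreducible i
  have hirr : (W i).dual.ρ.IsIrreducible := dual_isIrreducible (W i).ρ
  have hnt : ¬ (W i).dual.ρ.IsTrivial := by
    intro h
    refine hW.nontrivial i ⟨fun g => LinearMap.ext fun v => ?_⟩
    rw [← sub_eq_zero]
    refine (Module.forall_dual_apply_eq_zero_iff (ZMod p) _).1 fun φ => ?_
    have h1 := congrArg (fun ψ : Module.Dual (ZMod p) (W i).carrier => ψ v)
      ((W i).dual.ρ.isTrivial_apply g⁻¹ φ)
    change φ ((W i).ρ g⁻¹⁻¹ v) = φ v at h1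
    rw [inv_inv] at h1
    rw [map_sub, h1]
    exact sub_self _
  exact hW.exhaustive _ hirr hnt

/-- The duality involution on the list of irreducible representations. -/
def IsListOfNontrivialIrreps.dualIndex (hW : IsListOfNontrivialIrreps W) (i : Fin c) : Fin c :=
  (hW.exists_isDual i).choose

lemma IsListOfNontrivialIrreps.isDual_iff (hW : IsListOfNontrivialIrreps W) (i j : Fin c) :
    IsDual (W i) (W j) ↔ hW.dualIndex i = j := by
  have hs := (hW.exists_isDual i).choose_spec
  constructor
  · rintro ⟨e⟩
    obtain ⟨e'⟩ := hs
    exact hW.distinct _ _ ⟨e'.symm.trans e⟩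
  · rintro rfl
    exact hs

lemma IsListOfNontrivialIrreps.dualIndex_involutive (hW : IsListOfNontrivialIrreps W) :
    Involutive hW.dualIndex := by
  intro i
  have := hW.irreducible i
  have := hW.irreducible (hW.dualIndex i)
  rw [← hW.isDual_iff]
  exact ((hW.isDual_iff _ _).2 rfl).symm

/-- The numerical data of a list of irreducible representations. -/
def IsListOfNontrivialIrreps.momentData (hW : IsListOfNontrivialIrreps W) {u : ℕ} (hu : 0 < u) :
    MomentData (Fin c) where
  q i := (W i).q
  a i := u * (W i).n
  s i := (W i).cardAlt
  σ := hW.dualIndex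
  involutive := hW.dualIndex_involutive
  two_le_q i := have := hW.irreducible i; (W i).two_le_q
  a_pos i := have := hW.irreducible i; Nat.mul_pos hu (W i).n_pos
  s_le i := have := hW.irreducible i; (W i).cardAlt_le_q
  q_σ i := by
    have := hW.irreducible i
    have := hW.irreducible (hW.dualIndex i)
    exact ((hW.isDual_iff _ _).2 rfl).q_eq

lemma IsListOfNontrivialIrreps.cardBil_irreducible (hW : IsListOfNontrivialIrreps W)
    (i j : Fin c) : cardBil (W i) (W j) = if hW.dualIndex i = j then (W i).q else 1 := by
  have := hW.irreducible i
  have := hW.irreducible j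
  split_ifs with h
  · have hd := (hW.isDual_iff i j).2 h
    rw [cardBil_of_isDual hd, hd.q_eq]
  · exact cardBil_of_not_isDual fun hd => h ((hW.isDual_iff i j).1 hd)

/-- The number of invariant alternating forms on a product of irreducible representations. -/
lemma IsListOfNontrivialIrreps.cardAlt_prodPow (hW : IsListOfNontrivialIrreps W)
    (f : Fin c → ℕ) : (prodPow W f).cardAlt = ∏ i, if hW.dualIndex i = i then
      (W i).q ^ (f i).choose 2 * (W i).cardAlt ^ f i
      else if i < hW.dualIndex i then (W i).q ^ (f i * f (hW.dualIndex i)) else 1 := by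
  induction f using succAt_induction with
  | h0 =>
    have : Unique (AltForm (prodPow W 0).ρ) :=
      { default := ⟨0, fun _ _ _ => rfl, fun _ => rfl⟩
        uniq := fun B => Subtype.ext (LinearMap.ext fun v => by
          have : Subsingleton (prodPow W 0).carrier :=
            inferInstanceAs (Subsingleton (∀ i : Fin c, Fin 0 → (W i).carrier))
          rw [Subsingleton.elim v 0, map_zero, map_zero]) }
    rw [cardAlt, Nat.card_unique]
    simp
  | hs f i ih =>
    have hi := hW.irreducible i
    have hinv := hW.dualIndex_involutive
    rw [← (prod_iso_prodPow W f i).cardAlt_eq, cardAlt_prod, ih, cardBil_prodPow]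
    simp only [hW.cardBil_irreducible]
    have h1 : ∏ j, (if hW.dualIndex i = j then (W i).q else 1) ^ f j =
        (W i).q ^ f (hW.dualIndex i) := by
      rw [Finset.prod_eq_single (hW.dualIndex i)]
      · simp
      · intro j _ hj
        rw [if_neg hj.symm, one_pow]
      · simp
    rw [h1]
    have hne : ∀ j, j ≠ i → succAt f i j = f j := fun j hj => by simp [succAt, hj]
    have hself : succAt f i i = f i + 1 := by simp [succAt]
    -- Adding one copy of `W i` changes a single factor, the one at the smaller of `i` and its dual
    -- index, since a dual pair is recorded there. The three cases below locate it.
    have hstep : ∀ (j₀ : Fin c) (F F' : Fin c → ℕ) (r : ℕ), (∀ j, j ≠ j₀ → F' j = F j) →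
        F' j₀ = r * F j₀ → r * ∏ j, F j = ∏ j, F' j := by
      intro j₀ F F' r h h0
      rw [← Finset.mul_prod_erase _ F (Finset.mem_univ j₀),
        ← Finset.mul_prod_erase _ F' (Finset.mem_univ j₀), h0, mul_assoc]
      congr 2
      exact Finset.prod_congr rfl fun j hj => (h j (Finset.ne_of_mem_erase hj)).symm
    rw [mul_comm _ ((W i).q ^ _), ← mul_assoc]
    rcases lt_trichotomy (hW.dualIndex i) i with hlt | heq | hlt
    · refine hstep (hW.dualIndex i) _ _ _ (fun j hj => ?_) ?_
      · by_cases hji : j = i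
        · subst hji
          simp [hlt.ne, hlt.not_gt]
        · have h2 : hW.dualIndex j ≠ i := fun h => hj (by rw [← h, hinv])
          rw [hne j hji, hne _ h2]
      · have hq : (W (hW.dualIndex i)).q = (W i).q := by
          have := hW.irreducible (hW.dualIndex i)
          exact ((hW.isDual_iff i _).2 rfl).q_eq
        rw [hinv i, if_neg hlt.ne', if_neg hlt.ne', if_pos hlt, if_pos hlt, hself, hne _ hlt.ne, hq,
          cardAlt_of_not_isDual (fun h => hlt.ne ((hW.isDual_iff i i).1 h)), one_mul, ← pow_add]
        congr 1
        ring
    · refine hstep i _ _ _ (fun j hj => ?_) ?_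
      · have h2 : hW.dualIndex j ≠ i := fun h => hj (by rw [← hinv j, h, heq])
        rw [hne j hj, hne _ h2]
      · rw [if_pos heq, if_pos heq, hself, heq, Nat.choose_succ_succ' (f i) 1]
        simp only [Nat.choose_one_right]
        ring
    · refine hstep i _ _ _ (fun j hj => ?_) ?_
      · by_cases h2 : hW.dualIndex j = i
        · have hj2 : hW.dualIndex i = j := by rw [← h2, hinv]
          have hc : ¬ j < i := by rw [← hj2]; exact hlt.not_gt
          simp only [h2, hj.symm, if_false, hc]
        · rw [hne j hj, hne _ h2]
      · rw [if_neg hlt.ne', if_neg hlt.ne', if_pos hlt, if_pos hlt, hself, hne _ hlt.ne',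
          cardAlt_of_not_isDual (fun h => hlt.ne' ((hW.isDual_iff i i).1 h)), one_mul, ← pow_add]
        congr 1
        ring

/-- The prescribed moments in terms of multiplicities. -/
theorem IsListOfNontrivialIrreps.moment_eq [Finite Γ] (hp : ¬ p ∣ Nat.card Γ)
    (hW : IsListOfNontrivialIrreps W) {u : ℕ} (hu : 0 < u) (f : Fin c → ℕ) :
    ((prodPow W f).cardWedgeInv : ℝ) / (Nat.card (prodPow W f).carrier : ℝ) ^ u =
      (hW.momentData hu).moment f := by
  set D := hW.momentData hu with hD
  have hcard : (Nat.card (prodPow W f).carrier : ℝ) ^ u = ∏ i, (D.q i : ℝ) ^ (D.a i * f i) := by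
    rw [card_prodPow, Nat.cast_prod, ← Finset.prod_pow]
    refine Finset.prod_congr rfl fun i _ => ?_
    have := hW.irreducible i
    rw [FinRep.card_carrier]
    change _ = ((W i).q : ℝ) ^ (u * (W i).n * f i)
    push_cast
    rw [← pow_mul, ← pow_mul]
    congr 1
    ring
  have ha : ∀ i, D.a (D.σ i) = D.a i := by
    intro i
    have := hW.irreducible i
    have := hW.irreducible (hW.dualIndex i)
    change u * (W (hW.dualIndex i)).n = u * (W i).n
    rw [((hW.isDual_iff i _).2 rfl).n_eq]
  rw [hcard, cardWedgeInv_eq hp, hW.cardAlt_prodPow,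
    prod_eq_prod_involution D.involutive (fun i => (D.q i : ℝ) ^ (D.a i * f i)),
    MomentData.moment]
  have h1 : ((∏ i, if hW.dualIndex i = i then (W i).q ^ (f i).choose 2 * (W i).cardAlt ^ f i
      else if i < hW.dualIndex i then (W i).q ^ (f i * f (hW.dualIndex i)) else 1 : ℕ) : ℝ) =
      (∏ i with D.σ i = i, (D.q i : ℝ) ^ (f i).choose 2 * (D.s i : ℝ) ^ f i) *
        ∏ i with i < D.σ i, (D.q i : ℝ) ^ (f i * f (D.σ i)) := by
    rw [Nat.cast_prod, Finset.prod_filter, Finset.prod_filter, ← Finset.prod_mul_distrib]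
    refine Finset.prod_congr rfl fun i _ => ?_
    change _ = (if hW.dualIndex i = i then _ else _) * (if i < hW.dualIndex i then _ else _)
    by_cases h : hW.dualIndex i = i
    · have h' : ¬ i < hW.dualIndex i := by rw [h]; exact lt_irrefl i
      rw [if_pos h, if_pos h, if_neg h', mul_one]
      push_cast
      rfl
    · rw [if_neg h, if_neg h, one_mul]
      split_ifs
      · push_cast; rfl
      · simp
  rw [h1, mul_div_mul_comm, ← Finset.prod_div_distrib, ← Finset.prod_div_distrib]
  congr 1
  refine Finset.prod_congr rfl fun i _ => ?_
  rw [D.q_σ, ha, moment₂, mul_add, pow_add]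

end PTorsion

end

/-! ### The sign `ε` and the number of alternating forms -/

noncomputable section

/-- A twisted eigenspace of a non-trivial involution of a finite field has half the dimension. -/
lemma card_sq_of_involution {K : Type*} [Field K] (σ : K →+* K) (hσ : ∀ c, σ (σ c) = c)
    (hne : ∃ d, σ d ≠ d) (l : K) (hl : l * σ l = 1) :
    Nat.card {c : K // l * σ c = -c} ^ 2 = Nat.card K := by
  obtain ⟨d, hd⟩ := hne
  have he : d - σ d ≠ 0 := sub_ne_zero.2 (Ne.symm hd)
  -- An element with `t + σ t = 1`. It replaces `1/2` in the splitting of `K`, so the argument also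
  -- covers characteristic two.
  set t := d / (d - σ d) with ht
  have hst : t + σ t = 1 := by
    have h2 : σ d - d ≠ 0 := sub_ne_zero.2 hd
    rw [ht, map_div₀, map_sub, hσ, ← neg_sub d (σ d)]
    field_simp
    ring
  have e1 : K ≃ {c : K // l * σ c = c} × {c : K // l * σ c = -c} :=
    { toFun := fun c => (⟨c - t * (c - l * σ c), by
          simp only [map_sub, map_mul, hσ]
          linear_combination (c - l * σ c) * hst + (σ t * c) * hl⟩, ⟨c - l * σ c, by
          simp only [map_sub, map_mul, hσ]
          linear_combination (-c) * hl⟩)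
      invFun := fun x => x.1 + t * x.2
      left_inv := fun c => by simp
      right_inv := fun x => by
        obtain ⟨⟨a, ha⟩, ⟨b, hb⟩⟩ := x
        have h : a + t * b - l * σ (a + t * b) = b := by
          simp only [map_add, map_mul]
          linear_combination b * hst - ha - σ t * hb
        refine Prod.ext (Subtype.ext ?_) (Subtype.ext h)
        change a + t * b - t * (a + t * b - l * σ (a + t * b)) = a
        rw [h]
        ring }
  -- Multiplication by `d - σ d`, which `σ` negates, interchanges the two twisted eigenspaces.
  have e2 : {c : K // l * σ c = c} ≃ {c : K // l * σ c = -c} :=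
    { toFun := fun c => ⟨(d - σ d) * c, by
        have := c.2
        simp only [map_mul, map_sub, hσ]
        linear_combination (σ d - d) * this⟩
      invFun := fun c => ⟨(d - σ d)⁻¹ * c, by
        have := c.2
        have h3 : σ (d - σ d) = -(d - σ d) := by rw [map_sub, hσ]; ring
        rw [map_mul, map_inv₀, h3, inv_neg]
        linear_combination (-(d - σ d)⁻¹) * this⟩
      left_inv := fun c => by
        apply Subtype.ext
        simp [he]
      right_inv := fun c => by
        apply Subtype.ext
        simp [he] }
  rw [Nat.card_congr e1, Nat.card_prod, Nat.card_congr e2, sq]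

/-- Any functional with `ℓ 1 ≠ 0` works, since `x * x⁻¹ = 1`. It plays the role of the trace in
comparing forms over `k` with forms over `κ`. -/
lemma exists_nondegenerate_functional (k K : Type*) [Field k] [Field K] [Algebra k K] :
    ∃ ℓ : K →ₗ[k] k, ∀ x, (∀ c, ℓ (x * c) = 0) → x = 0 := by
  obtain ⟨ℓ, hℓ⟩ : ∃ ℓ : K →ₗ[k] k, ℓ 1 ≠ 0 := by
    by_contra! h
    exact one_ne_zero ((Module.forall_dual_apply_eq_zero_iff k (1 : K)).1 h)
  refine ⟨ℓ, fun x hx => by_contra fun h0 => hℓ ?_⟩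
  rw [← mul_inv_cancel₀ h0]
  exact hx _

lemma functional_eq_mul {k K : Type*} [Field k] [Field K] [Algebra k K] [Finite K]
    {ℓ : K →ₗ[k] k} (hℓ : ∀ x, (∀ c, ℓ (x * c) = 0) → x = 0) (φ : K →ₗ[k] k) :
    ∃ x, ∀ c, φ c = ℓ (x * c) := by
  let Ψ : K →ₗ[k] Module.Dual k K := (LinearMap.mul k K).compr₂ ℓ
  have hi : Function.Injective Ψ := (injective_iff_map_eq_zero Ψ).2 fun x hx => hℓ x fun c =>
    congrArg (fun φ : Module.Dual k K => φ c) hx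
  obtain ⟨x, hx⟩ := (LinearMap.injective_iff_surjective_of_finrank_eq_finrank
    (Subspace.dual_finrank_eq).symm).1 hi φ
  exact ⟨x, fun c => by rw [← hx]; rfl⟩

namespace PTorsion

open Function

variable {p : ℕ} [Fact p.Prime] {Γ : Type*} [Group Γ]

section InvariantForms

variable {k G V : Type*} [Field k] [Group G] [Finite G] [AddCommGroup V] [Module k V]

lemma invariants_exteriorSquare_ne_bot_iff  (hG : (Nat.card G : k) ≠ 0) (ρ : Representation k G V) :
    (exteriorSquare ρ).invariants ≠ ⊥ ↔ ∃ b : AltForm ρ, b.1 ≠ 0 := by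
  rw [invariants_ne_bot_iff hG, Submodule.ne_bot_iff]
  have h0 : ∀ F : (exteriorSquare ρ).dual.invariants,
      F.1 = 0 ↔ (wedgeDualEquiv _ F).1 = 0 := fun F => by
    constructor
    · intro h
      refine LinearMap.ext fun v => LinearMap.ext fun w => ?_
      change F.1 _ = 0
      rw [h]
      rfl
    · intro h
      have : wedgeDualEquiv _ F = wedgeDualEquiv _ 0 := by
        refine Subtype.ext (h.trans ?_)
        rfl
      rw [(wedgeDualEquiv _).injective this]
      rfl
  constructor
  · rintro ⟨F, hF, hne⟩
    exact ⟨wedgeDualEquiv _ ⟨F, hF⟩, fun h => hne ((h0 ⟨F, hF⟩).2 h)⟩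
  · rintro ⟨b, hb⟩
    refine ⟨((wedgeDualEquiv _).symm b).1, ((wedgeDualEquiv _).symm b).2, fun h => hb ?_⟩
    rw [h0, Equiv.apply_symm_apply] at h
    exact h

lemma invariants_tprod_ne_bot_iff (hG : (Nat.card G : k) ≠ 0) (ρ : Representation k G V) :
    (ρ.tprod ρ).invariants ≠ ⊥ ↔
      ∃ b : BilForm ρ ρ, b.1 ≠ 0 := by
  rw [invariants_ne_bot_iff hG, Submodule.ne_bot_iff]
  constructor
  · rintro ⟨F, hF, hne⟩
    refine ⟨tprodDualEquiv _ _ ⟨F, hF⟩, fun h => hne (TensorProduct.ext' fun v w => ?_)⟩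
    exact congrArg (fun b : V →ₗ[k] V →ₗ[k] k => b v w) h
  · rintro ⟨b, hb⟩
    refine ⟨((tprodDualEquiv _ _).symm b).1, ((tprodDualEquiv _ _).symm b).2, fun h => hb ?_⟩
    refine LinearMap.ext fun v => LinearMap.ext fun w => ?_
    exact congrArg (fun F : Module.Dual (k) (V ⊗[k] V) => F (v ⊗ₜ w)) h

end InvariantForms

section Adjoint

variable {k G V : Type*} [Field k] [Group G] [AddCommGroup V] [Module k V] [Finite V]
  {ρ : Representation k G V} [ρ.IsIrreducible]

lemma EndRing.mul_smul_apply (c d : EndRing ρ) (v : V) : (c * d) • v = c • d • v := rfl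

lemma EndRing.one_smul_apply (v : V) : (1 : EndRing ρ) • v = v := rfl

lemma BilForm.isIntertwining_endRing (c : EndRing ρ) (g : G) (v : V) : c • ρ g v = ρ g (c • v) :=
  Representation.IntertwiningMap.isIntertwining ρ ρ c g v

/-- The form `(v, w) ↦ B (v, c w)`. -/
def BilForm.twist (B : BilForm ρ ρ) (c : EndRing ρ) : BilForm ρ ρ :=
  ⟨B.1.compl₂ (Representation.IntertwiningMap.toLinearMap (ρ := ρ) (σ := ρ) c), fun g v w => by
    change B.1 _ (c • ρ g w) = _
    rw [BilForm.isIntertwining_endRing, B.2]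
    rfl⟩

lemma BilForm.twist_apply (B : BilForm ρ ρ) (c : EndRing ρ) (v w : V) :
    (B.twist c).1 v w = B.1 v (c • w) := rfl

/-- A non-zero invariant form on an irreducible representation identifies the endomorphism ring
with the space of invariant forms. -/
lemma BilForm.bijective_twist (B : BilForm ρ ρ) (hB : B.1 ≠ 0) : Bijective B.twist := by
  have hfin : FiniteDimensional k V := inferInstance
  have := dual_isIrreducible ρ
  have hb : Bijective (bilFormEquiv ρ ρ B) := by
    refine (Representation.IsIrreducible.bijective_or_eq_zero _).resolve_right fun h => hB ?_
    refine LinearMap.ext fun v => LinearMap.ext fun u => ?_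
    exact congrArg (fun φ : ρ.IntertwiningMap ρ.dual => φ u v) h
  constructor
  · intro c d h
    refine Representation.IntertwiningMap.ext (LinearMap.ext fun w => hb.1 ?_)
    refine LinearMap.ext fun v => ?_
    exact congrArg (fun C : BilForm ρ ρ => C.1 v w) h
  · intro C
    let e := (bilFormEquiv ρ ρ B).ofBijective hb
    let c : ρ.IntertwiningMap ρ := e.symm.toIntertwiningMap.comp (bilFormEquiv ρ ρ C)
    refine ⟨c, Subtype.ext (LinearMap.ext fun v => LinearMap.ext fun w => ?_)⟩
    exact congrArg (fun φ : Module.Dual k V => φ v) (e.apply_symm_apply (bilFormEquiv ρ ρ C w))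

lemma BilForm.eq_of_forall (B : BilForm ρ ρ) (hB : B.1 ≠ 0) {c d : EndRing ρ}
    (h : ∀ v w, B.1 v (c • w) = B.1 v (d • w)) : c = d :=
  (B.bijective_twist hB).1 (Subtype.ext (LinearMap.ext fun v => LinearMap.ext fun w => h v w))

lemma BilForm.exists_twist (B : BilForm ρ ρ) (hB : B.1 ≠ 0) (C : BilForm ρ ρ) :
    ∃ c : EndRing ρ, ∀ v w, C.1 v w = B.1 v (c • w) := by
  obtain ⟨c, hc⟩ := (B.bijective_twist hB).2 C
  exact ⟨c, fun v w => by rw [← hc]; rfl⟩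

/-- The form `(v, w) ↦ B (c v, w)`. -/
def BilForm.twistLeft (B : BilForm ρ ρ) (c : EndRing ρ) : BilForm ρ ρ :=
  ⟨B.1.comp (Representation.IntertwiningMap.toLinearMap (ρ := ρ) (σ := ρ) c), fun g v w => by
    change B.1 (c • ρ g v) _ = _
    rw [BilForm.isIntertwining_endRing, B.2]
    rfl⟩

/-- Every non-zero invariant form defines an adjoint involution of the endomorphism field, and a
scalar relating the form to its transpose. -/
lemma BilForm.exists_adjoint (B : BilForm ρ ρ) (hB : B.1 ≠ 0) :
    ∃ (σ : EndRing ρ →+* EndRing ρ) (l : EndRing ρ),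
      (∀ c v w, B.1 (c • v) w = B.1 v (σ c • w)) ∧ (∀ v w, B.1 w v = B.1 v (l • w)) ∧
      l * σ l = 1 ∧ ∀ c, σ (σ c) = c := by
  choose s hs using fun c => B.exists_twist hB (B.twistLeft c)
  obtain ⟨l, hl⟩ := B.exists_twist hB (bilFormFlip ρ ρ B)
  have hs' : ∀ c v w, B.1 (c • v) w = B.1 v (s c • w) := hs
  have hl' : ∀ v w, B.1 w v = B.1 v (l • w) := hl
  let σ : EndRing ρ →+* EndRing ρ :=
    { toFun := s
      map_one' := B.eq_of_forall hB fun v w => by rw [← hs', EndRing.one_smul_apply, EndRing.one_smul_apply]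
      map_zero' := B.eq_of_forall hB fun v w => by
        rw [← hs', zero_smul, zero_smul, map_zero, map_zero, LinearMap.zero_apply]
      -- Taking adjoints reverses products; commutativity of `κ` makes it a homomorphism.
      map_mul' := fun a b => B.eq_of_forall hB fun v w => by
        rw [← hs', mul_comm a b, EndRing.mul_smul_apply, hs', hs', EndRing.mul_smul_apply]
      map_add' := fun a b => B.eq_of_forall hB fun v w => by
        rw [← hs', add_smul, add_smul, map_add, map_add, LinearMap.add_apply, hs', hs'] }
  have h1 : l * σ l = 1 := by
    refine B.eq_of_forall hB fun v w => ?_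
    rw [mul_comm, EndRing.mul_smul_apply, EndRing.one_smul_apply]
    change B.1 v (s l • l • w) = _
    rw [← hs', ← hl' (l • v) w, ← hl' w v]
  refine ⟨σ, l, hs', hl', h1, fun c => ?_⟩
  have hl0 : l ≠ 0 := left_ne_zero_of_mul_eq_one h1
  refine mul_right_cancel₀ hl0 (B.eq_of_forall hB fun v w => ?_)
  rw [mul_comm c l, EndRing.mul_smul_apply, EndRing.mul_smul_apply]
  change B.1 v (s (s c) • l • w) = _
  rw [← hs', ← hl', ← hl', hs']

end Adjoint

namespace FinRep

/-- Only characteristic two is in question. There `v ↦ B(v, v)` is additive and invariant, so its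
zero set is a subrepresentation containing every `g v - v`. If it were zero the action would be
trivial, so it is all of `V`. -/
lemma alternating_of_skew {V : FinRep p Γ} [V.ρ.IsIrreducible] (hV : ¬ V.ρ.IsTrivial)
    (B : BilForm V.ρ V.ρ) (hB : ∀ v w, B.1 w v = -B.1 v w) (v : V.carrier) : B.1 v v = 0 := by
  by_cases h2 : (2 : ZMod p) = 0
  · have hadd : ∀ v w, B.1 (v + w) (v + w) = B.1 v v + B.1 w w := fun v w => by
      simp only [map_add, LinearMap.add_apply]
      rw [hB v w]
      ring
    let S : Subrepresentation V.ρ :=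
      { toSubmodule :=
          { carrier := {v | B.1 v v = 0}
            add_mem' := fun {v w} hv hw => by
              change B.1 _ _ = 0
              rw [hadd, show B.1 v v = 0 from hv, show B.1 w w = 0 from hw, add_zero]
            zero_mem' := by
              change B.1 0 0 = 0
              rw [map_zero]
            smul_mem' := fun r v hv => by
              change B.1 _ _ = 0
              rw [map_smul, map_smul, LinearMap.smul_apply, show B.1 v v = 0 from hv, smul_zero,
                smul_zero] }
        apply_mem_toSubmodule := fun g v hv => (B.2 g v v).trans hv }
    rcases eq_bot_or_eq_top S with h | h
    · refine absurd ⟨fun g => LinearMap.ext fun v => ?_⟩ hV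
      have h3 : V.ρ g v - v ∈ S := by
        change B.1 _ _ = 0
        rw [sub_eq_add_neg, hadd, B.2, map_neg, map_neg, LinearMap.neg_apply]
        linear_combination B.1 v v * h2
      rw [h] at h3
      exact sub_eq_zero.1 h3
    · have h3 : v ∈ S := by rw [h]; trivial
      exact h3
  · have h3 : 2 * B.1 v v = 0 := by linear_combination hB v v
    exact (mul_eq_zero.1 h3).resolve_left h2

/-- Every invariant form is `B(·, c ·)` for a unique `c`. Its transpose belongs to `l σ(c)`, and
skew is the same as alternating here. -/
lemma cardAlt_eq_of_adjoint {V : FinRep p Γ} [V.ρ.IsIrreducible] (hV : ¬ V.ρ.IsTrivial)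
    (B : BilForm V.ρ V.ρ) (hB : B.1 ≠ 0) {σ : EndRing V.ρ →+* EndRing V.ρ} {l : EndRing V.ρ}
    (hσ : ∀ c v w, B.1 (c • v) w = B.1 v (σ c • w)) (hl : ∀ v w, B.1 w v = B.1 v (l • w)) :
    V.cardAlt = Nat.card {c : EndRing V.ρ // l * σ c = -c} := by
  have key : ∀ c v w, B.1 w (c • v) = B.1 v ((l * σ c) • w) := fun c v w => by
    rw [mul_comm, EndRing.mul_smul_apply, ← hσ, ← hl]
  have hmem : ∀ C : BilForm V.ρ V.ρ, ∀ c, (∀ v w, C.1 v w = B.1 v (c • w)) →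
      ((∀ v, C.1 v v = 0) ↔ l * σ c = -c) := fun C c hc => by
    constructor
    · intro h0
      refine B.eq_of_forall hB fun v w => ?_
      have h := h0 (v + w)
      simp only [map_add, LinearMap.add_apply, h0] at h
      rw [← key, ← hc, neg_smul, map_neg, ← hc]
      linear_combination h
    · intro h
      refine alternating_of_skew hV C fun v w => ?_
      rw [hc, hc, key, h, neg_smul, map_neg]
  refine Nat.card_congr
    { toFun := fun C => ⟨(B.exists_twist hB C.toBilForm).choose,
        (hmem C.toBilForm _ (B.exists_twist hB C.toBilForm).choose_spec).1 C.2.2⟩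
      invFun := fun c => ⟨(B.twist c.1).1, (B.twist c.1).2,
        (hmem (B.twist c.1) c.1 fun v w => rfl).2 c.2⟩
      left_inv := fun C => ?_
      right_inv := fun c => ?_ }
  · refine Subtype.ext (LinearMap.ext fun v => LinearMap.ext fun w => ?_)
    exact ((B.exists_twist hB C.toBilForm).choose_spec v w).symm
  · refine Subtype.ext (B.eq_of_forall hB fun v w => ?_)
    exact ((B.exists_twist hB (AltForm.toBilForm _)).choose_spec v w).symm

end FinRep

section OverEnd

variable {k G V : Type*} [Field k] [Group G] [AddCommGroup V] [Module k V] [Finite V]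
  {ρ : Representation k G V} [ρ.IsIrreducible]

instance (ρ : Representation k G V) [ρ.IsIrreducible] : Algebra k (EndRing ρ) :=
  RingHom.toAlgebra
    { toFun := fun r => (r • (1 : ρ.IntertwiningMap ρ) : ρ.IntertwiningMap ρ)
      map_one' := Representation.IntertwiningMap.ext (LinearMap.ext fun v => one_smul k v)
      map_mul' := fun r s => Representation.IntertwiningMap.ext
        (LinearMap.ext fun v => mul_smul r s v)
      map_zero' := Representation.IntertwiningMap.ext (LinearMap.ext fun v => zero_smul k v)
      map_add' := fun r s => Representation.IntertwiningMap.ext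
        (LinearMap.ext fun v => add_smul r s v) }

lemma EndRing.smul_smul_apply (r : k) (c : EndRing ρ) (v : V) : (r • c) • v = r • c • v := rfl

lemma EndRing.smul_eq_smul_one (r : k) (v : V) : r • v = (r • (1 : EndRing ρ)) • v := rfl

/-- Composing a form over the endomorphism field with a linear functional. -/
def BilForm.ofOverEnd (ℓ : EndRing ρ →ₗ[k] k) (b : BilForm (overEnd ρ) (overEnd ρ)) :
    BilForm ρ ρ :=
  ⟨LinearMap.mk₂ k (fun v w => ℓ (b.1 v w)) (by simp)
    (fun r v w => by
      rw [EndRing.smul_eq_smul_one (ρ := ρ) r v, map_smul, LinearMap.smul_apply, smul_eq_mul,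
        smul_mul_assoc, one_mul, map_smul])
    (by simp)
    (fun r v w => by
      rw [EndRing.smul_eq_smul_one (ρ := ρ) r w, map_smul, smul_eq_mul,
        smul_mul_assoc, one_mul, map_smul]),
    fun g v w => congrArg ℓ (b.2 g v w)⟩

lemma BilForm.ofOverEnd_apply (ℓ : EndRing ρ →ₗ[k] k) (b : BilForm (overEnd ρ) (overEnd ρ))
    (v w : V) : (b.ofOverEnd ℓ).1 v w = ℓ (b.1 v w) := rfl

lemma BilForm.ofOverEnd_smul (ℓ : EndRing ρ →ₗ[k] k) (b : BilForm (overEnd ρ) (overEnd ρ))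
    (c : EndRing ρ) (v w : V) : (b.ofOverEnd ℓ).1 v (c • w) = ℓ (b.1 v w * c) := by
  rw [BilForm.ofOverEnd_apply, map_smul, smul_eq_mul, mul_comm]

lemma BilForm.ofOverEnd_ne_zero {ℓ : EndRing ρ →ₗ[k] k}
    (hℓ : ∀ x, (∀ c, ℓ (x * c) = 0) → x = 0) {b : BilForm (overEnd ρ) (overEnd ρ)}
    (hb : b.1 ≠ 0) : (b.ofOverEnd ℓ).1 ≠ 0 := by
  refine fun h => hb (LinearMap.ext fun v => LinearMap.ext fun w => hℓ _ fun c => ?_)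
  rw [← BilForm.ofOverEnd_smul, h]
  rfl

/-- If the endomorphism field is self-adjoint for a form, the form comes from a form over the
endomorphism field. -/
lemma BilForm.exists_overEnd (B : BilForm ρ ρ) (hB : B.1 ≠ 0)
    (h : ∀ (c : EndRing ρ) v w, B.1 (c • v) w = B.1 v (c • w)) :
    ∃ b : BilForm (overEnd ρ) (overEnd ρ), b.1 ≠ 0 := by
  obtain ⟨ℓ, hℓ⟩ := exists_nondegenerate_functional k (EndRing ρ)
  let ev : V → V → Module.Dual k (EndRing ρ) := fun v w =>
    { toFun := fun c => B.1 v (c • w)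
      map_add' := fun c d => by rw [add_smul, map_add]
      map_smul' := fun r c => by rw [EndRing.smul_smul_apply, map_smul]; rfl }
  -- The element `β v w` of `κ` represents the functional `c ↦ B(v, c w)`. Self-adjointness of `κ`
  -- makes `β` linear over `κ` in the first variable.
  choose β hβ using fun v w => functional_eq_mul hℓ (ev v w)
  have key : ∀ v w c, ℓ (β v w * c) = B.1 v (c • w) := fun v w c => (hβ v w c).symm
  have hext : ∀ x y : EndRing ρ, (∀ c, ℓ (x * c) = ℓ (y * c)) → x = y := fun x y hxy =>
    sub_eq_zero.1 (hℓ _ fun c => by rw [sub_mul, map_sub, hxy, sub_self])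
  let b : V →ₗ[EndRing ρ] V →ₗ[EndRing ρ] EndRing ρ := LinearMap.mk₂ (EndRing ρ) β
    (fun v v' w => hext _ _ fun c => by
      rw [add_mul, map_add, key, key, key, map_add, LinearMap.add_apply])
    (fun d v w => hext _ _ fun c => by
      rw [smul_eq_mul, key, h, mul_assoc, mul_left_comm, key, EndRing.mul_smul_apply])
    (fun v w w' => hext _ _ fun c => by
      rw [add_mul, map_add, key, key, key, smul_add, map_add])
    (fun d v w => hext _ _ fun c => by
      rw [smul_eq_mul, key, mul_assoc, mul_left_comm, key, ← EndRing.mul_smul_apply, mul_comm])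
  refine ⟨⟨b, fun g v w => hext _ _ fun c => ?_⟩, fun hb => hB ?_⟩
  · change ℓ (β (ρ g v) (ρ g w) * c) = ℓ (β v w * c)
    rw [key, key, BilForm.isIntertwining_endRing, B.2]
  · refine LinearMap.ext fun v => LinearMap.ext fun w => ?_
    have h1 : β v w = 0 :=
      congrArg (fun b : V →ₗ[EndRing ρ] V →ₗ[EndRing ρ] EndRing ρ => b v w) hb
    have h2 := key v w 1
    rw [h1, zero_mul, map_zero] at h2
    exact h2.symm

end OverEnd

namespace FinRep

/-- Allows averaging over `Γ` for representations over `κ`, as the definition of `ε` requires. -/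
lemma cast_card_endRing_ne_zero [Finite Γ] (hp : ¬ p ∣ Nat.card Γ) (V : FinRep p Γ)
    [V.ρ.IsIrreducible] : (Nat.card Γ : EndRing V.ρ) ≠ 0 := by
  intro h
  have := nontrivial_of_isIrreducible V.ρ
  obtain ⟨v, hv⟩ := exists_ne (0 : V.carrier)
  have h1 : (Nat.card Γ : EndRing V.ρ) • v = 0 := by rw [h, zero_smul]
  rw [Nat.cast_smul_eq_nsmul, ← Nat.cast_smul_eq_nsmul (ZMod p)] at h1
  exact hp ((ZMod.natCast_eq_zero_iff _ _).1 ((smul_eq_zero.1 h1).resolve_right hv))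

/-- A form induced from the endomorphism field: the relation between the sign and the number of
invariant alternating forms. -/
lemma exists_sign_of_overEnd {V : FinRep p Γ} [V.ρ.IsIrreducible] (hV : ¬ V.ρ.IsTrivial)
    (b : BilForm (overEnd V.ρ) (overEnd V.ρ)) (hb : b.1 ≠ 0) :
    V.cardAlt = V.q ∧ (∀ v, b.1 v v = 0) ∨ V.cardAlt = 1 ∧ ¬ ∀ v, b.1 v v = 0 := by
  obtain ⟨ℓ, hℓ⟩ := exists_nondegenerate_functional (ZMod p) (EndRing V.ρ)
  set B := b.ofOverEnd ℓ with hBdef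
  have hB : B.1 ≠ 0 := BilForm.ofOverEnd_ne_zero hℓ hb
  obtain ⟨σ, l, hσ, hl, h1, -⟩ := B.exists_adjoint hB
  -- As `b` is `κ`-bilinear the adjoint involution is trivial, so `l² = 1` and `l = ±1`. In
  -- characteristic two both signs fall under the case `l = -1`.
  have hid : ∀ c, σ c = c := fun c => B.eq_of_forall hB fun v w => by
    rw [← hσ, hBdef, BilForm.ofOverEnd_apply, BilForm.ofOverEnd_apply, map_smul, map_smul]
    rfl
  rw [cardAlt_eq_of_adjoint hV B hB hσ hl]
  simp only [hid] at h1 ⊢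
  by_cases hl1 : l = -1
  · left
    constructor
    · rw [hl1]
      exact Nat.card_congr (Equiv.subtypeUnivEquiv fun c => neg_one_mul c)
    · refine fun v => hℓ _ fun c => ?_
      rw [← BilForm.ofOverEnd_smul, ← BilForm.twist_apply]
      refine alternating_of_skew hV _ (fun v w => ?_) v
      rw [BilForm.twist_apply, BilForm.twist_apply, ← hBdef, hl, hσ, hid, hl1, neg_smul,
        EndRing.one_smul_apply, smul_neg, map_neg]
  · right
    have hl' : l = 1 := (mul_self_eq_one_iff.1 h1).resolve_right hl1
    constructor
    · rw [Nat.card_eq_one_iff_unique]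
      have h0 : ∀ c : EndRing V.ρ, l * c = -c → c = 0 := fun c hc => by
        by_contra h
        exact hl1 (mul_right_cancel₀ h (hc.trans (neg_one_mul c).symm))
      exact ⟨⟨fun c d => Subtype.ext ((h0 _ c.2).trans (h0 _ d.2).symm)⟩, ⟨⟨0, by simp⟩⟩⟩
    · intro hall
      refine hl1 (B.eq_of_forall hB fun v w => ?_)
      rw [← hl, neg_smul, EndRing.one_smul_apply, map_neg, hBdef, BilForm.ofOverEnd_apply,
        BilForm.ofOverEnd_apply, ← map_neg]
      have h2 := hall (v + w)
      simp only [map_add, LinearMap.add_apply, hall, zero_add, add_zero] at h2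
      exact congrArg ℓ (eq_neg_of_add_eq_zero_left h2)

/-- The number of invariant alternating forms on a self-dual irreducible representation in terms
of its sign. -/
lemma cardAlt_of_eps [Finite Γ] (hp : ¬ p ∣ Nat.card Γ) {V : FinRep p Γ} [V.ρ.IsIrreducible]
    (hV : ¬ V.ρ.IsTrivial) (hd : IsDual V V) :
    (eps V.ρ = -1 ∧ V.cardAlt = V.q) ∨ (eps V.ρ = 1 ∧ V.cardAlt = 1) ∨
      (eps V.ρ = 0 ∧ V.cardAlt ^ 2 = V.q) := by
  have hG := cast_card_endRing_ne_zero hp V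
  unfold eps
  split_ifs with h1 h2 <;> rw [invariants_exteriorSquare_ne_bot_iff hG] at h1 <;>
    try rw [invariants_tprod_ne_bot_iff hG] at h2
  · left
    obtain ⟨b, hb⟩ := h1
    refine ⟨rfl, ?_⟩
    rcases exists_sign_of_overEnd hV b.toBilForm hb with h | h
    · exact h.1
    · exact absurd b.2.2 h.2
  · right; left
    obtain ⟨b, hb⟩ := h2
    refine ⟨rfl, ?_⟩
    rcases exists_sign_of_overEnd hV b hb with h | h
    · exact absurd ⟨⟨b.1, b.2, h.2⟩, hb⟩ h1
    · exact h.1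
  · right; right
    refine ⟨rfl, ?_⟩
    obtain ⟨B, hB⟩ := (isDual_iff_exists_bilForm V V).1 hd
    obtain ⟨σ, l, hσ, hl, hl1, hσσ⟩ := B.exists_adjoint hB
    rw [cardAlt_eq_of_adjoint hV B hB hσ hl]
    refine card_sq_of_involution σ hσσ ?_ l hl1
    -- If `σ` were the identity, `B` would come from a `κ`-bilinear invariant form, which `ε = 0`
    -- excludes. So `σ` is a genuine involution and `card_sq_of_involution` applies.
    by_contra! hid
    exact h2 (B.exists_overEnd hB fun c v w => by rw [hσ, hid])

end FinRep

end PTorsion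

end

/-! ### From multiplicity vectors to the measure -/

noncomputable section

namespace PTorsion

open Function FinRep

lemma eta_eq_qPoch (q m : ℕ) : eta q m = qPoch (q : ℝ)⁻¹ m := by
  rw [eta, qPoch, ← Finset.Ico_add_one_right_eq_Icc, Finset.prod_Ico_eq_prod_range]
  simp only [add_tsub_cancel_right, add_comm 1, inv_pow]

lemma etaInf_eq_qPochInf (q : ℕ) : etaInf q = qPochInf (q : ℝ)⁻¹ := by
  simp only [etaInf, qPochInf, inv_pow]

variable {p : ℕ} [Fact p.Prime] {Γ : Type*} [Group Γ]

namespace FinRep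

/-- In all three cases the number of alternating forms is `q^((1-ε)/2)`, and `-un - (ε+1)/2 - l =
(1-ε)/2 - (un + 1 + l)`. -/
lemma selfDualFactor_eq [Finite Γ] (hp : ¬ p ∣ Nat.card Γ) (u : ℕ) {V : FinRep p Γ}
    [V.ρ.IsIrreducible] (hV : ¬ V.ρ.IsTrivial) (hd : IsDual V V) :
    selfDualFactor u V =
      ∏' l : ℕ, (1 + (V.cardAlt : ℝ) / (V.q : ℝ) ^ (u * V.n + 1) * (V.q : ℝ)⁻¹ ^ l)⁻¹ := by
  have hq : (0 : ℝ) < V.q := by exact_mod_cast zero_lt_two.trans_le V.two_le_q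
  have hs : (V.q : ℝ) ^ ((1 - (eps V.ρ : ℝ)) / 2) = V.cardAlt := by
    rcases cardAlt_of_eps hp hV hd with ⟨h1, h2⟩ | ⟨h1, h2⟩ | ⟨h1, h2⟩
    · rw [h1, h2]
      norm_num
    · rw [h1, h2]
      norm_num
    · rw [h1, ← h2, Nat.cast_pow, ← Real.rpow_natCast, ← Real.rpow_mul (Nat.cast_nonneg _)]
      norm_num
  unfold selfDualFactor
  congr 1
  funext l
  have h : -((u * V.n : ℕ) : ℝ) - ((eps V.ρ : ℝ) + 1) / 2 - (l : ℝ) =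
      (1 - (eps V.ρ : ℝ)) / 2 + -((u * V.n + 1 + l : ℕ) : ℝ) := by
    push_cast
    ring
  rw [h, Real.rpow_add hq, hs, Real.rpow_neg hq.le, Real.rpow_natCast, pow_add, mul_inv, inv_pow,
    div_eq_mul_inv, mul_assoc]

lemma dualPairFactor_eq (u : ℕ) (V : FinRep p Γ) {a b : ℕ}
    (h : |(a : ℤ) - (b : ℤ)| ≤ (u : ℤ) * (V.n : ℤ)) :
    dualPairFactor u V a b = qPochInf (V.q : ℝ)⁻¹ * qPoch (V.q : ℝ)⁻¹ (2 * (u * V.n)) *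
      (qPochInv (V.q : ℝ)⁻¹ ((u * V.n : ℕ) + b - a) *
        qPochInv (V.q : ℝ)⁻¹ ((u * V.n : ℕ) + a - b)) := by
  rw [abs_le] at h
  have h1 : ((u * V.n : ℕ) : ℤ) + b - a = ((u * V.n + b - a : ℕ) : ℤ) := by
    push_cast [Nat.cast_sub (show a ≤ u * V.n + b by zify; linarith)]
    ring
  have h2 : ((u * V.n : ℕ) : ℤ) + a - b = ((u * V.n + a - b : ℕ) : ℤ) := by
    push_cast [Nat.cast_sub (show b ≤ u * V.n + a by zify; linarith)]
    ring
  rw [h1, h2, qPochInv_natCast, qPochInv_natCast, dualPairFactor, eta_eq_qPoch, eta_eq_qPoch,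
    eta_eq_qPoch, etaInf_eq_qPochInf, div_eq_mul_inv, mul_inv]

end FinRep

variable {c : ℕ} {W : Fin c → FinRep p Γ}

namespace IsListOfNontrivialIrreps

lemma massFormula_eq [Finite Γ] (hp : ¬ p ∣ Nat.card Γ) (hW : IsListOfNontrivialIrreps W) {u : ℕ}
    (hu : 0 < u) (f : Fin c → ℕ)
    (hf : ∀ i j, IsDual (W i) (W j) → |(f i : ℤ) - (f j : ℤ)| ≤ (u : ℤ) * ((W i).n : ℤ)) :
    massFormula u W hW.irreducible f = (hW.momentData hu).mass f := by
  classical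
  set D := hW.momentData hu with hD
  have hirr := hW.irreducible
  have hsurj : ((prodPow W f).cardAut : ℝ) =
      (∏ i with D.σ i = i, (surjCount (D.q i) (f i) (f i) : ℝ)) *
        ∏ i with i < D.σ i, (surjCount (D.q i) (f i) (f i) : ℝ) *
          surjCount (D.q i) (f (D.σ i)) (f (D.σ i)) := by
    rw [cardAut_eq_cardSur, hW.cardSur_prodPow, Nat.cast_prod,
      prod_eq_prod_involution D.involutive]
    congr 1
    refine Finset.prod_congr rfl fun i _ => ?_
    congr 3
    exact D.q_σ i
  have h1 : (Finset.univ.filter fun i => IsDual (W i) (W i)) =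
      Finset.univ.filter fun i => D.σ i = i := by
    ext i
    simp only [Finset.mem_filter, Finset.mem_univ, true_and, hW.isDual_iff]
    rfl
  have h2 : ∏ ij : Fin c × Fin c with ij.1 < ij.2 ∧ IsDual (W ij.1) (W ij.2),
      dualPairFactor u (W ij.1) (f ij.1) (f ij.2) =
      ∏ i with i < D.σ i, dualPairFactor u (W i) (f i) (f (D.σ i)) := by
    -- The dual index is unique, so a dual pair is determined by its smaller member.
    refine Finset.prod_nbij' (fun ij => ij.1) (fun i => (i, D.σ i)) ?_ ?_ ?_ ?_ ?_
    · rintro ⟨i, j⟩ h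
      simp only [Finset.mem_filter, Finset.mem_univ, true_and, hW.isDual_iff] at h ⊢
      exact h.1.trans_eq h.2.symm
    · intro i h
      simp only [Finset.mem_filter, Finset.mem_univ, true_and, hW.isDual_iff] at h ⊢
      exact ⟨h, rfl⟩
    · rintro ⟨i, j⟩ h
      simp only [Finset.mem_filter, Finset.mem_univ, true_and, hW.isDual_iff] at h ⊢
      exact Prod.ext rfl h.2
    · intro i _
      rfl
    · rintro ⟨i, j⟩ h
      simp only [Finset.mem_filter, Finset.mem_univ, true_and, hW.isDual_iff] at h ⊢
      rw [← h.2]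
      rfl
  have h3 : ∏ i with D.σ i = i, selfDualFactor u (W i) = ∏ i with D.σ i = i,
      ∏' l : ℕ, (1 + (D.s i : ℝ) / (D.q i : ℝ) ^ (D.a i + 1) * (D.q i : ℝ)⁻¹ ^ l)⁻¹ := by
    refine Finset.prod_congr rfl fun i hi => ?_
    exact selfDualFactor_eq hp u (hW.nontrivial i)
      ((hW.isDual_iff i i).2 (Finset.mem_filter.1 hi).2)
  have h4 : ∏ i with i < D.σ i, dualPairFactor u (W i) (f i) (f (D.σ i)) = ∏ i with i < D.σ i,
      (qPochInf (D.q i : ℝ)⁻¹ * qPoch (D.q i : ℝ)⁻¹ (2 * D.a i) *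
      (qPochInv (D.q i : ℝ)⁻¹ (D.a i + f (D.σ i) - f i) *
        qPochInv (D.q i : ℝ)⁻¹ (D.a i + f i - f (D.σ i)))) :=
    Finset.prod_congr rfl fun i _ =>
      dualPairFactor_eq u (W i) (hf i _ ((hW.isDual_iff i _).2 rfl))
  have h5 : massFormula u W hW.irreducible f = D.moment f / (prodPow W f).cardAut *
      (∏ i with D.σ i = i, selfDualFactor u (W i)) *
      ∏ i with i < D.σ i, dualPairFactor u (W i) (f i) (f (D.σ i)) := by
    rw [← h1, ← h2, ← hW.moment_eq hp hu, div_div, massFormula]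
  rw [h5, h3, h4, hsurj, MomentData.moment, MomentData.mass]
  simp only [mass₁, mass₂, Finset.prod_mul_distrib, Finset.prod_div_distrib]
  ring

/-- When the bound fails for a pair, one of the two `qPochInv` arguments in its block is negative.
-/
lemma mass_eq_zero (hW : IsListOfNontrivialIrreps W) {u : ℕ} (hu : 0 < u) (f : Fin c → ℕ)
    (hf : ¬ ∀ i j, IsDual (W i) (W j) → |(f i : ℤ) - (f j : ℤ)| ≤ (u : ℤ) * ((W i).n : ℤ)) :
    (hW.momentData hu).mass f = 0 := by
  push Not at hf
  obtain ⟨i, j, hd, hij⟩ := hf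
  have hi := hW.irreducible i
  have hj := hW.irreducible j
  wlog h : i < j generalizing i j
  · refine this j i hd.symm ?_ hj hi ?_
    · rw [hd.n_eq, abs_sub_comm]
      exact hij
    · refine lt_of_le_of_ne (not_lt.1 h) fun e => ?_
      subst e
      rw [sub_self, abs_zero] at hij
      exact absurd hij (not_lt.2 (by positivity))
  have hσ := (hW.isDual_iff i j).1 hd
  subst hσ
  refine mul_eq_zero_of_right _ (Finset.prod_eq_zero (i := i) (Finset.mem_filter.2 ⟨Finset.mem_univ i, h⟩) ?_)
  change mass₂ (W i).q (u * (W i).n) (f i) (f (hW.dualIndex i)) = 0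
  rw [mass₂]
  refine mul_eq_zero_of_right _ (mul_eq_zero_of_right _ ?_)
  rw [lt_abs] at hij
  rcases hij with hij | hij
  · rw [qPochInv_of_neg (by push_cast; linarith), zero_mul]
  · rw [mul_comm, qPochInv_of_neg (by push_cast; linarith), zero_mul]

/-- Isomorphism classes correspond to multiplicity vectors. -/
lemma bijective_isoClass [Finite Γ] (hp : ¬ p ∣ Nat.card Γ) (hW : IsListOfNontrivialIrreps W) :
    Bijective fun f => isoClass (prodPow W f) (hW.prodPow_invariants f) := by
  constructor
  -- Surjections onto `prodPow W g` exist from itself, but not from `prodPow W f` unless `g ≤ f`.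
  -- The choice `u = 1` below is immaterial, since `surj` does not involve `u`.
  · have hle : ∀ f g, Iso (prodPow W f) (prodPow W g) → g ≤ f := fun f g h => by
      by_contra hfg
      have h1 := h.cardSur_eq (prodPow W g)
      rw [hW.cardSur_prodPow, hW.cardSur_prodPow] at h1
      have h2 := (hW.momentData one_pos).surj_self_pos g
      have h3 := (hW.momentData one_pos).surj_eq_zero hfg
      rw [MomentData.surj] at h2 h3
      exact h2.ne' (h1.symm.trans h3)
    intro f g h
    have h' : Iso (prodPow W f) (prodPow W g) := Quotient.exact (s := isoSetoid p Γ) h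
    exact le_antisymm (hle _ _ h'.symm) (hle _ _ h')
  · intro X
    induction X using Quotient.inductionOn with
    | h V =>
      obtain ⟨f, hf⟩ := exists_iso_prodPow hp hW V.1 V.2
      exact ⟨f, Quotient.sound (s := isoSetoid p Γ) hf.symm⟩

/-- The isomorphism classes of representations without invariants, in terms of multiplicities. -/
def equivRGamma [Finite Γ] (hp : ¬ p ∣ Nat.card Γ) (hW : IsListOfNontrivialIrreps W) :
    (Fin c → ℕ) ≃ RGamma p Γ :=
  Equiv.ofBijective _ (hW.bijective_isoClass hp)

instance : MeasurableSingletonClass (RGamma p Γ) := ⟨fun _ => trivial⟩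

/-- `R_Γ` is countable and discrete, so integrals are sums over multiplicity vectors; both sides
depend only on the class of `V`, so products of irreducibles suffice as tests. -/
lemma hasMoments_iff [Finite Γ] (hp : ¬ p ∣ Nat.card Γ) (hW : IsListOfNontrivialIrreps W)
    {u : ℕ} (hu : 0 < u) (ν : MeasureTheory.Measure (RGamma p Γ)) :
    HasMoments u ν ↔ ∀ f, ∑' e, ν {hW.equivRGamma hp e} * ((hW.momentData hu).surj e f : ℝ≥0∞) =
      ENNReal.ofReal ((hW.momentData hu).moment f) := by
  have hcount : Countable (RGamma p Γ) := (hW.equivRGamma hp).symm.injective.countable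
  have hint : ∀ f, ∫⁻ X, (X.cardSur (prodPow W f) : ℝ≥0∞) ∂ν =
      ∑' e, ν {hW.equivRGamma hp e} * ((hW.momentData hu).surj e f : ℝ≥0∞) := fun f => by
    rw [MeasureTheory.lintegral_countable', ← (hW.equivRGamma hp).tsum_eq]
    refine tsum_congr fun e => ?_
    rw [mul_comm]
    congr 2
    exact hW.cardSur_prodPow e f
  have hmom : ∀ f, ((prodPow W f).cardWedgeInv : ℝ≥0∞) /
      (Nat.card (prodPow W f).carrier : ℝ≥0∞) ^ u =
      ENNReal.ofReal ((hW.momentData hu).moment f) := fun f => by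
    have hpos : (0 : ℝ) < (Nat.card (prodPow W f).carrier : ℝ) ^ u := by
      have : 0 < Nat.card (prodPow W f).carrier := Nat.card_pos
      positivity
    rw [← hW.moment_eq hp hu, ENNReal.ofReal_div_of_pos hpos, ENNReal.ofReal_natCast,
      ENNReal.ofReal_pow (Nat.cast_nonneg _), ENNReal.ofReal_natCast]
  constructor
  · intro h f
    rw [← hint, ← hmom]
    exact h _ (hW.prodPow_invariants f)
  · intro h V hV
    obtain ⟨f, hf⟩ := exists_iso_prodPow hp hW V hV
    have h1 := h f
    rw [← hint, ← hmom, cardWedgeInv_eq hp, ← hf.cardAlt_eq, ← cardWedgeInv_eq hp,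
      ← hf.card_eq] at h1
    rw [← h1]
    refine MeasureTheory.lintegral_congr fun X => ?_
    congr 1
    induction X using Quotient.inductionOn with
    | h Y => exact cardSur_congr_right Y.1 hf

lemma measure_eq_of_hasMoments [Finite Γ] (hp : ¬ p ∣ Nat.card Γ)
    (hW : IsListOfNontrivialIrreps W) {u : ℕ} (hu : 0 < u)
    {ν : MeasureTheory.Measure (RGamma p Γ)} (h : HasMoments u ν) (f : Fin c → ℕ) :
    ν {hW.equivRGamma hp f} = ENNReal.ofReal ((hW.momentData hu).mass f) :=
  congrFun ((hW.momentData hu).eq_of_moments ((hW.hasMoments_iff hp hu ν).1 h)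
    (hW.momentData hu).tsum_mass) f

lemma existsUnique_hasMoments [Finite Γ] (hp : ¬ p ∣ Nat.card Γ)
    (hW : IsListOfNontrivialIrreps W) {u : ℕ} (hu : 0 < u) :
    ∃! ν : MeasureTheory.Measure (RGamma p Γ), HasMoments u ν := by
  have hcount : Countable (RGamma p Γ) := (hW.equivRGamma hp).symm.injective.countable
  -- The measure with the explicit masses as point masses; its moments are `tsum_mass`.
  have hex : HasMoments u (MeasureTheory.Measure.sum fun f =>
      ENNReal.ofReal ((hW.momentData hu).mass f) •
        MeasureTheory.Measure.dirac (hW.equivRGamma hp f)) := by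
    rw [hW.hasMoments_iff hp hu]
    intro f
    rw [← (hW.momentData hu).tsum_mass f]
    refine tsum_congr fun e => ?_
    congr 1
    rw [MeasureTheory.Measure.sum_apply _ (measurableSet_singleton _), tsum_eq_single e]
    · simp
    · intro e' he'
      simp [(hW.equivRGamma hp).injective.ne he']
  refine ⟨_, hex, fun ν hν => MeasureTheory.Measure.ext_of_singleton fun X => ?_⟩
  obtain ⟨f, rfl⟩ := (hW.equivRGamma hp).surjective X
  rw [hW.measure_eq_of_hasMoments hp hu hν, hW.measure_eq_of_hasMoments hp hu hex]

end IsListOfNontrivialIrreps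

end PTorsion

end

theorem theorem1p2 (Γ : Type*) [Group Γ] [Finite Γ] (p : ℕ) [Fact p.Prime]
    (hp : ¬ p ∣ Nat.card Γ) (u : ℕ) (hu : 0 < u) :
    (∃! ν : MeasureTheory.Measure (PTorsion.RGamma p Γ), PTorsion.HasMoments u ν) ∧
    ∀ ν : MeasureTheory.Measure (PTorsion.RGamma p Γ), PTorsion.HasMoments u ν →
    ∀ (c : ℕ) (W : Fin c → PTorsion.FinRep p Γ) (hW : PTorsion.IsListOfNontrivialIrreps W)
      (f : Fin c → ℕ),
      ((∀ i j, PTorsion.FinRep.IsDual (W i) (W j) →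
          |(f i : ℤ) - (f j : ℤ)| ≤ (u : ℤ) * ((W i).n : ℤ)) →
        ν {PTorsion.isoClass (PTorsion.FinRep.prodPow W f) (hW.prodPow_invariants f)} =
          ENNReal.ofReal (PTorsion.massFormula u W hW.irreducible f)) ∧
      (¬ (∀ i j, PTorsion.FinRep.IsDual (W i) (W j) →
          |(f i : ℤ) - (f j : ℤ)| ≤ (u : ℤ) * ((W i).n : ℤ)) →
        ν {PTorsion.isoClass (PTorsion.FinRep.prodPow W f) (hW.prodPow_invariants f)} = 0) := by
  -- Existence and uniqueness mention no list of irreducibles, so one must be supplied; the formula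
  -- for the masses is then proved for an arbitrary list.
  obtain ⟨c₀, W₀, hW₀⟩ := PTorsion.exists_isListOfNontrivialIrreps (p := p) (Γ := Γ)
  refine ⟨hW₀.existsUnique_hasMoments hp hu, fun ν hν c W hW f => ?_⟩
  have h := hW.measure_eq_of_hasMoments hp hu hν f
  constructor
  · intro hf
    rw [hW.massFormula_eq hp hu f hf]
    exact h
  · intro hf
    rw [hW.mass_eq_zero hu f hf, ENNReal.ofReal_zero] at h
    exact h
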